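/- **Conventions.** A CNF formula $A$ over variables $x_1,\dots,x_n$ (an $n$-variate CNF; not every variable has to occur) is a finite set of clauses; its size $|A|$ is its number of literal occurrences. For a set $F$ of Boolean functions $\{0,1\}^n\to\{0,1\}$, a *tree-like $\mathrm{Sem}(F)$ refutation of $A$ of length $t$* is a sequence $f_1,\dots,f_t$ of Boolean functions on $\{0,1\}^n$ such that $f_t\equiv 1$, each $f_i$ is either the indicator function of the set of assignments falsifying some clause of $A$, or lies in $F$ and is derived from some lines $f_j,f_\ell$ with $j,\ell<i$ such that $f_i(\alpha)=1$ implies $f_j(\alpha)=1$ or $f_\ell(\alpha)=1$ for all $\alpha$; and each line of the sequence is used in at most one derivation step. For positive integers $k,c,m$ let $N=m^c$ and let $G$ be a $k$-partite graph whose blocks $V_1,\dots,V_k$ have size $N$, $V_i=\{v_{i,\alpha}:\alpha\in\{0,\dots,m-1\}^c\}$. The *interpolated clique formula* $\mathrm{bclique}_c(G,k)$ has variables $x_{i,j,a}$ ($i\in[k]$, $j\in[c]$, $0\le a<m$) and the clauses $C_u\vee C_v$ for all pairs $u\ne v$ of non-adjacent vertices of $G$, where $C_{v_{i,\alpha}}=\bigvee_{j}\overline{x}_{i,j,\alpha_j}$,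 and $\bigvee_{a} x_{i,j,a}$ for all $i\in[k]$, $j\in[c]$. It is satisfiable if and only if $G$ contains a $k$-clique. **Theorem 1.3.** For every $0<\varepsilon<1$ there is $\varepsilon_0>0$ such that for every function $s$ with $n^{2-\varepsilon}\le s(n)\le 2^{n^{1-\varepsilon}}$ for all large $n$ there are integers $m=m(n)$ and $c=c(n)$ with the following properties. Put $$N=m^c,\quad D=\lfloor(\log_2 N)^{\varepsilon_0}\rfloor,\quad k=2D,\quad M=\Big\lceil N^{-2/D}\tbinom k2N^2\Big\rceil .$$ For all large $n$ we have $s(n)\le N^2\le s(n)^{1+\varepsilon}$ and $kcm\le n$, so that the $kcm$ variables $x_{i,j,a}$ can be taken among $x_1,\dots,x_n$; fix such a choice, and let $\mathcal A_n$ be the set of the $n$-variate formulas $\mathrm{bclique}_c(G,k)$ where $G$ ranges over all $k$-partite graphs with blocks of size $N$ and exactly $M$ edges. The choice can be made so that 1. $|A|\le s(n)^{1+\varepsilon}$ for all $A\in\mathcal A_n$ and all large $n$; 2. a uniformly random $A\in\mathcal A_n$ is unsatisfiable with probability tending to $1$ as $n\to\infty$; 3. for every sequence of sets $F_n$ of $n$-variate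 Boolean functions with $|F_n|\le\exp(s(n))$ for all large $n$, and for every constant $K$, with probability tending to $1$ as $n\to\infty$ every tree-like $\mathrm{Sem}(F_n)$ refutation of a uniformly random $A\in\mathcal A_n$ has length at least $|A|^K$. -/

import Mathlib

open Filter Topology

/-- Total Boolean assignments to the variables in `V`. -/
abbrev Assignment (V : Type) : Type := V → Bool

/-- `n`-variate Boolean functions. As a proof line, `f` rules out the assignments `α` with
`f α = true`. -/
abbrev BoolFn (n : ℕ) : Type := Assignment (Fin n) → Bool

/-- A clause over the variables `V`: a finite set of literals. The pair `(v, true)` is the positive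
literal of `v`, and `(v, false)` is the negative one. -/
abbrev Clause (V : Type) : Type := Finset (V × Bool)

/-- A CNF formula over the variables `V`: a finite set of clauses. -/
abbrev CNF (V : Type) : Type := Finset (Clause V)

/-- The assignment `α` satisfies the clause `C`. -/
def Clause.SatBy {V : Type} (C : Clause V) (α : Assignment V) : Prop :=
  ∃ l ∈ C, α l.1 = l.2

/-- Some assignment satisfies every clause of `A`. -/
def CNF.Satisfiable {V : Type} (A : CNF V) : Prop :=
  ∃ α : Assignment V, ∀ C ∈ A, Clause.SatBy C α

/-- The size of a CNF formula: its number of literal occurrences. -/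
def CNF.size {V : Type} (A : CNF V) : ℕ :=
  ∑ C ∈ A, C.card

/-- The sequence `f 0, …, f t` of `t + 1` proof lines is a tree-like semantic refutation of the
`n`-variate CNF formula `A` over the set of lines `F`. The last line is constant `1`. A line
with `prem i = none` is an axiom, i.e. the indicator of the falsifying assignments of a clause of
`A`. A line with `prem i = some (j, k)` lies in `F`, and is semantically derived from the
earlier lines `j` and `k` (possibly equal). Every line is used in at most one derivation step. -/
def IsTreeLikeRefutation {n t : ℕ} (F : Finset (BoolFn n)) (A : CNF (Fin n))
    (f : Fin (t + 1) → BoolFn n) : Prop :=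
  (∀ α, f (Fin.last t) α = true) ∧
  ∃ prem : Fin (t + 1) → Option (Fin (t + 1) × Fin (t + 1)),
    (∀ i, prem i = none → ∃ C ∈ A, ∀ α, f i α = true ↔ ¬ Clause.SatBy C α) ∧
    (∀ i j k, prem i = some (j, k) →
      f i ∈ F ∧ j < i ∧ k < i ∧ ∀ α, f i α = true → f j α = true ∨ f k α = true) ∧
    (∀ j i i', (∃ p, prem i = some p ∧ (j = p.1 ∨ j = p.2)) →
      (∃ p, prem i' = some p ∧ (j = p.1 ∨ j = p.2)) → i = i')

/-- Every tree-like semantic refutation of `A` over the set of lines `F` has length at least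
`L`. -/
def RequiresLength {n : ℕ} (F : Finset (BoolFn n)) (A : CNF (Fin n)) (L : ℕ) : Prop :=
  ∀ (t : ℕ) (f : Fin (t + 1) → BoolFn n), IsTreeLikeRefutation F A f → L ≤ t + 1

/-- The vertices of a `k`-partite graph with blocks of size `m ^ c`: a block together with the `c`
base-`m` coordinates of the vertex inside of the block. -/
abbrev BlockVertex (k c m : ℕ) : Type := Fin k × (Fin c → Fin m)

/-- The names of the variables `x_{i,j,a}` of the interpolated clique formula: "the `j`-th
coordinate of the vertex chosen from block `i` is `a`". -/
abbrev CliqueVar (k c m : ℕ) : Type := Fin k × Fin c × Fin m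

/-- The clause which states that `u` is not the vertex chosen from its block. Here and below,
`x` says which of the variables `V` serve as the variables `x_{i,j,a}`. -/
def nodeClause {V : Type} [DecidableEq V] {k c m : ℕ} (x : CliqueVar k c m ↪ V)
    (u : BlockVertex k c m) : Clause V :=
  Finset.univ.image fun j : Fin c => (x (u.1, j, u.2 j), false)

/-- The clause which states that coordinate `j` of block `i` takes some value. -/
def rangeClause {V : Type} [DecidableEq V] {k c m : ℕ} (x : CliqueVar k c m ↪ V)
    (i : Fin k) (j : Fin c) : Clause V :=
  Finset.univ.image fun a : Fin m => (x (i, j, a), true)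

open Classical in
/-- The interpolated (`c`-ary) block `k`-clique formula of `G`: an edge axiom for every pair of
non-adjacent vertices, and a range axiom for every coordinate of every block. -/
noncomputable def cliqueFormula {V : Type} [DecidableEq V] {k c m : ℕ} (x : CliqueVar k c m ↪ V)
    (G : SimpleGraph (BlockVertex k c m)) : CNF V :=
  ((Finset.univ.filter fun e : BlockVertex k c m × BlockVertex k c m =>
      e.1 ≠ e.2 ∧ ¬ G.Adj e.1 e.2).image fun e => nodeClause x e.1 ∪ nodeClause x e.2) ∪
  Finset.univ.image fun ij : Fin k × Fin c => rangeClause x ij.1 ij.2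

/-- The formulas of all `k`-partite graphs with blocks of size `m ^ c` that have exactly `M`
edges. -/
def cliqueFamily {V : Type} [DecidableEq V] {k c m : ℕ} (x : CliqueVar k c m ↪ V) (M : ℕ) :
    Set (CNF V) :=
  {A | ∃ G : SimpleGraph (BlockVertex k c m),
    (∀ u v, G.Adj u v → u.1 ≠ v.1) ∧ G.edgeSet.ncard = M ∧ A = cliqueFormula x G}

/-- `D = ⌊(log₂ N) ^ ε₀⌋`. -/
noncomputable def densityParam (ε₀ : ℝ) (N : ℕ) : ℕ := ⌊Real.logb 2 N ^ ε₀⌋₊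

/-- The clique size `k = 2 D`. -/
noncomputable def cliqueParam (ε₀ : ℝ) (N : ℕ) : ℕ := 2 * densityParam ε₀ N

/-- The number of edges at edge density `N ^ (-2 / D)`: a `k`-partite graph with blocks of size `N`
has `(k choose 2) * N ^ 2` potential edges. -/
noncomputable def edgeParam (ε₀ : ℝ) (N : ℕ) : ℕ :=
  ⌈(N : ℝ) ^ (-2 / (densityParam ε₀ N : ℝ)) * ((cliqueParam ε₀ N).choose 2 * (N : ℝ) ^ 2)⌉₊

/-- The probability that a uniformly random member of the finite set `S` has the property `P`. -/
noncomputable def uniformProb {α : Type} (S : Set α) (P : α → Prop) : ℝ :=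
  ({a ∈ S | P a}.ncard : ℝ) / (S.ncard : ℝ)

/-! The family uses m = 2, so N = 2 ^ c with c about (2 + ε) / 4 · log₂ s. Then s ≤ N ^ (2 - 2g) for
the constant g = ε / (2 + ε). The edge density is p ≈ N ^ (-2 / D). It is low enough for a first
moment bound on k-cliques (`eventually_unsat`). Since D tends to infinity while k = 2D is o(log N),
every loss of the form p ^ O(1) or 8 ^ k is smaller than any fixed power of N.

For the lower bound only the assignments that choose one vertex per block are considered. A
refutation shorter than |A| ^ K balances into a decision tree of depth O(log N) which queries lines
from F. Each leaf is covered by 12 sets of tuples, and the tuples of each set share a non-edge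
(`Deriv.searchTree`, `searchTree_of_not_requiresLength`).

An adversary walks down this tree (`not_searchTree_of_restores`). It keeps a set I of finished
blocks, a box in which the vertices of the finished blocks are adjacent to everything in other
blocks, and a measure on the surviving tuples. The measure is spread: prescribing the vertices in a
set J of unfinished blocks leaves mass at most ρ ^ |J|. A non-edge inside of the box joins two
unfinished blocks, so its tuples have mass at most ρ², and the walk cannot stop at a leaf. A query
costs at most half of the mass. After q = Θ(log N) queries the mass is restored: the few blocks that
the measure nearly determines are fixed to mutually adjacent vertices, and the measure is replaced
by one on the common neighbourhood. The depth is exhausted after constantly many such rounds, so ρ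
remains close to 1 / N.

A restoration may fail, but for a fixed set of tuples this is very unlikely
(`binomExp_not_restore_le`). The largest spread mass in the random graph has large expectation by a
second moment computation (`le_binomExp_packing`). One edge changes it by at most ρ₂², close to N ^
(-2), and there are about N² edges up to a polynomial in c. A bounded differences inequality
therefore gives failure probability exp(-N ^ (2 - g/2) / poly(c)). As F is fixed before the graph,
the sets described by O(log N) queries number only exp(O(c N ^ (2 - 2g))), and the boxes 2 ^ (N k),
so the union bound closes (`binomExp_searchTree_le`).

All of this takes place with independent edges. Passing to exactly M edges costs a factor of the
number of potential edges plus one (`card_powersetCard_filter_le`). -/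

/-! ### Balancing tree-like derivations into decision trees. -/

/-- A decision tree of depth at most `d` which queries membership in the sets `g ∈ 𝓕` and whose
leaves satisfy `P`. -/
inductive SearchTree {X : Type} [DecidableEq X] (𝓕 : Finset (Finset X)) (P : Finset X → Prop) :
    ℕ → Finset X → Prop
  | leaf (d : ℕ) (R : Finset X) : P R → SearchTree 𝓕 P d R
  | node (d : ℕ) (R g : Finset X) : g ∈ 𝓕 → SearchTree 𝓕 P d (R ∩ g) →
      SearchTree 𝓕 P d (R \ g) → SearchTree 𝓕 P (d + 1) R

/-- A tree-like semantic derivation with `n` lines of the set `f`, valid inside of `R`. -/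
inductive Deriv {X : Type} [DecidableEq X] (𝓕 : Finset (Finset X)) (P : Finset X → Prop)
    (R : Finset X) : Finset X → ℕ → Prop
  | ax (f : Finset X) : P (R ∩ f) → Deriv 𝓕 P R f 1
  | one (f g : Finset X) (a : ℕ) : f ∈ 𝓕 → R ∩ f ⊆ g → Deriv 𝓕 P R g a → Deriv 𝓕 P R f (a + 1)
  | two (f g h : Finset X) (a b : ℕ) : f ∈ 𝓕 → R ∩ f ⊆ g ∪ h → Deriv 𝓕 P R g a →
      Deriv 𝓕 P R h b → Deriv 𝓕 P R f (a + b + 1)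

/-- `R` is a union of at most `n` sets with the property `P`. -/
def CoveredBy {X : Type} [DecidableEq X] (P : Finset X → Prop) (n : ℕ) (R : Finset X) : Prop :=
  ∃ 𝒞 : Finset (Finset X), 𝒞.card ≤ n ∧ (∀ C ∈ 𝒞, P C) ∧ R ⊆ 𝒞.biUnion id

section Balancing

variable {X : Type} [DecidableEq X] {𝓕 : Finset (Finset X)} {P : Finset X → Prop}

lemma CoveredBy.mono {n n' : ℕ} {R R' : Finset X} (h : CoveredBy P n R) (hn : n ≤ n')
    (hR : R' ⊆ R) : CoveredBy P n' R' := by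
  obtain ⟨𝒞, h1, h2, h3⟩ := h
  exact ⟨𝒞, h1.trans hn, h2, hR.trans h3⟩

lemma Deriv.coveredBy {R f : Finset X} {n : ℕ} (h : Deriv 𝓕 P R f n) :
    CoveredBy P n (R ∩ f) := by
  induction h with
  | ax f h => exact ⟨{R ∩ f}, by simp, by simpa using h, by simp⟩
  | one f g a _ hs _ ih =>
    exact ih.mono (by omega) (fun x hx => by
      have := hs hx
      simp only [Finset.mem_inter] at hx ⊢
      exact ⟨hx.1, this⟩)
  | two f g h a b _ hs _ _ ih1 ih2 =>
    obtain ⟨𝒞, h1, h2, h3⟩ := ih1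
    obtain ⟨𝒟, k1, k2, k3⟩ := ih2
    refine ⟨𝒞 ∪ 𝒟, (Finset.card_union_le _ _).trans (by omega), fun C hC => ?_, fun x hx => ?_⟩
    · rcases Finset.mem_union.1 hC with hC | hC
      · exact h2 C hC
      · exact k2 C hC
    · have hxR := (Finset.mem_inter.1 hx).1
      rw [Finset.union_biUnion]
      rcases Finset.mem_union.1 (hs hx) with hg | hg
      · exact Finset.mem_union_left _ (h3 (Finset.mem_inter.2 ⟨hxR, hg⟩))
      · exact Finset.mem_union_right _ (k3 (Finset.mem_inter.2 ⟨hxR, hg⟩))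

variable (hP : ∀ R R' : Finset X, R' ⊆ R → P R → P R')

include hP in
lemma Deriv.mono {R R' f : Finset X} {n : ℕ} (h : Deriv 𝓕 P R f n) (hR : R' ⊆ R) :
    Deriv 𝓕 P R' f n := by
  induction h with
  | ax f h => exact .ax f (hP _ _ (Finset.inter_subset_inter_right hR) h)
  | one f g a hf hs _ ih => exact .one f g a hf ((Finset.inter_subset_inter_right hR).trans hs) ih
  | two f g h a b hf hs _ _ ih1 ih2 =>
    exact .two f g h a b hf ((Finset.inter_subset_inter_right hR).trans hs) ih1 ih2

include hP in
lemma SearchTree.mono {d : ℕ} {R R' : Finset X} (h : SearchTree 𝓕 P d R) (hR : R' ⊆ R) :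
    SearchTree 𝓕 P d R' := by
  induction h generalizing R' with
  | leaf d R h => exact .leaf d R' (hP _ _ hR h)
  | node d R g hg _ _ ih1 ih2 =>
    exact .node d R' g hg (ih1 (Finset.inter_subset_inter_right hR))
      (ih2 (Finset.sdiff_subset_sdiff hR le_rfl))

include hP in
/-- Every large derivation has a line which splits off a part of prescribed size. -/
lemma Deriv.exists_split (hP0 : P ∅) {R f : Finset X} {n : ℕ} (h : Deriv 𝓕 P R f n) (w : ℕ)
    (hw : 1 ≤ w) (hn : w < n) :
    ∃ g ∈ 𝓕, ∃ a n', w < a ∧ a ≤ 2 * w + 1 ∧ n' + a ≤ n + 1 ∧ Deriv 𝓕 P R g a ∧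
      Deriv 𝓕 P (R \ g) f n' := by
  -- Off its own set a line is empty, hence an axiom. This lets a single line replace the whole
  -- subtree that is split off.
  have hself : ∀ f : Finset X, Deriv 𝓕 P (R \ f) f 1 := fun f =>
    .ax f (by rw [Finset.sdiff_inter_self]; exact hP0)
  induction h with
  | ax f h => omega
  | one f g a hf hs hd ih =>
    by_cases hb : a + 1 ≤ 2 * w + 1
    · exact ⟨f, hf, a + 1, 1, hn, hb, by omega, .one f g a hf hs hd, hself f⟩
    · obtain ⟨g', hg', a', n', h1, h2, h3, h4, h5⟩ := ih (by omega)
      exact ⟨g', hg', a', n' + 1, h1, h2, by omega, h4,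
        .one f g n' hf ((Finset.inter_subset_inter_right Finset.sdiff_subset).trans hs) h5⟩
  | two f g h a b hf hs hd1 hd2 ih1 ih2 =>
    by_cases hb : a + b + 1 ≤ 2 * w + 1
    · exact ⟨f, hf, a + b + 1, 1, hn, hb, by omega, .two f g h a b hf hs hd1 hd2, hself f⟩
    · by_cases ha : w < a
      · obtain ⟨g', hg', a', n', h1, h2, h3, h4, h5⟩ := ih1 ha
        exact ⟨g', hg', a', n' + b + 1, h1, h2, by omega, h4,
          .two f g h n' b hf ((Finset.inter_subset_inter_right Finset.sdiff_subset).trans hs) h5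
            (hd2.mono hP Finset.sdiff_subset)⟩
      · obtain ⟨g', hg', a', n', h1, h2, h3, h4, h5⟩ := ih2 (by omega)
        exact ⟨g', hg', a', a + n' + 1, h1, h2, by omega, h4,
          .two f g h a n' hf ((Finset.inter_subset_inter_right Finset.sdiff_subset).trans hs)
            (hd1.mono hP Finset.sdiff_subset) h5⟩

include hP in
/-- A tree-like derivation can be balanced. -/
lemma Deriv.searchTree (hP0 : P ∅) (d : ℕ) {R f : Finset X} {n : ℕ} (h : Deriv 𝓕 P R f n)
    (hn : (n : ℝ) ≤ 12 * (4 / 3 : ℝ) ^ d) : SearchTree 𝓕 (CoveredBy P 12) d (R ∩ f) := by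
  induction d generalizing R f n with
  | zero =>
    have : n ≤ 12 := by exact_mod_cast (by simpa using hn : (n : ℝ) ≤ 12)
    exact .leaf _ _ (h.coveredBy.mono this subset_rfl)
  | succ d ih =>
    by_cases hn12 : n ≤ 12
    · exact .leaf _ _ (h.coveredBy.mono hn12 subset_rfl)
    -- A part of between n/3 and 2n/3 + 1 lines is split off. For n > 12 both parts have at most
    -- 3n/4 lines, which explains the constants 12 and 4/3.
    obtain ⟨g, hg, a, n', h1, h2, h3, h4, h5⟩ :=
      h.exists_split hP hP0 (n / 3) (by omega) (by omega)
    have key : ∀ a : ℕ, 4 * a ≤ 3 * n → (a : ℝ) ≤ 12 * (4 / 3 : ℝ) ^ d := fun a ha => by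
      have : (4 : ℝ) * a ≤ 3 * n := by exact_mod_cast ha
      rw [pow_succ] at hn
      linarith
    have hmono : ∀ R R' : Finset X, R' ⊆ R → CoveredBy P 12 R → CoveredBy P 12 R' :=
      fun R R' h h' => h'.mono le_rfl h
    refine .node d _ g hg ((ih h4 (key a (by omega))).mono hmono ?_)
      ((ih h5 (key n' (by omega))).mono hmono ?_)
    · intro x; simp only [Finset.mem_inter]; tauto
    · intro x; simp only [Finset.mem_inter, Finset.mem_sdiff]; tauto

end Balancing

/-- The part of a tree-like refutation above a line is a tree-like derivation. -/
lemma exists_deriv_of_isTreeLikeRefutation {n t : ℕ} {F : Finset (BoolFn n)} {A : CNF (Fin n)}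
    {f : Fin (t + 1) → BoolFn n} (h : IsTreeLikeRefutation F A f)
    {X : Type} [DecidableEq X] [Fintype X] (asg : X → Assignment (Fin n)) (P : Finset X → Prop)
    (hP : ∀ C ∈ A, P {x | ¬ ∃ l ∈ C, asg x l.1 = l.2}) :
    ∃ a ≤ t + 1, Deriv (F.image fun g => ({x | g (asg x) = true} : Finset X)) P Finset.univ
      Finset.univ a := by
  classical
  obtain ⟨hlast, prem, hax, hstep, huniq⟩ := h
  let par : Fin (t + 1) → Fin (t + 1) → Prop :=
    fun l i => ∃ p, prem i = some p ∧ (l = p.1 ∨ l = p.2)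
  have hlt : ∀ l i, par l i → l < i := by
    rintro l i ⟨⟨j, k⟩, hp, rfl | rfl⟩
    · exact (hstep i _ _ hp).2.1
    · exact (hstep i _ _ hp).2.2.1
  have hle : ∀ l i, Relation.ReflTransGen par l i → l ≤ i := by
    intro l i h
    induction h with
    | refl => exact le_rfl
    | tail _ h ih => exact ih.trans (hlt _ _ h).le
  let desc : Fin (t + 1) → Finset (Fin (t + 1)) := fun i => {l | Relation.ReflTransGen par l i}
  have hdesc : ∀ j i, par j i → desc j ⊆ desc i := by
    intro j i h l hl
    simp only [desc, Finset.mem_filter, Finset.mem_univ, true_and] at hl ⊢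
    exact hl.tail h
  have hnot : ∀ j i, par j i → i ∉ desc j := by
    intro j i h hi
    simp only [desc, Finset.mem_filter, Finset.mem_univ, true_and] at hi
    exact absurd (hle _ _ hi) (not_le.2 (hlt _ _ h))
  have hself : ∀ i, i ∈ desc i := fun i => by simp [desc, Relation.ReflTransGen.refl]
  have hru : Relator.RightUnique par := fun l i i' h h' => huniq l i i' h h'
  -- A line has at most one user, so the lines reachable from it form a chain. Hence no line lies
  -- above two different premises, and unfolding into a tree duplicates nothing.
  have hdisj : ∀ i j k, par j i → par k i → j ≠ k → Disjoint (desc j) (desc k) := by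
    intro i j k hj hk hjk
    have aux : ∀ j k, par j i → par k i → j ≠ k → ¬ Relation.ReflTransGen par j k := by
      intro j k hj hk hjk h
      rcases Relation.ReflTransGen.cases_head h with h | ⟨i', h1, h2⟩
      · exact hjk h
      · have : i' = i := hru h1 hj
        subst this
        exact absurd (hle _ _ h2) (not_le.2 (hlt _ _ hk))
    refine Finset.disjoint_left.2 fun l h1 h2 => ?_
    simp only [desc, Finset.mem_filter, Finset.mem_univ, true_and] at h1 h2
    rcases Relation.ReflTransGen.total_of_right_unique hru h1 h2 with h | h
    · exact aux j k hj hk hjk h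
    · exact aux k j hk hj hjk.symm h
  let S : Fin (t + 1) → Finset X := fun i => {x | f i (asg x) = true}
  have main : ∀ i : Fin (t + 1), ∃ a ≤ (desc i).card,
      Deriv (F.image fun g => ({x | g (asg x) = true} : Finset X)) P Finset.univ (S i) a := by
    intro i
    induction i using WellFoundedLT.induction with
    | ind i ih =>
      rcases hp : prem i with _ | ⟨j, k⟩
      · obtain ⟨C, hC, hfC⟩ := hax i hp
        refine ⟨1, Finset.card_pos.2 ⟨i, hself i⟩, .ax _ ?_⟩
        have : Finset.univ ∩ S i = ({x | ¬ ∃ l ∈ C, asg x l.1 = l.2} : Finset X) := by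
          ext x
          simp only [S, Finset.univ_inter, Finset.mem_filter, Finset.mem_univ, true_and]
          exact hfC (asg x)
        rw [this]
        exact hP C hC
      · obtain ⟨hF, hji, hki, hfi⟩ := hstep i j k hp
        have hj : par j i := ⟨_, hp, .inl rfl⟩
        have hk : par k i := ⟨_, hp, .inr rfl⟩
        obtain ⟨a, ha, hda⟩ := ih j hji
        obtain ⟨b, hb, hdb⟩ := ih k hki
        have hmem : S i ∈ F.image fun g => ({x | g (asg x) = true} : Finset X) :=
          Finset.mem_image.2 ⟨f i, hF, rfl⟩
        -- Coinciding premises would be counted twice by the two-premise rule.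
        by_cases hjk : j = k
        · subst hjk
          refine ⟨a + 1, ?_, .one _ (S j) a hmem ?_ hda⟩
          · have : (insert i (desc j)).card ≤ (desc i).card :=
              Finset.card_le_card (Finset.insert_subset (hself i) (hdesc j i hj))
            rw [Finset.card_insert_of_notMem (hnot j i hj)] at this
            omega
          · intro x hx
            simp only [S, Finset.univ_inter, Finset.mem_filter, Finset.mem_univ, true_and] at hx ⊢
            simpa using hfi _ hx
        · refine ⟨a + b + 1, ?_, .two _ (S j) (S k) a b hmem ?_ hda hdb⟩
          · have : (insert i (desc j ∪ desc k)).card ≤ (desc i).card :=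
              Finset.card_le_card (Finset.insert_subset (hself i)
                (Finset.union_subset (hdesc j i hj) (hdesc k i hk)))
            rw [Finset.card_insert_of_notMem (by simp [hnot j i hj, hnot k i hk]),
              Finset.card_union_of_disjoint (hdisj i j k hj hk hjk)] at this
            omega
          · intro x hx
            simp only [S, Finset.univ_inter, Finset.mem_union, Finset.mem_filter, Finset.mem_univ,
              true_and] at hx ⊢
            exact hfi _ hx
  obtain ⟨a, ha, hd⟩ := main (Fin.last t)
  refine ⟨a, ha.trans ((Finset.card_le_univ _).trans (by simp)), ?_⟩
  have : S (Fin.last t) = Finset.univ := by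
    ext x; simp [S, hlast]
  rwa [this] at hd

/-! ### Random subsets: concentration, and comparison with subsets of fixed size. -/

/-- The expectation of `f S` for a random subset `S` of `U` which contains every element of `U`
independently with probability `p`. -/
noncomputable def binomExp {ι : Type} (p : ℝ) (U : Finset ι) (f : Finset ι → ℝ) : ℝ :=
  ∑ S ∈ U.powerset, p ^ S.card * (1 - p) ^ (U.card - S.card) * f S

open Classical in
/-- The probability of the event `P` for such a random subset. -/
noncomputable def binomProb {ι : Type} (p : ℝ) (U : Finset ι) (P : Finset ι → Prop) : ℝ :=
  binomExp p U fun S => if P S then 1 else 0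

section Binomial

variable {ι : Type} {p : ℝ} {U : Finset ι}

lemma binomExp_mono (hp0 : 0 ≤ p) (hp1 : p ≤ 1) {f g : Finset ι → ℝ}
    (h : ∀ S ⊆ U, f S ≤ g S) : binomExp p U f ≤ binomExp p U g :=
  Finset.sum_le_sum fun S hS => mul_le_mul_of_nonneg_left (h S (Finset.mem_powerset.1 hS))
    (mul_nonneg (pow_nonneg hp0 _) (pow_nonneg (sub_nonneg.2 hp1) _))

lemma binomExp_const_mul (a : ℝ) (f : Finset ι → ℝ) :
    binomExp p U (fun S => a * f S) = a * binomExp p U f := by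
  simp only [binomExp, Finset.mul_sum]
  exact Finset.sum_congr rfl fun S _ => by ring

lemma binomExp_sub (f g : Finset ι → ℝ) :
    binomExp p U (fun S => f S - g S) = binomExp p U f - binomExp p U g := by
  simp only [binomExp, mul_sub, Finset.sum_sub_distrib]

lemma binomExp_sum {κ : Type} (s : Finset κ) (f : κ → Finset ι → ℝ) :
    binomExp p U (fun S => ∑ i ∈ s, f i S) = ∑ i ∈ s, binomExp p U (f i) := by
  simp only [binomExp, Finset.mul_sum]
  exact Finset.sum_comm

lemma binomExp_empty (f : Finset ι → ℝ) : binomExp p ∅ f = f ∅ := by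
  simp [binomExp]

lemma binomExp_congr {f g : Finset ι → ℝ} (h : ∀ S ⊆ U, f S = g S) :
    binomExp p U f = binomExp p U g :=
  Finset.sum_congr rfl fun S hS => by rw [h S (Finset.mem_powerset.1 hS)]

lemma binomExp_insert [DecidableEq ι] {e : ι} (he : e ∉ U) (f : Finset ι → ℝ) :
    binomExp p (insert e U) f =
      (1 - p) * binomExp p U f + p * binomExp p U (fun S => f (insert e S)) := by
  rw [binomExp, Finset.sum_powerset_insert he, binomExp, binomExp, Finset.mul_sum, Finset.mul_sum]
  congr 1
  · refine Finset.sum_congr rfl fun S hS => ?_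
    have := Finset.card_le_card (Finset.mem_powerset.1 hS)
    rw [Finset.card_insert_of_notMem he, Nat.sub_add_comm this]
    ring
  · refine Finset.sum_congr rfl fun S hS => ?_
    have hS' := Finset.mem_powerset.1 hS
    rw [Finset.card_insert_of_notMem he, Finset.card_insert_of_notMem (fun h => he (hS' h)),
      Nat.add_sub_add_right]
    ring

lemma binomExp_const (a : ℝ) : binomExp p U (fun _ => a) = a := by
  classical
  induction U using Finset.induction_on with
  | empty => exact binomExp_empty _
  | insert e U he ih => rw [binomExp_insert he, ih]; ring

lemma binomProb_nonneg (hp0 : 0 ≤ p) (hp1 : p ≤ 1) (P : Finset ι → Prop) :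
    0 ≤ binomProb p U P := by
  rw [← binomExp_const (p := p) (U := U) 0]
  refine binomExp_mono hp0 hp1 fun S _ => ?_
  split_ifs <;> norm_num

lemma binomExp_subset [DecidableEq ι] {E : Finset ι} (hE : E ⊆ U) :
    binomExp p U (fun S => if E ⊆ S then 1 else 0) = p ^ E.card := by
  induction U using Finset.induction_on generalizing E with
  | empty =>
    rw [Finset.subset_empty.1 hE, binomExp_empty]; simp
  | insert e U he ih =>
    rw [binomExp_insert he]
    by_cases heE : e ∈ E
    · have h1 : binomExp p U (fun S => if E ⊆ S then (1 : ℝ) else 0) = 0 := by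
        rw [binomExp_congr (g := fun _ => 0), binomExp_const]
        intro S hS
        rw [if_neg (fun h => he (hS (h heE)))]
      have h2 : E.erase e ⊆ U := Finset.subset_insert_iff.1 hE
      have h3 : binomExp p U (fun S => if E ⊆ insert e S then (1 : ℝ) else 0)
          = p ^ (E.erase e).card := by
        rw [← ih h2]
        exact binomExp_congr fun S _ => by simp only [Finset.subset_insert_iff]
      rw [h1, h3, ← Finset.card_erase_add_one heE]
      ring
    · have h2 : E ⊆ U := (Finset.subset_insert_iff_of_notMem heE).1 hE
      simp only [Finset.subset_insert_iff_of_notMem heE]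
      rw [ih h2]; ring

lemma exp_le_one_add_add_sq {x : ℝ} (hx : |x| ≤ 1) : Real.exp x ≤ 1 + x + x ^ 2 := by
  have := (abs_le.1 (Real.abs_exp_sub_one_sub_id_le hx)).2
  linarith

/-- The exponential moment bound behind McDiarmid's inequality. -/
lemma binomExp_exp_neg_le [DecidableEq ι] (hp0 : 0 ≤ p) (hp1 : p ≤ 1) (f : Finset ι → ℝ) {L l : ℝ}
    (hl : 0 ≤ l) (hlL : l * L ≤ 1)
    (hf : ∀ e ∈ U, ∀ S ⊆ U, |f (insert e S) - f S| ≤ L) :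
    binomExp p U (fun S => Real.exp (-l * f S)) ≤
      Real.exp (-l * binomExp p U f + U.card * (l * L) ^ 2) := by
  induction U using Finset.induction_on generalizing f with
  | empty => simp [binomExp_empty]
  | insert e U he ih =>
    have hsub : U ⊆ insert e U := Finset.subset_insert _ _
    have h0 := ih f fun e' he' S hS => hf e' (hsub he') S (hS.trans hsub)
    have h1 := ih (fun S => f (insert e S)) fun e' he' S hS => by
      rw [Finset.insert_comm]
      exact hf e' (hsub he') _ (Finset.insert_subset_insert _ hS)
    rw [binomExp_insert he, binomExp_insert he]
    set x0 := binomExp p U f with hx0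
    set x1 := binomExp p U (fun S => f (insert e S)) with hx1
    set Q := (U.card : ℝ) * (l * L) ^ 2 with hQ
    have hd : |x1 - x0| ≤ L := by
      have hc : ∀ a : ℝ, a = binomExp p U (fun _ => a) := fun a => (binomExp_const a).symm
      rw [hx0, hx1, ← binomExp_sub, abs_le]
      constructor
      · rw [hc (-L)]
        exact binomExp_mono hp0 hp1 fun S hS =>
          (abs_le.1 (hf e (Finset.mem_insert_self _ _) S (hS.trans hsub))).1
      · conv_rhs => rw [hc L]
        exact binomExp_mono hp0 hp1 fun S hS =>
          (abs_le.1 (hf e (Finset.mem_insert_self _ _) S (hS.trans hsub))).2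
    have hL : 0 ≤ L := (abs_nonneg _).trans hd
    set x := (1 - p) * x0 + p * x1 with hx
    have hlL2 : 0 ≤ l * L := mul_nonneg hl hL
    have bound : ∀ y q : ℝ, |y| ≤ L → 0 ≤ q → q ≤ 1 →
        Real.exp (-l * (q * y)) ≤ 1 + -l * (q * y) + (l * L) ^ 2 := by
      intro y q hy hq0 hq1
      have h1 : |-l * (q * y)| ≤ l * L := by
        rw [abs_mul, abs_neg, abs_of_nonneg hl, abs_mul, abs_of_nonneg hq0]
        refine mul_le_mul_of_nonneg_left ?_ hl
        calc q * |y| ≤ 1 * |y| := mul_le_mul_of_nonneg_right hq1 (abs_nonneg _)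
          _ ≤ L := by rwa [one_mul]
      refine (exp_le_one_add_add_sq (h1.trans hlL)).trans ?_
      have : (-l * (q * y)) ^ 2 ≤ (l * L) ^ 2 := sq_le_sq' (abs_le.1 h1).1 (abs_le.1 h1).2
      linarith
    have b0 := bound (x0 - x1) p (by rwa [abs_sub_comm]) hp0 hp1
    have b1 := bound (x1 - x0) (1 - p) hd (by linarith) (by linarith)
    -- Both conditional means are expanded around the overall mean x. The deviations p (x0 - x1) and
    -- (1 - p) (x1 - x0) average to zero, so only the quadratic term survives.
    have e0 : Real.exp (-l * x0 + Q) =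
        Real.exp (-l * (p * (x0 - x1))) * Real.exp (-l * x + Q) := by
      rw [← Real.exp_add]; congr 1; rw [hx]; ring
    have e1 : Real.exp (-l * x1 + Q) =
        Real.exp (-l * ((1 - p) * (x1 - x0))) * Real.exp (-l * x + Q) := by
      rw [← Real.exp_add]; congr 1; rw [hx]; ring
    have hq : (0 : ℝ) ≤ 1 - p := by linarith
    calc (1 - p) * binomExp p U (fun S => Real.exp (-l * f S))
          + p * binomExp p U (fun S => Real.exp (-l * f (insert e S)))
        ≤ (1 - p) * Real.exp (-l * x0 + Q) + p * Real.exp (-l * x1 + Q) :=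
          add_le_add (mul_le_mul_of_nonneg_left h0 hq) (mul_le_mul_of_nonneg_left h1 hp0)
      _ = ((1 - p) * Real.exp (-l * (p * (x0 - x1))) +
            p * Real.exp (-l * ((1 - p) * (x1 - x0)))) * Real.exp (-l * x + Q) := by
          rw [e0, e1]; ring
      _ ≤ ((1 - p) * (1 + -l * (p * (x0 - x1)) + (l * L) ^ 2) +
            p * (1 + -l * ((1 - p) * (x1 - x0)) + (l * L) ^ 2)) * Real.exp (-l * x + Q) := by
          gcongr
      _ = (1 + (l * L) ^ 2) * Real.exp (-l * x + Q) := by ring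
      _ ≤ Real.exp ((l * L) ^ 2) * Real.exp (-l * x + Q) := by
          gcongr
          have := Real.add_one_le_exp ((l * L) ^ 2)
          linarith
      _ = Real.exp (-l * x + ((insert e U).card : ℝ) * (l * L) ^ 2) := by
          rw [← Real.exp_add, Finset.card_insert_of_notMem he, hQ]
          congr 1; push_cast; ring

/-- The lower tail of a function with bounded differences. -/
lemma binomExp_lt_half_le [DecidableEq ι] (hp0 : 0 ≤ p) (hp1 : p ≤ 1) (f : Finset ι → ℝ) {L t : ℝ}
    (hL : 0 < L) (ht : 0 < t) (htL : t ≤ 4 * (U.card * L))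
    (hf : ∀ e ∈ U, ∀ S ⊆ U, |f (insert e S) - f S| ≤ L) (hE : t ≤ binomExp p U f) :
    binomExp p U (fun S => if f S < t / 2 then 1 else 0) ≤
      Real.exp (-(t ^ 2 / (16 * (U.card * L ^ 2)))) := by
  have hU : 0 < (U.card : ℝ) := by
    by_contra h
    have : (U.card : ℝ) = 0 := le_antisymm (not_lt.1 h) (Nat.cast_nonneg _)
    rw [this] at htL; linarith
  -- This l minimises -l t / 2 + |U| (l L)², and the hypothesis `htL` is what makes l L ≤ 1.
  set l := t / (4 * (U.card * L ^ 2)) with hl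
  have hl0 : 0 < l := by positivity
  have hlL : l * L ≤ 1 := by
    rw [hl, div_mul_eq_mul_div, div_le_one (by positivity)]
    nlinarith
  have h1 := binomExp_exp_neg_le hp0 hp1 f hl0.le hlL hf
  calc binomExp p U (fun S => if f S < t / 2 then 1 else 0)
      ≤ binomExp p U (fun S => Real.exp (l * (t / 2)) * Real.exp (-l * f S)) := by
        refine binomExp_mono hp0 hp1 fun S _ => ?_
        rw [← Real.exp_add]
        split_ifs with h
        · apply Real.one_le_exp
          nlinarith
        · positivity
    _ ≤ Real.exp (l * (t / 2)) * Real.exp (-l * binomExp p U f + U.card * (l * L) ^ 2) := by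
        rw [binomExp_const_mul]; gcongr
    _ ≤ Real.exp (l * (t / 2)) * Real.exp (-l * t + U.card * (l * L) ^ 2) := by
        gcongr _ * Real.exp (?_ + _)
        nlinarith
    _ = Real.exp (-(t ^ 2 / (16 * (U.card * L ^ 2)))) := by
        rw [← Real.exp_add]; congr 1
        rw [hl]; field_simp; ring

/-- The mode of the binomial distribution with `n` trials and mean `M` is `M`. -/
lemma choose_mul_pow_le_mode {n M : ℕ} (hM : M ≤ n) (j : ℕ) (hj : j ≤ n) :
    n.choose j * (M ^ j * (n - M) ^ (n - j)) ≤ n.choose M * (M ^ M * (n - M) ^ (n - M)) := by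
  have step : ∀ i, i < n → n.choose (i + 1) * (i + 1) = n.choose i * (n - i) := fun i _ =>
    Nat.choose_succ_right_eq n i
  set a : ℕ → ℕ := fun j => n.choose j * (M ^ j * (n - M) ^ (n - j)) with ha
  -- The cross-multiplied ratio of consecutive terms. The terms increase up to M and decrease from
  -- there.
  have hrec : ∀ i, i < n → a (i + 1) * ((i + 1) * (n - M)) = a i * ((n - i) * M) := by
    intro i hi
    have h2 : n - i = (n - (i + 1)) + 1 := by omega
    calc a (i + 1) * ((i + 1) * (n - M))
        = (n.choose (i + 1) * (i + 1)) * (M ^ (i + 1) * ((n - M) ^ (n - (i + 1)) * (n - M))) := by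
          simp only [ha]; ring
      _ = (n.choose i * (n - i)) * (M ^ (i + 1) * (n - M) ^ (n - i)) := by
          rw [step i hi, ← pow_succ, ← h2]
      _ = a i * ((n - i) * M) := by simp only [ha]; ring
  rcases le_total j M with hjM | hjM
  · refine Nat.decreasingInduction' (n := M) (m := j) (P := fun i => a i ≤ a M) ?_ hjM le_rfl
    intro i hiM _ ih
    refine le_trans ?_ ih
    have hin : i < n := by omega
    have hpos : 0 < (n - i) * M := Nat.mul_pos (by omega) (by omega)
    have hle : (i + 1) * (n - M) ≤ (n - i) * M := by
      obtain ⟨r, rfl⟩ := Nat.exists_eq_add_of_le hM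
      obtain ⟨q, rfl⟩ := Nat.exists_eq_add_of_lt hiM
      have e1 : i + q + 1 + r - (i + q + 1) = r := by omega
      have e2 : i + q + 1 + r - i = q + 1 + r := by omega
      rw [e1, e2]
      nlinarith [Nat.zero_le (q * r), Nat.zero_le (q * i), Nat.zero_le (q * q), Nat.zero_le q,
        Nat.zero_le i]
    have := hrec i hin
    by_contra hlt
    push Not at hlt
    have h1 : a (i + 1) * ((i + 1) * (n - M)) ≤ a (i + 1) * ((n - i) * M) :=
      Nat.mul_le_mul_left _ hle
    have h2 : a (i + 1) * ((n - i) * M) < a i * ((n - i) * M) :=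
      Nat.mul_lt_mul_of_pos_right hlt hpos
    omega
  · induction j, hjM using Nat.le_induction with
    | base => exact le_rfl
    | succ i hi ih =>
      refine le_trans ?_ (ih (by omega))
      have hpos : 0 < (i + 1) * (n - M) := Nat.mul_pos (by omega) (by omega)
      have hle : (n - i) * M ≤ (i + 1) * (n - M) := by
        obtain ⟨q, rfl⟩ := Nat.exists_eq_add_of_le hi
        obtain ⟨r, rfl⟩ := Nat.exists_eq_add_of_le hj
        have e1 : M + q + 1 + r - (M + q) = r + 1 := by omega
        have e2 : M + q + 1 + r - M = q + 1 + r := by omega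
        rw [e1, e2]
        nlinarith [Nat.zero_le (q * r), Nat.zero_le (q * M), Nat.zero_le (q * q), Nat.zero_le q,
          Nat.zero_le r]
      have := hrec i (by omega)
      by_contra hlt
      push Not at hlt
      have h1 : a i * ((n - i) * M) ≤ a i * ((i + 1) * (n - M)) := Nat.mul_le_mul_left _ hle
      have h2 : a i * ((i + 1) * (n - M)) < a (i + 1) * ((i + 1) * (n - M)) :=
        Nat.mul_lt_mul_of_pos_right hlt hpos
      omega

open Classical in
/-- Unlikely events of the binomial model are unlikely in the uniform model. -/
lemma card_powersetCard_filter_le {M : ℕ} (hM : M ≤ U.card) (hU : 0 < U.card)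
    (bad : Finset ι → Prop) :
    (((U.powersetCard M).filter bad).card : ℝ) ≤
      ((U.card + 1 : ℕ) : ℝ) *
        binomProb ((M : ℝ) / U.card) U bad * (U.card.choose M) := by
  set n := U.card with hn
  set p : ℝ := (M : ℝ) / n with hp
  have hn0 : (0 : ℝ) < n := by exact_mod_cast hU
  have hp0 : 0 ≤ p := by positivity
  have hp1 : p ≤ 1 := by rw [hp, div_le_one hn0]; exact_mod_cast hM
  have hq : 1 - p = ((n - M : ℕ) : ℝ) / n := by
    rw [hp, Nat.cast_sub hM]; field_simp
  have hterm : ∀ j, j ≤ n → p ^ j * (1 - p) ^ (n - j) * (n.choose j : ℝ)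
      = ((n.choose j * (M ^ j * (n - M) ^ (n - j)) : ℕ) : ℝ) / (n : ℝ) ^ n := by
    intro j hj
    rw [hq, hp, div_pow, div_pow]
    have : (n : ℝ) ^ n = (n : ℝ) ^ j * (n : ℝ) ^ (n - j) := by
      rw [← pow_add]; congr 1; omega
    rw [this]; push_cast; field_simp
  set w : ℝ := p ^ M * (1 - p) ^ (n - M) with hw
  have hw0 : 0 ≤ w := mul_nonneg (pow_nonneg hp0 _) (pow_nonneg (by linarith) _)
  -- The n + 1 binomial probabilities sum to 1 and the one at M is the largest.
  have hmode : 1 ≤ ((n + 1 : ℕ) : ℝ) * (w * n.choose M) := by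
    have h1 : (1 : ℝ) =
        ∑ j ∈ Finset.range (n + 1), p ^ j * (1 - p) ^ (n - j) * (n.choose j : ℝ) := by
      have := add_pow p (1 - p) n
      rwa [add_sub_cancel, one_pow] at this
    rw [h1]
    calc _ ≤ ∑ j ∈ Finset.range (n + 1), w * (n.choose M : ℝ) := by
          refine Finset.sum_le_sum fun j hj => ?_
          have hj' : j ≤ n := Nat.lt_succ_iff.1 (Finset.mem_range.1 hj)
          rw [hw, hterm j hj', hterm M hM]
          exact div_le_div_of_nonneg_right (Nat.cast_le.2 (choose_mul_pow_le_mode hM j hj'))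
            (pow_nonneg hn0.le n)
      _ = _ := by rw [Finset.sum_const, Finset.card_range, nsmul_eq_mul]
  have hE : w * (((U.powersetCard M).filter bad).card : ℝ) ≤
      binomProb p U bad := by
    have hsub : (U.powersetCard M).filter bad ⊆ U.powerset := fun S hS =>
      Finset.mem_powerset.2 (Finset.mem_powersetCard.1 (Finset.mem_filter.1 hS).1).1
    rw [binomProb, binomExp]
    refine le_trans ?_ (Finset.sum_le_sum_of_subset_of_nonneg hsub fun S _ _ => ?_)
    · rw [mul_comm, ← nsmul_eq_mul, ← Finset.sum_const]
      refine Finset.sum_le_sum fun S hS => ?_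
      rw [if_pos (Finset.mem_filter.1 hS).2,
        (Finset.mem_powersetCard.1 (Finset.mem_filter.1 hS).1).2, mul_one]
    · have : (0 : ℝ) ≤ if bad S then 1 else 0 := by split_ifs <;> norm_num
      exact mul_nonneg (mul_nonneg (pow_nonneg hp0 _) (pow_nonneg (by linarith) _)) this
  calc (((U.powersetCard M).filter bad).card : ℝ)
      ≤ (((n + 1 : ℕ) : ℝ) * (w * n.choose M)) * (((U.powersetCard M).filter bad).card : ℝ) := by
        nlinarith [Nat.cast_nonneg (α := ℝ) ((U.powersetCard M).filter bad).card]
    _ = ((n + 1 : ℕ) : ℝ) * (w * (((U.powersetCard M).filter bad).card : ℝ)) * (n.choose M) := by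
        ring
    _ ≤ _ := by gcongr

end Binomial

/-! ### Spread measures on tuples and their structure. -/

/-- The tuples in `T` which agree with `x` on the blocks in `J`. -/
def cyl {K B : Type} [DecidableEq B] (T : Finset (K → B)) (J : Finset K) (x : K → B) :
    Finset (K → B) :=
  T.filter fun y => ∀ j ∈ J, y j = x j

/-- The measure `μ` has large blockwise min-entropy outside of the blocks in `I`. -/
def Spread {K B : Type} [DecidableEq B] [Fintype K] [DecidableEq K] [Fintype B]
    (I : Finset K) (ρ : ℝ) (μ : (K → B) → ℝ) : Prop :=
  ∀ J : Finset K, Disjoint J I → ∀ x, ∑ y ∈ cyl Finset.univ J x, μ y ≤ ρ ^ J.card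

/-- The set `T` carries a spread measure of total mass at least `η`. -/
def Cap {K B : Type} [DecidableEq B] [Fintype K] [DecidableEq K] [Fintype B]
    (I : Finset K) (ρ η : ℝ) (T : Finset (K → B)) : Prop :=
  ∃ μ : (K → B) → ℝ, (∀ x, 0 ≤ μ x) ∧ (∀ x, x ∉ T → μ x = 0) ∧ Spread I ρ μ ∧ η ≤ ∑ x, μ x

/-- The edges of the tuple `x` between the blocks in `J` and the blocks outside of `I`. -/
def tupleEdges {K B : Type} [DecidableEq K] [DecidableEq B] [Fintype K] (I J : Finset K)
    (x : K → B) : Finset (Sym2 (K × B)) :=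
  ((J ×ˢ Iᶜ).filter fun ij => ij.1 ≠ ij.2).image fun ij => s((ij.1, x ij.1), (ij.2, x ij.2))

section Spread

variable {K B : Type} [DecidableEq B]

lemma mem_cyl {T : Finset (K → B)} {J : Finset K} {x y : K → B} :
    y ∈ cyl T J x ↔ y ∈ T ∧ ∀ j ∈ J, y j = x j := by
  simp [cyl]

lemma cyl_congr (T : Finset (K → B)) {J : Finset K} {x y : K → B} (h : ∀ j ∈ J, y j = x j) :
    cyl T J y = cyl T J x := by
  ext z
  simp only [mem_cyl]
  refine and_congr_right fun _ => forall₂_congr fun j hj => ?_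
  rw [h j hj]

lemma cyl_empty (T : Finset (K → B)) (x : K → B) : cyl T ∅ x = T := by
  ext; simp [mem_cyl]

lemma cyl_subset (T : Finset (K → B)) (J : Finset K) (x : K → B) : cyl T J x ⊆ T :=
  Finset.filter_subset _ _

lemma cyl_anti {T T' : Finset (K → B)} {J J' : Finset K} (x : K → B) (hT : T ⊆ T') (hJ : J' ⊆ J) :
    cyl T J x ⊆ cyl T' J' x := fun y hy => by
  rw [mem_cyl] at hy ⊢
  exact ⟨hT hy.1, fun j hj => hy.2 j (hJ hj)⟩

variable [DecidableEq K] [Fintype K]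

/-- The common edges of two tuples. -/
lemma card_tupleEdges_inter_le (I J : Finset K) (x y : K → B) :
    (tupleEdges I J x ∩ tupleEdges I J y).card ≤
      J.card * (Finset.univ.filter fun j => j ∉ I ∧ y j = x j).card := by
  rw [← Finset.card_product]
  refine (Finset.card_le_card fun e he => ?_).trans (Finset.card_image_le
    (f := fun ij : K × K => s((ij.1, x ij.1), (ij.2, x ij.2))))
  simp only [tupleEdges, Finset.mem_inter, Finset.mem_image, Finset.mem_filter,
    Finset.mem_product, Finset.mem_compl, Prod.exists] at he
  obtain ⟨⟨i, j, ⟨⟨hi, hj⟩, hij⟩, rfl⟩, ⟨i', j', ⟨⟨hi', hj'⟩, hij'⟩, h⟩⟩ := he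
  simp only [Finset.mem_image, Finset.mem_product, Finset.mem_filter, Finset.mem_univ, true_and,
    Prod.exists]
  refine ⟨i, j, ⟨hi, hj, ?_⟩, rfl⟩
  rw [Sym2.eq_iff] at h
  simp only [Prod.mk.injEq] at h
  rcases h with ⟨⟨rfl, h1⟩, ⟨rfl, h2⟩⟩ | ⟨⟨rfl, h1⟩, ⟨rfl, h2⟩⟩
  · exact h2
  · exact h1

variable [Fintype B]

lemma Cap.mono {I : Finset K} {ρ ρ' η η' : ℝ} {T T' : Finset (K → B)} (h : Cap I ρ η T)
    (hρ0 : 0 ≤ ρ) (hρ : ρ ≤ ρ') (hη : η' ≤ η) (hT : T ⊆ T') : Cap I ρ' η' T' := by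
  obtain ⟨μ, h0, h1, h2, h3⟩ := h
  exact ⟨μ, h0, fun x hx => h1 x fun h => hx (hT h),
    fun J hJ x => (h2 J hJ x).trans (pow_le_pow_left₀ hρ0 hρ _), hη.trans h3⟩

/-- Restricting a measure keeps it spread with the same ρ, and one of the two restrictions has at
least half of the mass. This is the price of one query. -/
lemma Cap.exists_half {I : Finset K} {ρ η : ℝ} {T S : Finset (K → B)} (h : Cap I ρ η T) :
    Cap I ρ (η / 2) (T ∩ S) ∨ Cap I ρ (η / 2) (T \ S) := by
  obtain ⟨μ, h0, h1, h2, h3⟩ := h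
  have key : ∀ Q : Finset (K → B), η / 2 ≤ ∑ x ∈ T ∩ Q, μ x → Cap I ρ (η / 2) (T ∩ Q) := by
    intro Q hQ
    refine ⟨fun x => if x ∈ T ∩ Q then μ x else 0, fun x => ?_, fun x hx => if_neg hx,
      fun J hJ x => ?_, ?_⟩
    · dsimp only; split_ifs
      exacts [h0 x, le_rfl]
    · refine le_trans (Finset.sum_le_sum fun y _ => ?_) (h2 J hJ x)
      split_ifs
      exacts [le_rfl, h0 y]
    · rwa [Finset.sum_ite_mem, Finset.univ_inter]
  have hsplit : ∑ x, μ x = ∑ x ∈ T ∩ S, μ x + ∑ x ∈ T ∩ Sᶜ, μ x := by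
    have h4 : ∑ x, μ x = ∑ x ∈ T, μ x :=
      (Finset.sum_subset (Finset.subset_univ T) fun x _ hx => h1 x hx).symm
    rw [h4, ← Finset.sum_inter_add_sum_sdiff T S, Finset.sdiff_eq_inter_compl]
  rw [Finset.sdiff_eq_inter_compl]
  by_cases h : η / 2 ≤ ∑ x ∈ T ∩ S, μ x
  · exact .inl (key S h)
  · exact .inr (key Sᶜ (by linarith))

/-- A spread measure splits along some small set `J` of blocks, which fixes all of the blocks that
it nearly determines. -/
lemma exists_structured {I : Finset K} {ρ ρ' η : ℝ} {μ : (K → B) → ℝ} {T : Finset (K → B)} {b : ℕ}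
    (hμ : ∀ x, 0 ≤ μ x) (hT : ∀ x, x ∉ T → μ x = 0) (hsp : Spread I ρ μ) (hη : 0 < η)
    (hm : η ≤ ∑ x, μ x) (hρ : 0 < ρ) (hρρ' : ρ ≤ ρ') (hb : ρ ^ (b + 1) < η * ρ' ^ (b + 1)) :
    ∃ J : Finset K, Disjoint J I ∧ J.card ≤ b ∧ ∃ T' ⊆ T,
      ∑ x, μ x ≤ 2 ^ Fintype.card K * ∑ x ∈ T', μ x ∧
      ∀ J', Disjoint J' (I ∪ J) → ∀ x,
        ∑ y ∈ cyl T' (J ∪ J') x, μ y ≤ ρ' ^ J'.card * ∑ y ∈ cyl T J x, μ y := by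
  classical
  set m := ∑ x, μ x with hm_def
  have hm0 : 0 < m := hη.trans_le hm
  have hρ' : 0 < ρ' := hρ.trans_le hρρ'
  have hTuniv : ∀ J x, ∑ y ∈ cyl T J x, μ y = ∑ y ∈ cyl Finset.univ J x, μ y := fun J x =>
    Finset.sum_subset (cyl_anti x (Finset.subset_univ T) subset_rfl) fun y hy hy' =>
      hT y fun h => hy' (mem_cyl.2 ⟨h, (mem_cyl.1 hy).2⟩)
  have hTm : ∑ y ∈ T, μ y = m := Finset.sum_subset (Finset.subset_univ T) fun x _ hx => hT x hx
  -- The sets of blocks on which the values of x carry at least the mass that ρ' would allow. A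
  -- largest one contains every block that is nearly determined.
  let heavy : (K → B) → Finset (Finset K) := fun x =>
    {J | Disjoint J I ∧ ρ' ^ J.card * m ≤ ∑ y ∈ cyl T J x, μ y}
  have hheavy : ∀ x J, J ∈ heavy x ↔ Disjoint J I ∧ ρ' ^ J.card * m ≤ ∑ y ∈ cyl T J x, μ y :=
    fun x J => by simp [heavy]
  have hne : ∀ x, (heavy x).Nonempty := fun x =>
    ⟨∅, by rw [hheavy]; simp [cyl_empty, hTm]⟩
  choose Jmax hJmem hJmax using fun x => (heavy x).exists_max_image Finset.card (hne x)
  -- Pigeonhole over the at most 2 ^ k possible values of `Jmax`.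
  obtain ⟨J, -, hJ⟩ : ∃ J ∈ (Finset.univ : Finset (Finset K)),
      m / 2 ^ Fintype.card K ≤ ∑ x ∈ T.filter (fun x => Jmax x = J), μ x := by
    refine Finset.exists_le_of_sum_le (f := fun _ => m / 2 ^ Fintype.card K)
      Finset.univ_nonempty ?_
    rw [Finset.sum_fiberwise_of_maps_to (fun x _ => Finset.mem_univ _), hTm]
    simp only [Finset.sum_const, Finset.card_univ, Fintype.card_finset, nsmul_eq_mul]
    push_cast
    rw [mul_div_cancel₀ _ (by positivity)]
  set T' := T.filter (fun x => Jmax x = J) with hT'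
  have hpos : 0 < ∑ x ∈ T', μ x := lt_of_lt_of_le (by positivity) hJ
  have hT'J : ∀ x ∈ T', Jmax x = J := fun x hx => (Finset.mem_filter.1 hx).2
  obtain ⟨x0, hx0⟩ : T'.Nonempty := Finset.nonempty_of_sum_ne_zero hpos.ne'
  have hJ0 := (hheavy x0 J).1 (hT'J x0 hx0 ▸ hJmem x0)
  refine ⟨J, hJ0.1, ?_, T', Finset.filter_subset _ _, ?_, fun J' hJ' x => ?_⟩
  -- A heavy set of more than b blocks would have mass at least ρ' ^ |J| η, more than the ρ ^ |J|
  -- permitted by the original spread.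
  · by_contra hcard
    push Not at hcard
    have h1 : ρ' ^ J.card * η ≤ ρ ^ J.card :=
      (mul_le_mul_of_nonneg_left hm (by positivity)).trans (hJ0.2.trans
        ((hTuniv J x0).le.trans (hsp J hJ0.1 x0)))
    obtain ⟨q, hq⟩ := Nat.exists_eq_add_of_le hcard
    have hq' : J.card = (b + 1) + q := by omega
    rw [hq', pow_add _ (b + 1) q, pow_add _ (b + 1) q] at h1
    have h2 : ρ ^ q ≤ ρ' ^ q := pow_le_pow_left₀ hρ.le hρρ' q
    have h3 : ρ ^ (b + 1) * ρ ^ q ≤ ρ ^ (b + 1) * ρ' ^ q :=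
      mul_le_mul_of_nonneg_left h2 (by positivity)
    have h4 : ρ ^ (b + 1) * ρ' ^ q < (η * ρ' ^ (b + 1)) * ρ' ^ q :=
      mul_lt_mul_of_pos_right hb (by positivity)
    linarith
  · rw [div_le_iff₀' (by positivity)] at hJ
    exact hJ
  · rw [Finset.disjoint_union_right] at hJ'
    by_cases hempty : cyl T' (J ∪ J') x = ∅
    · rw [hempty, Finset.sum_empty]
      exact mul_nonneg (by positivity) (Finset.sum_nonneg fun y _ => hμ y)
    obtain ⟨z, hz⟩ := Finset.nonempty_iff_ne_empty.2 hempty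
    rw [mem_cyl] at hz
    rw [← cyl_congr T' hz.2, ← cyl_congr T fun j hj => hz.2 j (Finset.mem_union_left _ hj)]
    have hTT' : ∑ y ∈ cyl T' (J ∪ J') z, μ y ≤ ∑ y ∈ cyl T (J ∪ J') z, μ y :=
      Finset.sum_le_sum_of_subset_of_nonneg
        (cyl_anti z (Finset.filter_subset _ _) subset_rfl) fun y _ _ => hμ y
    rcases J'.eq_empty_or_nonempty with rfl | hJ'ne
    · simpa using hTT'
    have hdisj : Disjoint J J' := hJ'.2.symm
    have hzJ := (hheavy z J).1 (hT'J z hz.1 ▸ hJmem z)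
    -- Since J is a largest heavy set for z, no proper enlargement of it is heavy. Comparison with
    -- the heavy cylinder over J turns this into relative spread.
    have hlight : ∑ y ∈ cyl T (J ∪ J') z, μ y < ρ' ^ (J ∪ J').card * m := by
      by_contra h
      push Not at h
      have h1 := hJmax z (J ∪ J') ((hheavy z _).2 ⟨Finset.disjoint_union_left.2 ⟨hJ0.1, hJ'.1⟩, h⟩)
      rw [hT'J z hz.1, Finset.card_union_of_disjoint hdisj] at h1
      have := Finset.card_pos.2 hJ'ne
      omega
    calc _ ≤ _ := hTT'
      _ ≤ ρ' ^ (J ∪ J').card * m := hlight.le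
      _ = ρ' ^ J'.card * (ρ' ^ J.card * m) := by
        rw [Finset.card_union_of_disjoint hdisj, pow_add]; ring
      _ ≤ _ := mul_le_mul_of_nonneg_left hzJ.2 (by positivity)

end Spread

/-! ### The packing number of a random edge set. -/

/-- The maximal total mass of a feasible weighting of the points `x` whose edge sets `E x` are
contained in `S`. -/
noncomputable def packing {X ι : Type} [Fintype X] (Feas : (X → ℝ) → Prop) (E : X → Finset ι)
    (S : Finset ι) : ℝ :=
  sSup {r | ∃ ν, Feas ν ∧ (∀ x, ¬ E x ⊆ S → ν x = 0) ∧ ∑ x, ν x = r}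

section Packing

variable {X ι : Type} [Fintype X] {Feas : (X → ℝ) → Prop} {E : X → Finset ι}

lemma le_packing {S : Finset ι} {B : ℝ} (hB : ∀ ν, Feas ν → ∑ x, ν x ≤ B) {ν : X → ℝ}
    (hν : Feas ν) (hS : ∀ x, ¬ E x ⊆ S → ν x = 0) : ∑ x, ν x ≤ packing Feas E S :=
  le_csSup ⟨B, by rintro _ ⟨ν, h, -, rfl⟩; exact hB ν h⟩ ⟨ν, hν, hS, rfl⟩

lemma exists_lt_of_lt_packing (h0 : Feas 0) {S : Finset ι} {r : ℝ} (hr : r < packing Feas E S) :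
    ∃ ν, Feas ν ∧ (∀ x, ¬ E x ⊆ S → ν x = 0) ∧ r < ∑ x, ν x := by
  obtain ⟨_, ⟨ν, h1, h2, rfl⟩, h3⟩ :=
    exists_lt_of_lt_csSup (s := {r | ∃ ν, Feas ν ∧ (∀ x, ¬ E x ⊆ S → ν x = 0) ∧ ∑ x, ν x = r})
      ⟨_, 0, h0, fun _ _ => rfl, rfl⟩ hr
  exact ⟨ν, h1, h2, h3⟩

-- Deleting the points that use e from a weighting for `insert e S` yields one for S and loses at
-- most L. An optimum over all feasible weightings is used, rather than an explicit weighting,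
-- precisely because it has this stability.
open Classical in
lemma abs_packing_insert_sub_le [DecidableEq ι] (h0 : Feas 0) {B L : ℝ}
    (hB : ∀ ν, Feas ν → ∑ x, ν x ≤ B)
    (hdown : ∀ ν ν' : X → ℝ, Feas ν → (∀ x, ν' x = ν x ∨ ν' x = 0) → Feas ν') (e : ι)
    (hL : ∀ ν, Feas ν → ∑ x with e ∈ E x, ν x ≤ L) (S : Finset ι) :
    |packing Feas E (insert e S) - packing Feas E S| ≤ L := by
  have hL0 : 0 ≤ L := by simpa using hL 0 h0
  rw [abs_le]
  constructor
  · have : packing Feas E S ≤ packing Feas E (insert e S) := by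
      refine csSup_le ⟨_, 0, h0, fun _ _ => rfl, rfl⟩ ?_
      rintro _ ⟨ν, h1, h2, rfl⟩
      exact le_packing hB h1 fun x hx => h2 x fun h => hx (h.trans (Finset.subset_insert _ _))
    linarith
  · have : packing Feas E (insert e S) ≤ packing Feas E S + L := by
      refine csSup_le ⟨_, 0, h0, fun _ _ => rfl, rfl⟩ ?_
      rintro _ ⟨ν, h1, h2, rfl⟩
      have h3 : ∑ x, (if e ∈ E x then 0 else ν x) ≤ packing Feas E S := by
        refine le_packing hB (hdown ν _ h1 fun x => ?_) fun x hx => ?_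
        · split_ifs <;> simp
        · split_ifs with he
          · rfl
          · exact h2 x fun h => hx fun a ha =>
              (Finset.mem_insert.1 (h ha)).resolve_left fun h => he (h ▸ ha)
      have h4 := hL ν h1
      rw [Finset.sum_filter] at h4
      have h5 : ∑ x, ν x = ∑ x, (if e ∈ E x then 0 else ν x) + ∑ x, (if e ∈ E x then ν x else 0) := by
        rw [← Finset.sum_add_distrib]
        exact Finset.sum_congr rfl fun x _ => by split_ifs <;> simp
      linarith
    linarith

end Packing

/-! ### Relatively spread weightings. -/

section Restoration

variable {K B : Type} [DecidableEq B] [Fintype K] [DecidableEq K] [Fintype B]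

/-- The cylinders over J partition the tuples, so cylinderwise comparisons add up. Cylinders that
miss s only help, as g is nonnegative. -/
lemma sum_le_mul_sum_of_cyl (J : Finset K) {f g : (K → B) → ℝ} {s t : Finset (K → B)} {a : ℝ}
    (ha : 0 ≤ a) (hg : ∀ x, 0 ≤ g x)
    (h : ∀ x ∈ s, ∑ y ∈ cyl s J x, f y ≤ a * ∑ y ∈ cyl t J x, g y) :
    ∑ x ∈ s, f x ≤ a * ∑ x ∈ t, g x := by
  let r : (K → B) → (J → B) := fun x j => x j
  rw [← Finset.sum_fiberwise_of_maps_to (g := r) (t := Finset.univ) (s := s)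
      (fun x _ => Finset.mem_univ _),
    ← Finset.sum_fiberwise_of_maps_to (g := r) (t := Finset.univ) (s := t)
      (fun x _ => Finset.mem_univ _), Finset.mul_sum]
  refine Finset.sum_le_sum fun l _ => ?_
  have hfib : ∀ (q : Finset (K → B)) (x : K → B), r x = l → q.filter (fun y => r y = l) =
      cyl q J x := by
    rintro q x rfl
    ext y
    simp only [r, Finset.mem_filter, mem_cyl, funext_iff, Subtype.forall]
  by_cases hs : s.filter (fun x => r x = l) = ∅
  · rw [hs, Finset.sum_empty]
    exact mul_nonneg ha (Finset.sum_nonneg fun x _ => hg x)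
  · obtain ⟨x, hx⟩ := Finset.nonempty_iff_ne_empty.2 hs
    rw [Finset.mem_filter] at hx
    rw [hfib s x hx.2, hfib t x hx.2]
    exact h x hx.1

/-- The weightings of `T'` which are spread out relative to `μ` inside of every `J`-cylinder. -/
def RelSpread (I J : Finset K) (ρ : ℝ) (μ : (K → B) → ℝ) (T T' : Finset (K → B))
    (ν : (K → B) → ℝ) : Prop :=
  (∀ x, 0 ≤ ν x) ∧ (∀ x, x ∉ T' → ν x = 0) ∧
    ∀ J', Disjoint J' (I ∪ J) → ∀ x,
      ∑ y ∈ cyl T' (J ∪ J') x, ν y ≤ ρ ^ J'.card * ∑ y ∈ cyl T J x, μ y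

section Deterministic

variable {I J : Finset K} {ρ ρ₂ : ℝ} {μ : (K → B) → ℝ} {T T' : Finset (K → B)}

omit [Fintype K] [Fintype B] in
lemma RelSpread.zero (hμ : ∀ x, 0 ≤ μ x) (hρ : 0 ≤ ρ) : RelSpread I J ρ μ T T' 0 := by
  refine ⟨fun _ => le_rfl, fun _ _ => rfl, fun J' _ x => ?_⟩
  simp only [Pi.zero_apply, Finset.sum_const_zero]
  exact mul_nonneg (pow_nonneg hρ _) (Finset.sum_nonneg fun y _ => hμ y)

omit [Fintype K] [Fintype B] in
lemma RelSpread.down {ν ν' : (K → B) → ℝ} (h : RelSpread I J ρ μ T T' ν)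
    (h' : ∀ x, ν' x = ν x ∨ ν' x = 0) : RelSpread I J ρ μ T T' ν' := by
  refine ⟨fun x => ?_, fun x hx => ?_, fun J' hJ' x => le_trans (Finset.sum_le_sum fun y _ => ?_)
    (h.2.2 J' hJ' x)⟩
  · rcases h' x with h1 | h1 <;> rw [h1]
    exact h.1 x
  · rcases h' x with h1 | h1 <;> rw [h1]
    exact h.2.1 x hx
  · rcases h' y with h1 | h1 <;> rw [h1]
    exact h.1 y

omit [Fintype K] [Fintype B] in
lemma RelSpread.cyl_le {ν : (K → B) → ℝ} (h : RelSpread I J ρ μ T T' ν) (x : K → B) :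
    ∑ y ∈ cyl T' J x, ν y ≤ ∑ y ∈ cyl T J x, μ y := by
  simpa using h.2.2 ∅ (Finset.disjoint_empty_left _) x

lemma RelSpread.sum_eq {ν : (K → B) → ℝ} (h : RelSpread I J ρ μ T T' ν) :
    ∑ x, ν x = ∑ x ∈ T', ν x :=
  (Finset.sum_subset (Finset.subset_univ T') fun x _ hx => h.2.1 x hx).symm

lemma RelSpread.sum_le {ν : (K → B) → ℝ} (hμ : ∀ x, 0 ≤ μ x)
    (h : RelSpread I J ρ μ T T' ν) : ∑ x, ν x ≤ ∑ x ∈ T, μ x := by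
  rw [h.sum_eq, ← one_mul (∑ x ∈ T, μ x)]
  exact sum_le_mul_sum_of_cyl J zero_le_one hμ fun x _ => by rw [one_mul]; exact h.cyl_le x

/-- An edge is used by few of the tuples. -/
lemma RelSpread.sum_edge_le {ν : (K → B) → ℝ} (hμ : ∀ x, 0 ≤ μ x) (hsp : Spread I ρ μ)
    (hJI : Disjoint J I) (h : RelSpread I J ρ₂ μ T T' ν) (hρ : 0 ≤ ρ) (hρρ₂ : ρ ≤ ρ₂)
    (e : Sym2 (K × B)) : ∑ x with e ∈ tupleEdges I J x, ν x ≤ ρ₂ ^ 2 := by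
  classical
  have hρ₂ := hρ.trans hρρ₂
  have hE : ∑ x with e ∈ tupleEdges I J x, ν x =
      ∑ x ∈ T'.filter (fun x => e ∈ tupleEdges I J x), ν x := by
    refine (Finset.sum_subset (Finset.filter_subset_filter _ (Finset.subset_univ _))
      fun x hx hx' => h.2.1 x fun hT => hx' ?_).symm
    exact Finset.mem_filter.2 ⟨hT, (Finset.mem_filter.1 hx).2⟩
  rw [hE]
  rcases (T'.filter (fun x => e ∈ tupleEdges I J x)).eq_empty_or_nonempty with h0 | ⟨x0, hx0⟩
  · rw [h0, Finset.sum_empty]; positivity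
  obtain ⟨hx0T, hx0e⟩ := Finset.mem_filter.1 hx0
  simp only [tupleEdges, Finset.mem_image, Finset.mem_filter, Finset.mem_product,
    Finset.mem_compl, Prod.exists] at hx0e
  obtain ⟨i, j, ⟨⟨hi, hj⟩, hij⟩, rfl⟩ := hx0e
  have hsub : T'.filter (fun x => s((i, x0 i), (j, x0 j)) ∈ tupleEdges I J x) ⊆
      cyl T' {i, j} x0 := by
    intro x hx
    obtain ⟨hxT, hxe⟩ := Finset.mem_filter.1 hx
    simp only [tupleEdges, Finset.mem_image, Finset.mem_filter, Finset.mem_product,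
      Finset.mem_compl, Prod.exists] at hxe
    obtain ⟨i', j', -, h'⟩ := hxe
    rw [Sym2.eq_iff] at h'
    simp only [Prod.mk.injEq] at h'
    rw [mem_cyl]
    refine ⟨hxT, ?_⟩
    rcases h' with ⟨⟨rfl, h1⟩, ⟨rfl, h2⟩⟩ | ⟨⟨rfl, h1⟩, ⟨rfl, h2⟩⟩ <;> simp [h1, h2]
  refine (Finset.sum_le_sum_of_subset_of_nonneg hsub fun x _ _ => h.1 x).trans ?_
  have hiI : i ∉ I := Finset.disjoint_left.1 hJI hi
  have huniv : ∀ Q, Disjoint Q I → ∑ x ∈ cyl T Q x0, μ x ≤ ρ ^ Q.card := fun Q hQ =>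
    (Finset.sum_le_sum_of_subset_of_nonneg (cyl_anti x0 (Finset.subset_univ T) subset_rfl)
      fun x _ _ => hμ x).trans (hsp Q hQ x0)
  have hcyl : ∀ Q ⊆ J, ∀ x ∈ cyl T' Q x0, cyl (cyl T Q x0) J x = cyl T J x := by
    intro Q hQ x hx
    ext y
    simp only [mem_cyl]
    constructor
    · rintro ⟨⟨h1, -⟩, h2⟩; exact ⟨h1, h2⟩
    · rintro ⟨h1, h2⟩
      exact ⟨⟨h1, fun q hq => (h2 q (hQ hq)).trans ((mem_cyl.1 hx).2 q hq)⟩, h2⟩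
  -- With both ends in J, the spread of μ yields both factors. Otherwise μ yields one factor for
  -- block i, and the relative spread of ν yields the other for block j.
  by_cases hjJ : j ∈ J
  · have h1 : ∑ x ∈ cyl T' {i, j} x0, ν x ≤ 1 * ∑ x ∈ cyl T {i, j} x0, μ x := by
      refine sum_le_mul_sum_of_cyl J zero_le_one hμ fun x hx => ?_
      rw [hcyl {i, j} (by intro q hq; simp at hq; rcases hq with rfl | rfl <;> assumption) x hx,
        one_mul]
      exact (Finset.sum_le_sum_of_subset_of_nonneg (cyl_anti x (cyl_subset _ _ _) subset_rfl)
        fun y _ _ => h.1 y).trans (h.cyl_le x)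
    have h2 := huniv {i, j} (by simp [hiI, hj])
    rw [Finset.card_pair hij] at h2
    calc _ ≤ _ := h1
      _ ≤ ρ ^ 2 := by rw [one_mul]; exact h2
      _ ≤ ρ₂ ^ 2 := pow_le_pow_left₀ hρ hρρ₂ 2
  · have h1 : ∑ x ∈ cyl T' {i, j} x0, ν x ≤ ρ₂ * ∑ x ∈ cyl T {i} x0, μ x := by
      refine sum_le_mul_sum_of_cyl J hρ₂ hμ fun x hx => ?_
      rw [hcyl {i} (by simpa using hi) x (cyl_anti x0 subset_rfl (by simp) hx)]
      have h3 := h.2.2 {j} (by simp [hj, hjJ]) x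
      rw [Finset.card_singleton, pow_one] at h3
      refine le_trans (Finset.sum_le_sum_of_subset_of_nonneg ?_ fun y _ _ => h.1 y) h3
      intro y hy
      simp only [mem_cyl] at hy hx ⊢
      refine ⟨hy.1.1, fun q hq => ?_⟩
      rcases Finset.mem_union.1 hq with hq | hq
      · exact hy.2 q hq
      · rw [Finset.mem_singleton.1 hq, hy.1.2 j (by simp), hx.2 j (by simp)]
    have h2 := huniv {i} (by simp [hiI])
    rw [Finset.card_singleton, pow_one] at h2
    calc _ ≤ _ := h1
      _ ≤ ρ₂ * ρ₂ := mul_le_mul_of_nonneg_left (h2.trans hρρ₂) hρ₂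
      _ = ρ₂ ^ 2 := (sq _).symm

/-- A relatively spread weighting of large mass is spread in some cylinder. -/
lemma RelSpread.exists_cap {ν : (K → B) → ℝ} (hμ : ∀ x, 0 ≤ μ x)
    (h : RelSpread I J ρ μ T T' ν) {E : (K → B) → Finset (Sym2 (K × B))}
    {S : Finset (Sym2 (K × B))} [DecidablePred fun x => E x ⊆ S] (hS : ∀ x, ¬ E x ⊆ S → ν x = 0)
    (hT' : T' ⊆ T) {a : ℝ} (ha : 0 ≤ a) (hm : a * ∑ x ∈ T, μ x < ∑ x, ν x) :
    ∃ x₀, Cap (I ∪ J) ρ a ((cyl T J x₀).filter fun x => E x ⊆ S) := by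
  -- Averaging: some cylinder over J retains more than the fraction a of its mass. Division by the
  -- mass α of that cylinder turns relative spread into spread.
  obtain ⟨x, hx, hlt⟩ : ∃ x ∈ T', a * ∑ y ∈ cyl T J x, μ y < ∑ y ∈ cyl T' J x, ν y := by
    by_contra hcon
    push Not at hcon
    rw [h.sum_eq] at hm
    exact absurd (sum_le_mul_sum_of_cyl J ha hμ hcon) (not_le.2 hm)
  set α := ∑ y ∈ cyl T J x, μ y with hα
  have hα0 : 0 ≤ α := Finset.sum_nonneg fun y _ => hμ y
  have hαpos : 0 < α := by
    refine lt_of_le_of_ne hα0 fun h0 => ?_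
    have := h.cyl_le x
    rw [← hα, ← h0] at this
    rw [← h0, mul_zero] at hlt
    linarith
  refine ⟨x, fun y => if y ∈ cyl T' J x then ν y / α else 0, fun y => ?_, fun y hy => ?_,
    fun J' hJ' z => ?_, ?_⟩
  · dsimp only; split_ifs
    · exact div_nonneg (h.1 y) hα0
    · exact le_rfl
  · dsimp only
    split_ifs with hyc
    · rw [Finset.mem_filter, not_and] at hy
      rw [hS y (hy (cyl_anti x hT' subset_rfl hyc)), zero_div]
    · rfl
  · rw [Finset.sum_ite_mem]
    rcases (cyl Finset.univ J' z ∩ cyl T' J x).eq_empty_or_nonempty with h0 | ⟨y, hy⟩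
    · rw [h0, Finset.sum_empty]
      have h1 := h.2.2 J' hJ' x
      have h2 : 0 ≤ ρ ^ J'.card * α :=
        (Finset.sum_nonneg fun y _ => h.1 y).trans h1
      exact nonneg_of_mul_nonneg_left h2 hαpos
    · rw [← Finset.sum_div, div_le_iff₀ hαpos]
      simp only [Finset.mem_inter, mem_cyl, Finset.mem_univ, true_and] at hy
      have h1 := h.2.2 J' hJ' y
      rw [cyl_congr T hy.2.2] at h1
      refine le_trans (Finset.sum_le_sum_of_subset_of_nonneg ?_ fun w _ _ => h.1 w) h1
      intro w hw
      simp only [Finset.mem_inter, mem_cyl, Finset.mem_univ, true_and] at hw ⊢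
      refine ⟨hw.2.1, fun q hq => ?_⟩
      rcases Finset.mem_union.1 hq with hq | hq
      · rw [hw.2.2 q hq, hy.2.2 q hq]
      · rw [hw.1 q hq, hy.1 q hq]
  · rw [Finset.sum_ite_mem, Finset.univ_inter, ← Finset.sum_div, le_div_iff₀ hαpos]
    exact hlt.le

end Deterministic

end Restoration

/-! ### Restoration in a random graph: second moment and concentration. -/

section Random

variable {K B : Type} [DecidableEq B] [Fintype K] [DecidableEq K] [Fintype B]

-- The off-diagonal part of the second moment. Tuples y are grouped by the set Q of blocks outside
-- of I ∪ J where they agree with x. Such a y shares at most b (b + |Q|) edges with x, and the group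
-- has mass at most ρ' ^ |Q| α. The gap between ρ' and ρ₂ pays p ^ (-b) for every block of Q, which
-- leaves p ^ (-b²) and at most 2 ^ k groups.
omit [Fintype B] in
lemma sum_cyl_div_pow_le {I J J' : Finset K} {ρ' ρ₂ p : ℝ} {μ : (K → B) → ℝ}
    {T T' : Finset (K → B)} {b : ℕ} (hp0 : 0 < p) (hp1 : p ≤ 1) (hμ : ∀ x, 0 ≤ μ x)
    (hJb : J.card ≤ b) (hρ'0 : 0 ≤ ρ')
    (hstr : ∀ J', Disjoint J' (I ∪ J) → ∀ x,
      ∑ y ∈ cyl T' (J ∪ J') x, μ y ≤ ρ' ^ J'.card * ∑ y ∈ cyl T J x, μ y)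
    (hρ₂ : ρ' ≤ ρ₂ * p ^ b) (hρ₂1 : ρ₂ ≤ 1) (hJ' : Disjoint J' (I ∪ J)) (x : K → B) :
    ∑ y ∈ cyl T' (J ∪ J') x, μ y / p ^ (tupleEdges I J x ∩ tupleEdges I J y).card ≤
      2 ^ Fintype.card K / p ^ (b * b) * (ρ₂ ^ J'.card * ∑ y ∈ cyl T J x, μ y) := by
  classical
  set α := ∑ y ∈ cyl T J x, μ y with hα
  have hα0 : 0 ≤ α := Finset.sum_nonneg fun y _ => hμ y
  have hpb : 0 < p ^ b := pow_pos hp0 b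
  have hρ₂0 : 0 ≤ ρ₂ := by
    by_contra h
    have := mul_neg_of_neg_of_pos (not_le.1 h) hpb
    linarith
  let 𝒥 : Finset (Finset K) := Finset.univ.filter fun Q => Disjoint Q (I ∪ J) ∧ J' ⊆ Q
  let A : (K → B) → Finset K := fun y => Finset.univ.filter fun j => j ∉ I ∪ J ∧ y j = x j
  have hA : ∀ y ∈ cyl T' (J ∪ J') x, A y ∈ 𝒥 := by
    intro y hy
    simp only [𝒥, A, Finset.mem_filter, Finset.mem_univ, true_and]
    refine ⟨Finset.disjoint_left.2 fun j hj => (Finset.mem_filter.1 hj).2.1, fun j hj => ?_⟩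
    rw [Finset.mem_filter]
    exact ⟨Finset.mem_univ _, Finset.disjoint_left.1 hJ' hj,
      (mem_cyl.1 hy).2 j (Finset.mem_union_right _ hj)⟩
  rw [← Finset.sum_fiberwise_of_maps_to hA]
  have hterm : ∀ Q ∈ 𝒥, ∑ y ∈ (cyl T' (J ∪ J') x).filter (fun y => A y = Q),
      μ y / p ^ (tupleEdges I J x ∩ tupleEdges I J y).card ≤
        ρ₂ ^ J'.card * α / p ^ (b * b) := by
    intro Q hQ
    obtain ⟨hQ1, hQ2⟩ := (Finset.mem_filter.1 hQ).2
    have h1 : ∀ y ∈ (cyl T' (J ∪ J') x).filter (fun y => A y = Q),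
        μ y / p ^ (tupleEdges I J x ∩ tupleEdges I J y).card ≤
          μ y / p ^ (b * b + b * Q.card) := by
      intro y hy
      obtain ⟨hy1, rfl⟩ := Finset.mem_filter.1 hy
      refine div_le_div_of_nonneg_left (hμ y) (pow_pos hp0 _)
        (pow_le_pow_of_le_one hp0.le hp1 ?_)
      refine (card_tupleEdges_inter_le I J x y).trans ?_
      have : (Finset.univ.filter fun j => j ∉ I ∧ y j = x j) ⊆ J ∪ A y := by
        intro j hj
        simp only [A, Finset.mem_filter, Finset.mem_univ, true_and, Finset.mem_union] at hj ⊢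
        tauto
      calc _ ≤ b * (J.card + (A y).card) :=
            Nat.mul_le_mul hJb ((Finset.card_le_card this).trans (Finset.card_union_le _ _))
        _ ≤ b * (b + (A y).card) := by gcongr
        _ = _ := by ring
    have h2 : ∑ y ∈ (cyl T' (J ∪ J') x).filter (fun y => A y = Q), μ y ≤ ρ' ^ Q.card * α := by
      refine le_trans (Finset.sum_le_sum_of_subset_of_nonneg ?_ fun y _ _ => hμ y) (hstr Q hQ1 x)
      intro y hy
      obtain ⟨hy1, hy2⟩ := Finset.mem_filter.1 hy
      rw [mem_cyl] at hy1 ⊢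
      refine ⟨hy1.1, fun j hj => ?_⟩
      rcases Finset.mem_union.1 hj with hj | hj
      · exact hy1.2 j (Finset.mem_union_left _ hj)
      · rw [← hy2] at hj
        exact (Finset.mem_filter.1 hj).2.2
    have h3 : ρ' ^ Q.card ≤ ρ₂ ^ J'.card * p ^ (b * Q.card) := by
      calc ρ' ^ Q.card ≤ (ρ₂ * p ^ b) ^ Q.card := pow_le_pow_left₀ hρ'0 hρ₂ _
        _ = ρ₂ ^ Q.card * p ^ (b * Q.card) := by rw [mul_pow, pow_mul]
        _ ≤ _ := mul_le_mul_of_nonneg_right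
          (pow_le_pow_of_le_one hρ₂0 hρ₂1 (Finset.card_le_card hQ2)) (pow_nonneg hp0.le _)
    refine (Finset.sum_le_sum h1).trans ?_
    rw [← Finset.sum_div, div_le_div_iff₀ (pow_pos hp0 _) (pow_pos hp0 _), pow_add]
    calc _ ≤ (ρ₂ ^ J'.card * p ^ (b * Q.card) * α) * p ^ (b * b) :=
          mul_le_mul_of_nonneg_right (h2.trans (mul_le_mul_of_nonneg_right h3 hα0))
            (pow_nonneg hp0.le _)
      _ = _ := by ring
  have hcard : (𝒥.card : ℝ) ≤ 2 ^ Fintype.card K := by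
    have := Finset.card_le_univ 𝒥
    rw [Fintype.card_finset] at this
    exact_mod_cast this
  have hpos : 0 ≤ ρ₂ ^ J'.card * α / p ^ (b * b) :=
    div_nonneg (mul_nonneg (pow_nonneg hρ₂0 _) hα0) (pow_nonneg hp0.le _)
  calc _ ≤ ∑ Q ∈ 𝒥, ρ₂ ^ J'.card * α / p ^ (b * b) := Finset.sum_le_sum hterm
    _ = 𝒥.card * (ρ₂ ^ J'.card * α / p ^ (b * b)) := by rw [Finset.sum_const, nsmul_eq_mul]
    _ ≤ 2 ^ Fintype.card K * (ρ₂ ^ J'.card * α / p ^ (b * b)) :=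
        mul_le_mul_of_nonneg_right hcard hpos
    _ = _ := by ring

/-- In a random graph, the restriction of a structured measure still has a spread part. -/
lemma le_binomExp_packing {I J : Finset K} {ρ' ρ₂ p : ℝ} {μ : (K → B) → ℝ}
    {T T' : Finset (K → B)} {b : ℕ} {U : Finset (Sym2 (K × B))} (hp0 : 0 < p) (hp1 : p ≤ 1)
    (hμ : ∀ x, 0 ≤ μ x) (hJb : J.card ≤ b) (hρ'0 : 0 < ρ') (hT' : T' ⊆ T)
    (hstr : ∀ J', Disjoint J' (I ∪ J) → ∀ x,
      ∑ y ∈ cyl T' (J ∪ J') x, μ y ≤ ρ' ^ J'.card * ∑ y ∈ cyl T J x, μ y)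
    (hρ₂ : ρ' ≤ ρ₂ * p ^ b) (hρ₂1 : ρ₂ ≤ 1) (hU : ∀ x, tupleEdges I J x ⊆ U) :
    p ^ (b * b) / (4 * 4 ^ Fintype.card K) * ∑ x ∈ T', μ x ≤
      binomExp p U (packing (RelSpread I J ρ₂ μ T T') (tupleEdges I J)) := by
  classical
  set k := Fintype.card K with hk
  have hpb : 0 < p ^ b := pow_pos hp0 b
  have hρ₂0 : 0 < ρ₂ := pos_of_mul_pos_left (hρ'0.trans_le hρ₂) hpb.le
  set E := tupleEdges (B := B) I J with hE
  set α : (K → B) → ℝ := fun x => ∑ y ∈ cyl T J x, μ y with hα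
  have hα0 : ∀ x, 0 ≤ α x := fun x => Finset.sum_nonneg fun y _ => hμ y
  -- One factor 2 ^ k pays for the union over Q and another for the overlap sum. The factor 2 keeps
  -- the expected truncation loss below half.
  set C : ℝ := 2 * 4 ^ k / p ^ (b * b) with hC
  have hC0 : 0 < C := by positivity
  let 𝒥 : Finset (Finset K) := Finset.univ.filter fun Q => Disjoint Q (I ∪ J)
  let Y : Finset (Sym2 (K × B)) → (K → B) → ℝ :=
    fun S x => if x ∈ T' ∧ E x ⊆ S then μ x / p ^ (E x).card else 0
  have hY0 : ∀ S x, 0 ≤ Y S x := fun S x => by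
    dsimp only [Y]; split_ifs
    exacts [div_nonneg (hμ x) (pow_nonneg hp0.le _), le_rfl]
  let Z : Finset (Sym2 (K × B)) → Finset K → (K → B) → ℝ :=
    fun S Q x => ∑ y ∈ cyl T' (J ∪ Q) x, Y S y
  have hZ0 : ∀ S Q x, 0 ≤ Z S Q x := fun S Q x => Finset.sum_nonneg fun y _ => hY0 S y
  let good : Finset (Sym2 (K × B)) → (K → B) → Prop :=
    fun S x => ∀ Q ∈ 𝒥, Z S Q x ≤ C * (ρ₂ ^ Q.card * α x)
  -- `Y` is an unbiased estimator of μ supported on the surviving tuples. Scaling it and discarding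
  -- the tuples in overweight cylinders makes it feasible.
  let ν : Finset (Sym2 (K × B)) → (K → B) → ℝ := fun S x => if good S x then Y S x / C else 0
  have hν0 : ∀ S x, 0 ≤ ν S x := fun S x => by
    dsimp only [ν]; split_ifs
    exacts [div_nonneg (hY0 S x) hC0.le, le_rfl]
  have hνY : ∀ S x, ν S x ≤ Y S x / C := fun S x => by
    dsimp only [ν]; split_ifs
    exacts [le_rfl, div_nonneg (hY0 S x) hC0.le]
  have hfeas : ∀ S, RelSpread I J ρ₂ μ T T' (ν S) := by
    intro S
    refine ⟨hν0 S, fun x hx => ?_, fun Q hQ x => ?_⟩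
    · simp [ν, Y, hx]
    · by_cases hall : ∀ y ∈ cyl T' (J ∪ Q) x, ν S y = 0
      · rw [Finset.sum_eq_zero hall]
        exact mul_nonneg (pow_nonneg hρ₂0.le _) (hα0 x)
      · push Not at hall
        -- A single retained tuple already certifies the bound for the entire cylinder containing
        -- it.
        obtain ⟨y, hy, hne⟩ := hall
        have hgood : good S y := by
          by_contra h
          exact hne (if_neg h)
        have h1 := hgood Q (Finset.mem_filter.2 ⟨Finset.mem_univ _, hQ⟩)
        have hy2 := (mem_cyl.1 hy).2
        have h2 : α y = α x := by
          simp only [hα]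
          rw [cyl_congr T fun j hj => hy2 j (Finset.mem_union_left _ hj)]
        simp only [Z] at h1
        rw [cyl_congr T' hy2, h2] at h1
        calc _ ≤ ∑ y ∈ cyl T' (J ∪ Q) x, Y S y / C := Finset.sum_le_sum fun y _ => hνY S y
          _ = (∑ y ∈ cyl T' (J ∪ Q) x, Y S y) / C := (Finset.sum_div _ _ _).symm
          _ ≤ _ := by rw [div_le_iff₀' hC0]; exact h1
  have hle : ∀ S, ∑ x ∈ T', ν S x ≤ packing (RelSpread I J ρ₂ μ T T') E S := by
    intro S
    rw [← (hfeas S).sum_eq]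
    refine le_packing (fun ν h => h.sum_le hμ) (hfeas S) fun x hx => ?_
    simp [ν, Y, hx]
  have hsingle : ∀ x ∈ T', (∀ S ⊆ U, True) → binomExp p U (fun S => Y S x) = μ x := by
    intro x hx _
    have : (fun S => Y S x) = fun S => μ x / p ^ (E x).card * if E x ⊆ S then 1 else 0 := by
      funext S
      simp only [Y, hx, true_and]
      split_ifs <;> simp
    rw [this, binomExp_const_mul, binomExp_subset (hU x)]
    exact div_mul_cancel₀ _ (pow_pos hp0 _).ne'
  have hpair : ∀ x ∈ T', ∀ y ∈ T', binomExp p U (fun S => Y S x * Y S y) =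
      μ x * (μ y / p ^ (E x ∩ E y).card) := by
    intro x hx y hy
    have : (fun S => Y S x * Y S y) = fun S => (μ x / p ^ (E x).card * (μ y / p ^ (E y).card)) *
        if E x ∪ E y ⊆ S then 1 else 0 := by
      funext S
      simp only [Y, hx, hy, true_and, Finset.union_subset_iff]
      by_cases h1 : E x ⊆ S <;> by_cases h2 : E y ⊆ S <;> simp [h1, h2]
    rw [this, binomExp_const_mul, binomExp_subset (Finset.union_subset (hU x) (hU y))]
    have hc : p ^ (E x ∪ E y).card * p ^ (E x ∩ E y).card = p ^ (E x).card * p ^ (E y).card := by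
      rw [← pow_add, ← pow_add, Finset.card_union_add_card_inter]
    have h1 := (pow_pos hp0 (E x ∩ E y).card).ne'
    have h2 := (pow_pos hp0 (E x).card).ne'
    have h3 := (pow_pos hp0 (E y).card).ne'
    field_simp
    linear_combination (μ x * μ y) * hc
  have hpoint : ∀ x ∈ T', μ x / 2 / C ≤ binomExp p U (fun S => ν S x) := by
    intro x hx
    rcases (hμ x).eq_or_lt with h0 | hpos
    · rw [← h0, zero_div, zero_div, ← binomExp_const (p := p) (U := U) 0]
      exact binomExp_mono hp0.le hp1 fun S _ => hν0 S x
    have hαpos : 0 < α x := hpos.trans_le (Finset.single_le_sum (f := μ) (fun y _ => hμ y)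
      (mem_cyl.2 ⟨hT' hx, fun _ _ => rfl⟩))
    let Θ : Finset K → ℝ := fun Q => C * (ρ₂ ^ Q.card * α x)
    have hΘ : ∀ Q, 0 < Θ Q := fun Q => by positivity
    -- Markov's inequality in pointwise form: when x is discarded, some Q has Z / Θ > 1, so its
    -- subtracted term outweighs `Y S x`.
    have hlow : ∀ S, (1 / C) * (Y S x - ∑ Q ∈ 𝒥, (1 / Θ Q) * (Y S x * Z S Q x)) ≤ ν S x := by
      intro S
      have hterm : ∀ Q ∈ 𝒥, 0 ≤ (1 / Θ Q) * (Y S x * Z S Q x) := fun Q _ =>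
        mul_nonneg (one_div_nonneg.2 (hΘ Q).le) (mul_nonneg (hY0 S x) (hZ0 S Q x))
      by_cases hg : good S x
      · simp only [ν, if_pos hg]
        rw [div_eq_mul_one_div (Y S x) C, mul_comm (Y S x) (1 / C)]
        refine mul_le_mul_of_nonneg_left ?_ (by positivity)
        linarith [Finset.sum_nonneg hterm]
      · simp only [ν, if_neg hg]
        simp only [good] at hg
        push Not at hg
        obtain ⟨Q, hQ, hlt⟩ := hg
        have h1 : Y S x ≤ (1 / Θ Q) * (Y S x * Z S Q x) := by
          rw [one_div, inv_mul_eq_div, le_div_iff₀ (hΘ Q)]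
          exact mul_le_mul_of_nonneg_left hlt.le (hY0 S x)
        have h2 := Finset.single_le_sum hterm hQ
        refine mul_nonpos_of_nonneg_of_nonpos (by positivity) (by linarith)
    refine le_trans ?_ (binomExp_mono hp0.le hp1 fun S _ => hlow S)
    rw [binomExp_const_mul, binomExp_sub, hsingle x hx fun _ _ => trivial, binomExp_sum]
    have hQ : ∀ Q ∈ 𝒥, binomExp p U (fun S => (1 / Θ Q) * (Y S x * Z S Q x)) ≤
        μ x / (2 * 2 ^ k) := by
      intro Q hQ
      have h1 : (fun S => Y S x * Z S Q x) =
          fun S => ∑ y ∈ cyl T' (J ∪ Q) x, Y S x * Y S y := by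
        funext S; exact Finset.mul_sum _ _ _
      rw [binomExp_const_mul, h1, binomExp_sum, Finset.sum_congr rfl fun y hy =>
        hpair x hx y (cyl_subset _ _ _ hy), ← Finset.mul_sum, one_div, inv_mul_eq_div,
        div_le_iff₀ (hΘ Q)]
      have h2 := sum_cyl_div_pow_le hp0 hp1 hμ hJb hρ'0.le hstr hρ₂ hρ₂1
        (Finset.mem_filter.1 hQ).2 x
      refine (mul_le_mul_of_nonneg_left h2 hpos.le).trans (le_of_eq ?_)
      simp only [Θ, hC, ← hk]
      have h4 : (4 : ℝ) ^ k = 2 ^ k * 2 ^ k := by rw [← mul_pow]; norm_num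
      rw [h4]
      field_simp
      rfl
    have hcard : (𝒥.card : ℝ) ≤ 2 ^ k := by
      have := Finset.card_le_univ 𝒥
      rw [Fintype.card_finset] at this
      exact_mod_cast this
    have hsum : ∑ Q ∈ 𝒥, binomExp p U (fun S => (1 / Θ Q) * (Y S x * Z S Q x)) ≤ μ x / 2 := by
      calc _ ≤ ∑ Q ∈ 𝒥, μ x / (2 * 2 ^ k) := Finset.sum_le_sum hQ
        _ = 𝒥.card * (μ x / (2 * 2 ^ k)) := by rw [Finset.sum_const, nsmul_eq_mul]
        _ ≤ 2 ^ k * (μ x / (2 * 2 ^ k)) :=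
            mul_le_mul_of_nonneg_right hcard (by positivity)
        _ = μ x / 2 := by field_simp
    rw [div_eq_mul_one_div _ C, mul_comm]
    refine mul_le_mul_of_nonneg_left ?_ (by positivity)
    linarith
  calc p ^ (b * b) / (4 * 4 ^ k) * ∑ x ∈ T', μ x = ∑ x ∈ T', μ x / 2 / C := by
        rw [Finset.mul_sum]
        refine Finset.sum_congr rfl fun x _ => ?_
        rw [hC]; field_simp; ring
    _ ≤ ∑ x ∈ T', binomExp p U (fun S => ν S x) := Finset.sum_le_sum hpoint
    _ = binomExp p U (fun S => ∑ x ∈ T', ν S x) := (binomExp_sum _ _).symm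
    _ ≤ _ := binomExp_mono hp0.le hp1 fun S _ => hle S

open Classical in
/-- With overwhelming probability, a large set of tuples contains a clique `J`-tuple whose
common neighbourhood in the set is spread. -/
lemma binomExp_not_restore_le {I : Finset K} {ρ ρ' ρ₂ η p : ℝ} {T : Finset (K → B)} {b : ℕ}
    {U : Finset (Sym2 (K × B))} (hp0 : 0 < p) (hp1 : p ≤ 1) (hη : 0 < η) (hcap : Cap I ρ η T)
    (hρ : 0 < ρ) (hρρ' : ρ ≤ ρ') (hb : ρ ^ (b + 1) < η * ρ' ^ (b + 1))
    (hρ₂ : ρ' ≤ ρ₂ * p ^ b) (hρ₂1 : ρ₂ ≤ 1)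
    (hU : ∀ J x, Disjoint J I → tupleEdges I J x ⊆ U) (hU1 : 1 ≤ U.card * ρ₂ ^ 2) :
    binomExp p U (fun S => if ∃ J x₀, Disjoint J I ∧
        Cap (I ∪ J) ρ₂ (p ^ (b * b) / (16 * 8 ^ Fintype.card K))
          ((cyl T J x₀).filter fun x => tupleEdges I J x ⊆ S) then 0 else 1) ≤
      Real.exp (-((η * (p ^ (b * b) / (4 * 8 ^ Fintype.card K))) ^ 2 /
        (16 * (U.card * ρ₂ ^ 4)))) := by
  set k := Fintype.card K with hk
  obtain ⟨μ, hμ, hμT, hsp, hm⟩ := hcap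
  obtain ⟨J, hJI, hJb, T', hT'T, hT', hstr⟩ :=
    exists_structured hμ hμT hsp hη hm hρ hρρ' hb
  set m := ∑ x, μ x with hm_def
  have hm0 : 0 < m := hη.trans_le hm
  have hTm : ∑ y ∈ T, μ y = m := Finset.sum_subset (Finset.subset_univ T) fun x _ hx => hμT x hx
  have hm1 : m ≤ 1 := by
    obtain ⟨x, -⟩ : (Finset.univ : Finset (K → B)).Nonempty :=
      Finset.nonempty_of_sum_ne_zero hm0.ne'
    simpa [cyl_empty] using hsp ∅ (Finset.disjoint_empty_left _) x
  have hpb : 0 < p ^ b := pow_pos hp0 b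
  have hρ'0 : 0 < ρ' := hρ.trans_le hρρ'
  have hρ₂0 : 0 < ρ₂ := pos_of_mul_pos_left (hρ'0.trans_le hρ₂) hpb.le
  have hρρ₂ : ρ ≤ ρ₂ := by
    have : p ^ b ≤ 1 := pow_le_one₀ hp0.le hp1
    nlinarith
  set Ψ := packing (RelSpread I J ρ₂ μ T T') (tupleEdges I J) with hΨ
  set q : ℝ := p ^ (b * b) / (4 * 8 ^ k) with hq
  have hq0 : 0 < q := by positivity
  have hq1 : q ≤ 1 := by
    rw [hq, div_le_one (by positivity)]
    have h1 : p ^ (b * b) ≤ 1 := pow_le_one₀ hp0.le hp1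
    have h2 : (1 : ℝ) ≤ 8 ^ k := one_le_pow₀ (by norm_num)
    linarith
  have hEΨ : m * q ≤ binomExp p U Ψ := by
    refine le_trans ?_ (le_binomExp_packing hp0 hp1 hμ hJb hρ'0 hT'T hstr hρ₂ hρ₂1
      fun x => hU J x hJI)
    rw [hq, ← hk]
    have h8 : (8 : ℝ) ^ k = 4 ^ k * 2 ^ k := by rw [← mul_pow]; norm_num
    calc m * (p ^ (b * b) / (4 * 8 ^ k)) ≤
          (2 ^ k * ∑ x ∈ T', μ x) * (p ^ (b * b) / (4 * 8 ^ k)) :=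
          mul_le_mul_of_nonneg_right hT' hq0.le
      _ = _ := by rw [h8]; field_simp
  have hzero : RelSpread I J ρ₂ μ T T' 0 := RelSpread.zero hμ hρ₂0.le
  have htail := binomExp_lt_half_le (U := U) (L := ρ₂ ^ 2) (t := m * q) hp0.le hp1 Ψ
    (by positivity) (by positivity) (by nlinarith)
    (fun e _ S _ => abs_packing_insert_sub_le hzero (fun ν h => h.sum_le hμ)
      (fun ν ν' h h' => h.down h') e
      (fun ν h => h.sum_edge_le hμ hsp hJI hρ.le hρρ₂ e) S) hEΨ
  refine le_trans (binomExp_mono hp0.le hp1 fun S _ => ?_) (htail.trans ?_)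
  · by_cases hlt : Ψ S < m * q / 2
    · rw [if_pos hlt]; split_ifs <;> norm_num
    · rw [if_neg hlt, if_pos]
      -- The concentration bound gives m q / 2. The supremum need not be attained, so m q / 4 is
      -- used, which turns the constant 4 of q into 16.
      obtain ⟨ν, hν, hνS, hνm⟩ := exists_lt_of_lt_packing hzero
        (show m * q / 4 < packing (RelSpread I J ρ₂ μ T T') (tupleEdges I J) S by
          have : 0 < m * q := by positivity
          rw [← hΨ]; linarith)
      obtain ⟨x₀, hx₀⟩ := hν.exists_cap hμ hνS hT'T (a := q / 4) (by positivity)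
        (by rw [hTm]; linarith)
      refine ⟨J, x₀, hJI, ?_⟩
      have : q / 4 = p ^ (b * b) / (16 * 8 ^ k) := by rw [hq]; field_simp; norm_num
      rwa [← this]
  · rw [Real.exp_le_exp, neg_le_neg_iff]
    have h4 : (ρ₂ ^ 2) ^ 2 = ρ₂ ^ 4 := by ring
    rw [h4]
    gcongr

end Random

/-! ### The adversary argument and the union bound. -/

/-- The sets which are described by at most `e` queries to `𝓕` and their answers. -/
def queryFamily {X : Type} [DecidableEq X] [Fintype X] (𝓕 : Finset (Finset X)) :
    ℕ → Finset (Finset X)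
  | 0 => {Finset.univ}
  | e + 1 => queryFamily 𝓕 e ∪ (Finset.image₂ (· ∩ ·) (queryFamily 𝓕 e) 𝓕 ∪
      Finset.image₂ (· \ ·) (queryFamily 𝓕 e) 𝓕)

lemma card_queryFamily_le {X : Type} [DecidableEq X] [Fintype X] (𝓕 : Finset (Finset X)) (e : ℕ) :
    (queryFamily 𝓕 e).card ≤ (1 + 2 * 𝓕.card) ^ e := by
  induction e with
  | zero => simp [queryFamily]
  | succ e ih =>
    have h1 : (Finset.image₂ (· ∩ ·) (queryFamily 𝓕 e) 𝓕).card ≤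
        (queryFamily 𝓕 e).card * 𝓕.card := Finset.card_image₂_le _ _ _
    have h2 : (Finset.image₂ (· \ ·) (queryFamily 𝓕 e) 𝓕).card ≤
        (queryFamily 𝓕 e).card * 𝓕.card := Finset.card_image₂_le _ _ _
    calc (queryFamily 𝓕 (e + 1)).card ≤ (queryFamily 𝓕 e).card +
          ((queryFamily 𝓕 e).card * 𝓕.card + (queryFamily 𝓕 e).card * 𝓕.card) :=
          (Finset.card_union_le _ _).trans (Nat.add_le_add_left
            ((Finset.card_union_le _ _).trans (Nat.add_le_add h1 h2)) _)
      _ = (queryFamily 𝓕 e).card * (1 + 2 * 𝓕.card) := by ring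
      _ ≤ _ := by rw [pow_succ]; exact Nat.mul_le_mul_right _ ih

lemma queryFamily_mono {X : Type} [DecidableEq X] [Fintype X] (𝓕 : Finset (Finset X)) {e e' : ℕ}
    (h : e ≤ e') : queryFamily 𝓕 e ⊆ queryFamily 𝓕 e' := by
  induction h with
  | refl => exact subset_rfl
  | step _ ih => exact ih.trans Finset.subset_union_left

/-- All of the tuples in `R` use a fixed pair of vertices which is not an edge of `S`. -/
def UsesNonEdge {K B : Type} (S : Finset (Sym2 (K × B))) (R : Finset (K → B)) : Prop :=
  R = ∅ ∨ ∃ u v : K × B, u ≠ v ∧ s(u, v) ∉ S ∧ ∀ x ∈ R, x u.1 = u.2 ∧ x v.1 = v.2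

/-- The vertices of the box `W` in the blocks in `I` are adjacent to all others. -/
def BoxJoined {K B : Type} (S : Finset (Sym2 (K × B))) (I : Finset K) (W : K → Finset B) : Prop :=
  ∀ i ∈ I, ∀ j, j ≠ i → ∀ a ∈ W i, ∀ b ∈ W j, s((i, a), (j, b)) ∈ S

section Adversary

variable {K B : Type} [DecidableEq B] [Fintype K] [DecidableEq K] [Fintype B]

/-- Some clique extension inside of `T` has a spread common neighbourhood. -/
def Restores (S : Finset (Sym2 (K × B))) (I : Finset K) (ρ κ : ℝ) (T : Finset (K → B)) : Prop :=
  ∃ (J : Finset K) (x₀ : K → B), Disjoint J I ∧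
    Cap (I ∪ J) ρ κ ((cyl T J x₀).filter fun x => tupleEdges I J x ⊆ S)

omit [Fintype K] [DecidableEq K] [DecidableEq B] [Fintype B] in
lemma UsesNonEdge.mono {S : Finset (Sym2 (K × B))} (R R' : Finset (K → B)) (h : R' ⊆ R)
    (hR : UsesNonEdge S R) : UsesNonEdge S R' := by
  rcases hR with rfl | ⟨u, v, h1, h2, h3⟩
  · exact .inl (Finset.subset_empty.1 h)
  · exact .inr ⟨u, v, h1, h2, fun x hx => h3 x (h hx)⟩

lemma Cap.nonempty {I : Finset K} {ρ η : ℝ} {T : Finset (K → B)} (h : Cap I ρ η T) (hη : 0 < η) :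
    T.Nonempty := by
  obtain ⟨μ, -, h1, -, h3⟩ := h
  by_contra hT
  rw [Finset.not_nonempty_iff_eq_empty] at hT
  rw [Finset.sum_eq_zero fun x _ => h1 x (by simp [hT])] at h3
  linarith

/-- If each nonempty part fixed two blocks outside of I, it would have mass at most ρ², and n such
parts cannot carry the mass η. -/
lemma Cap.exists_mem_of_coveredBy {P : Finset (K → B) → Prop} {n : ℕ} {I : Finset K} {ρ η : ℝ}
    {R T : Finset (K → B)} (hR : CoveredBy P n R) (h : Cap I ρ η (R ∩ T)) (hn : n * ρ ^ 2 < η) :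
    ∃ C, P C ∧ (C ∩ T).Nonempty ∧ ∀ J x, Disjoint J I → J.card = 2 →
      ¬ (C ∩ T ⊆ cyl Finset.univ J x) := by
  obtain ⟨μ, h0, h1, h2, h3⟩ := h
  obtain ⟨𝒞, hc1, hc2, hc3⟩ := hR
  by_contra hcon
  push Not at hcon
  have hC : ∀ C ∈ 𝒞, ∑ x ∈ C ∩ T, μ x ≤ ρ ^ 2 := by
    intro C hC
    rcases (C ∩ T).eq_empty_or_nonempty with h | h
    · rw [h, Finset.sum_empty]; positivity
    · obtain ⟨J, x, hJ, hJ2, hsub⟩ := hcon C (hc2 C hC) h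
      rw [← hJ2]
      exact (Finset.sum_le_sum_of_subset_of_nonneg hsub fun x _ _ => h0 x).trans (h2 J hJ x)
  have hsum : ∑ x, μ x ≤ ∑ C ∈ 𝒞, ∑ x ∈ C ∩ T, μ x := by
    have h4 : ∑ x, μ x = ∑ x ∈ R ∩ T, μ x :=
      (Finset.sum_subset (Finset.subset_univ _) fun x _ hx => h1 x hx).symm
    have h5 : ∀ C ∈ 𝒞, ∑ x ∈ C ∩ T, μ x = ∑ x, if x ∈ C ∩ T then μ x else 0 := fun C _ => by
      rw [Finset.sum_ite_mem, Finset.univ_inter]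
    rw [h4, Finset.sum_congr rfl h5, Finset.sum_comm]
    have hterm : ∀ x, ∀ C ∈ 𝒞, 0 ≤ if x ∈ C ∩ T then μ x else 0 := fun x C _ => by
      split_ifs
      exacts [h0 x, le_rfl]
    refine le_trans (Finset.sum_le_sum fun x hx => ?_) (Finset.sum_le_sum_of_subset_of_nonneg
      (Finset.subset_univ (R ∩ T)) fun x _ _ => Finset.sum_nonneg (hterm x))
    obtain ⟨hxR, hxT⟩ := Finset.mem_inter.1 hx
    obtain ⟨C, hC, hxC⟩ := Finset.mem_biUnion.1 (hc3 hxR)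
    refine le_trans (le_of_eq ?_) (Finset.single_le_sum (hterm x) hC)
    rw [if_pos (show x ∈ C ∩ T from Finset.mem_inter.2 ⟨hxC, hxT⟩)]
  have h5 : ∑ C ∈ 𝒞, ∑ x ∈ C ∩ T, μ x ≤ n * ρ ^ 2 := by
    calc _ ≤ ∑ C ∈ 𝒞, ρ ^ 2 := Finset.sum_le_sum hC
      _ = 𝒞.card * ρ ^ 2 := by rw [Finset.sum_const, nsmul_eq_mul]
      _ ≤ n * ρ ^ 2 := by gcongr
  linarith

/-- A spread set inside of a joined box is not covered by few non-edges. -/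
lemma not_cap_of_coveredBy {S : Finset (Sym2 (K × B))} {n : ℕ} {I : Finset K} {W : K → Finset B}
    {ρ η : ℝ} {R : Finset (K → B)} (hR : CoveredBy (UsesNonEdge S) n R) (hW : BoxJoined S I W)
    (hn : n * ρ ^ 2 < η) : ¬ Cap I ρ η (R ∩ Fintype.piFinset W) := by
  intro h
  obtain ⟨C, hC, hne, hcyl⟩ := h.exists_mem_of_coveredBy hR hn
  obtain ⟨x, hx⟩ := hne
  obtain ⟨hxC, hxW⟩ := Finset.mem_inter.1 hx
  rw [Fintype.mem_piFinset] at hxW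
  rcases hC with rfl | ⟨⟨i, a⟩, ⟨j, b⟩, huv, hS, hall⟩
  · simp at hxC
  obtain ⟨h1, h2⟩ := hall x hxC
  dsimp only at h1 h2
  have hij : i ≠ j := by
    rintro rfl
    exact huv (by rw [← h1, ← h2])
  -- Both vertices lie in the box, so a finished block at either end would make the pair an edge.
  have hiI : i ∉ I := fun hi => hS (hW i hi j hij.symm a (h1 ▸ hxW i) b (h2 ▸ hxW j))
  have hjI : j ∉ I := fun hj => hS (Sym2.eq_swap ▸ hW j hj i hij b (h2 ▸ hxW j) a (h1 ▸ hxW i))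
  refine hcyl {i, j} x (by simp [hiI, hjI]) (Finset.card_pair hij) fun y hy => ?_
  have := hall y (Finset.mem_inter.1 hy).1
  dsimp only at this
  simp [mem_cyl, this, h1, h2]

/-- The adversary always follows the answer with more mass. The mass never falls below η / 2 ^ q
during these steps, so `hleaf` excludes reaching a leaf early. -/
lemma exists_queries {𝓕 : Finset (Finset (K → B))} {P : Finset (K → B) → Prop} {I : Finset K}
    {ρ η : ℝ} {T : Finset (K → B)} (hρ : 0 ≤ ρ) (hη : 0 ≤ η) (q : ℕ)
    (hleaf : ∀ R, P R → ¬ Cap I ρ (η / 2 ^ q) (R ∩ T)) {d e : ℕ} {R : Finset (K → B)}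
    (htree : SearchTree 𝓕 P d R) (hR : R ∈ queryFamily 𝓕 e) (hcap : Cap I ρ η (R ∩ T)) :
    ∃ R' ∈ queryFamily 𝓕 (e + q), SearchTree 𝓕 P (d - q) R' ∧
      Cap I ρ (η / 2 ^ q) (R' ∩ T) := by
  induction q generalizing d e R η with
  | zero => exact ⟨R, hR, htree, by simpa using hcap⟩
  | succ q ih =>
    have hpow : η / 2 / 2 ^ q = η / 2 ^ (q + 1) := by rw [pow_succ']; field_simp
    cases htree with
    | leaf _ _ hP =>
      refine absurd (hcap.mono hρ le_rfl ?_ subset_rfl) (hleaf R hP)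
      exact div_le_self hη (one_le_pow₀ (by norm_num))
    | node d _ g hg h1 h2 =>
      have e1 : ∀ A : Finset (K → B), R ∩ T ∩ A = R ∩ A ∩ T := fun A =>
        Finset.inter_right_comm _ _ _
      have e2 : (R ∩ T) \ g = (R \ g) ∩ T := by
        ext; simp only [Finset.mem_inter, Finset.mem_sdiff]; tauto
      have hd : d + 1 - (q + 1) = d - q := by omega
      have he : e + (q + 1) = e + 1 + q := by omega
      rw [hd, he, ← hpow]
      rw [← hpow] at hleaf
      rcases hcap.exists_half (S := g) with h | h
      · rw [e1] at h
        refine ih (by positivity) hleaf h1 ?_ h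
        exact Finset.mem_union_right _ (Finset.mem_union_left _ (Finset.mem_image₂_of_mem hR hg))
      · rw [e2] at h
        refine ih (by positivity) hleaf h2 ?_ h
        exact Finset.mem_union_right _ (Finset.mem_union_right _ (Finset.mem_image₂_of_mem hR hg))

/-- The new box fixes the blocks in J to x₀ and elsewhere outside of I keeps only the common
neighbours. Surviving tuples lie in this box by definition, and any one of them shows that the
vertices fixed in J are mutually adjacent. -/
lemma Restores.exists_joined {S : Finset (Sym2 (K × B))} {I : Finset K} {W : K → Finset B}
    {ρ κ : ℝ} {R : Finset (K → B)} (hρ : 0 ≤ ρ) (hκ : 0 < κ) (hW : BoxJoined S I W)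
    (h : Restores S I ρ κ (R ∩ Fintype.piFinset W)) :
    ∃ I' W', BoxJoined S I' W' ∧ Cap I' ρ κ (R ∩ Fintype.piFinset W') := by
  classical
  obtain ⟨J, x₀, hJI, hcap⟩ := h
  have hedge : ∀ x : K → B, tupleEdges I J x ⊆ S → ∀ i ∈ J, ∀ j, j ∉ I → j ≠ i →
      s((i, x i), (j, x j)) ∈ S := by
    intro x hx i hi j hj hij
    refine hx ?_
    simp only [tupleEdges, Finset.mem_image, Finset.mem_filter, Finset.mem_product,
      Finset.mem_compl, Prod.exists]
    exact ⟨i, j, ⟨⟨hi, hj⟩, hij.symm⟩, rfl⟩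
  obtain ⟨z, hz⟩ := hcap.nonempty hκ
  simp only [Finset.mem_filter, mem_cyl, Finset.mem_inter, Fintype.mem_piFinset] at hz
  obtain ⟨⟨⟨-, hzW⟩, hzJ⟩, hzE⟩ := hz
  let W' : K → Finset B := fun j => if j ∈ J then {x₀ j} else
    (W j).filter fun b => j ∉ I → ∀ i ∈ J, s((i, x₀ i), (j, b)) ∈ S
  have hW'W : ∀ j, W' j ⊆ W j := by
    intro j
    simp only [W']
    split_ifs with h
    · rw [Finset.singleton_subset_iff, ← hzJ j h]; exact hzW j
    · exact Finset.filter_subset _ _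
  have hW'J : ∀ j ∈ J, ∀ a ∈ W' j, a = x₀ j := by
    intro j hj a ha
    simpa [W', hj] using ha
  refine ⟨I ∪ J, W', ?_, hcap.mono hρ le_rfl le_rfl fun x hx => ?_⟩
  · intro i hi j hji a ha b hb
    by_cases hiI : i ∈ I
    · exact hW i hiI j hji a (hW'W i ha) b (hW'W j hb)
    have hiJ : i ∈ J := (Finset.mem_union.1 hi).resolve_left hiI
    by_cases hjI : j ∈ I
    · rw [Sym2.eq_swap]
      exact hW j hjI i hji.symm b (hW'W j hb) a (hW'W i ha)
    rw [hW'J i hiJ a ha]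
    by_cases hjJ : j ∈ J
    · rw [hW'J j hjJ b hb, ← hzJ i hiJ, ← hzJ j hjJ]
      exact hedge z hzE i hiJ j hjI hji
    · simp only [W', if_neg hjJ, Finset.mem_filter] at hb
      exact hb.2 hjI i hiJ
  · simp only [Finset.mem_filter, mem_cyl, Finset.mem_inter, Fintype.mem_piFinset] at hx ⊢
    obtain ⟨⟨⟨hxR, hxW⟩, hxJ⟩, hxE⟩ := hx
    refine ⟨hxR, fun j => ?_⟩
    simp only [W']
    split_ifs with h
    · rw [hxJ j h]; exact Finset.mem_singleton_self _
    · refine Finset.mem_filter.2 ⟨hxW j, fun hjI i hi => ?_⟩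
      rw [← hxJ i hi]
      exact hedge x hxE i hi j hjI fun hji => h (hji ▸ hi)

/-- Witnessed by the uniform measure, the starting point of the adversary. -/
lemma cap_univ [Nonempty B] : Cap (∅ : Finset K) (1 / (Fintype.card B : ℝ)) 1
    (Finset.univ : Finset (K → B)) := by
  have hN : (0 : ℝ) < Fintype.card B := by exact_mod_cast Fintype.card_pos
  refine ⟨fun _ => 1 / (Fintype.card B : ℝ) ^ Fintype.card K, fun x => by positivity,
    fun x hx => absurd (Finset.mem_univ x) hx, fun J _ x => ?_, ?_⟩
  · have h1 : cyl Finset.univ J x =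
        Fintype.piFinset fun j => if j ∈ J then {x j} else Finset.univ := by
      ext y
      simp only [mem_cyl, Finset.mem_univ, true_and, Fintype.mem_piFinset]
      refine forall_congr' fun j => ?_
      split_ifs with h <;> simp [h]
    have h2 : (cyl Finset.univ J x).card = Fintype.card B ^ (Fintype.card K - J.card) := by
      rw [h1, Fintype.card_piFinset]
      have : ∀ j, (if j ∈ J then ({x j} : Finset B) else Finset.univ).card =
          if j ∈ J then 1 else Fintype.card B := fun j => by split_ifs <;> simp
      simp only [this]
      rw [Finset.prod_ite, Finset.prod_const_one, one_mul, Finset.prod_const]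
      congr 1
      rw [← Finset.card_compl]
      congr 1; ext; simp
    rw [Finset.sum_const, nsmul_eq_mul, h2, Nat.cast_pow, one_div_pow,
      ← Nat.add_sub_cancel' (Finset.card_le_univ J)]
    rw [Nat.add_sub_cancel_left, pow_add]
    field_simp
    exact le_rfl
  · rw [Finset.sum_const, nsmul_eq_mul, Finset.card_univ, Fintype.card_fun]
    push_cast
    rw [mul_one_div_cancel (by positivity)]

/-- The adversary argument: no shallow search tree finds a non-edge of a graph in which all sets
described by few queries restore. -/
theorem not_searchTree_of_restores [Nonempty B] {S : Finset (Sym2 (K × B))}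
    {𝓕 : Finset (Finset (K → B))} {ρ : ℕ → ℝ} {κ : ℝ} {n r q d : ℕ}
    (hρ0 : ρ 0 = 1 / (Fintype.card B : ℝ)) (hρ : ∀ i, 0 ≤ ρ i) (hκ0 : 0 < κ) (hκ1 : κ ≤ 1)
    (hn : ∀ i ≤ r, n * ρ i ^ 2 < κ / 2 ^ q) (hd : d ≤ r * q)
    (hres : ∀ i < r, ∀ (I : Finset K) (W : K → Finset B), ∀ R ∈ queryFamily 𝓕 (r * q),
      Cap I (ρ i) (κ / 2 ^ q) (R ∩ Fintype.piFinset W) →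
        Restores S I (ρ (i + 1)) κ (R ∩ Fintype.piFinset W)) :
    ¬ SearchTree 𝓕 (CoveredBy (UsesNonEdge S) n) d Finset.univ := by
  intro htree
  -- The state after i rounds: i q queries have been answered, the mass is back at κ, and only the
  -- spread parameter has deteriorated.
  have key : ∀ i ≤ r, ∃ (I : Finset K) (W : K → Finset B), ∃ R ∈ queryFamily 𝓕 (i * q),
      SearchTree 𝓕 (CoveredBy (UsesNonEdge S) n) (d - i * q) R ∧ BoxJoined S I W ∧
        Cap I (ρ i) κ (R ∩ Fintype.piFinset W) := by
    intro i
    induction i with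
    | zero =>
      intro _
      refine ⟨∅, fun _ => Finset.univ, Finset.univ, by simp [queryFamily], by simpa using htree,
        fun i hi => absurd hi (Finset.notMem_empty i), ?_⟩
      rw [hρ0]
      refine cap_univ.mono (by positivity) le_rfl hκ1 fun x _ => ?_
      simp
    | succ i ih =>
      intro hi
      obtain ⟨I, W, R, hR, ht, hJ, hcap⟩ := ih (by omega)
      obtain ⟨R', hR', ht', hcap'⟩ := exists_queries (hρ i) hκ0.le q
        (fun R hR => not_cap_of_coveredBy hR hJ (hn i (by omega))) ht hR hcap
      have he : i * q + q = (i + 1) * q := by ring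
      rw [he] at hR'
      obtain ⟨I', W', hJ', hcap''⟩ := (hres i (by omega) I W R'
        (queryFamily_mono 𝓕 (Nat.mul_le_mul_right q hi) hR') hcap').exists_joined (hρ _) hκ0 hJ
      refine ⟨I', W', R', hR', ?_, hJ', hcap''⟩
      rwa [← he, ← Nat.sub_sub]
  obtain ⟨I, W, R, -, ht, hJ, hcap⟩ := key r le_rfl
  rw [Nat.sub_eq_zero_of_le hd] at ht
  cases ht with
  | leaf _ _ hP =>
    refine not_cap_of_coveredBy hP hJ ((hn r le_rfl).trans_le ?_) hcap
    exact div_le_self hκ0.le (one_le_pow₀ (by norm_num))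

/-- In a random graph, with high probability there is no shallow search tree for a non-edge. -/
theorem binomExp_searchTree_le [Nonempty B] {𝓕 : Finset (Finset (K → B))}
    {U : Finset (Sym2 (K × B))} {ρ ρ' : ℕ → ℝ} {κ p : ℝ} {n r q d b : ℕ}
    (hp0 : 0 < p) (hp1 : p ≤ 1) (hκ : κ = p ^ (b * b) / (16 * 8 ^ Fintype.card K))
    (hρ0 : ρ 0 = 1 / (Fintype.card B : ℝ)) (hρ : ∀ i, 0 < ρ i)
    (hn : ∀ i ≤ r, n * ρ i ^ 2 < κ / 2 ^ q) (hd : d ≤ r * q)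
    (hρρ' : ∀ i, ρ i ≤ ρ' i) (hb : ∀ i, ρ i ^ (b + 1) < κ / 2 ^ q * ρ' i ^ (b + 1))
    (hρ₂ : ∀ i, ρ' i ≤ ρ (i + 1) * p ^ b) (hρr1 : ρ r ≤ 1)
    (hU : ∀ I J x, Disjoint J I → tupleEdges I J x ⊆ U)
    (hU1 : (Fintype.card B : ℝ) ^ 2 ≤ U.card) :
    binomProb p U (fun S => SearchTree 𝓕 (CoveredBy (UsesNonEdge S) n) d Finset.univ) ≤
      r * (2 ^ Fintype.card K * (2 ^ (Fintype.card B * Fintype.card K) *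
        ((1 + 2 * 𝓕.card) ^ (r * q) *
          Real.exp (-((κ / 2 ^ q * κ) ^ 2 / (16 * (U.card * ρ r ^ 4))))))) := by
  classical
  have hpb : 0 < p ^ b := pow_pos hp0 b
  have hpb1 : p ^ b ≤ 1 := pow_le_one₀ hp0.le hp1
  have hκ0 : 0 < κ := by rw [hκ]; positivity
  have h8 : (1 : ℝ) ≤ 8 ^ Fintype.card K := one_le_pow₀ (by norm_num)
  have hκ1 : κ ≤ 1 := by
    rw [hκ, div_le_one (by positivity)]
    have : p ^ (b * b) ≤ 1 := pow_le_one₀ hp0.le hp1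
    linarith
  have hmono : Monotone ρ := monotone_nat_of_le_succ fun i => by
    have := hρ₂ i
    have := hρρ' i
    nlinarith [hρ (i + 1)]
  have hN : (0 : ℝ) < Fintype.card B := by exact_mod_cast Fintype.card_pos
  set ex : ℝ := Real.exp (-((κ / 2 ^ q * κ) ^ 2 / (16 * (U.card * ρ r ^ 4)))) with hex
  have hUpos : (0 : ℝ) < U.card := lt_of_lt_of_le (by positivity) hU1
  -- Everything the adversary may meet: a round, a set of finished blocks, a box and a set described
  -- by queries. These range over a set chosen independently of the graph, so a union bound applies.
  let idx : Finset (ℕ × Finset K × (K → Finset B) × Finset (K → B)) :=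
    Finset.range r ×ˢ Finset.univ ×ˢ Finset.univ ×ˢ queryFamily 𝓕 (r * q)
  let bad : (ℕ × Finset K × (K → Finset B) × Finset (K → B)) → Finset (Sym2 (K × B)) → ℝ :=
    fun a S => if Cap a.2.1 (ρ a.1) (κ / 2 ^ q) (a.2.2.2 ∩ Fintype.piFinset a.2.2.1) →
      Restores S a.2.1 (ρ (a.1 + 1)) κ (a.2.2.2 ∩ Fintype.piFinset a.2.2.1) then 0 else 1
  have hbad0 : ∀ a S, 0 ≤ bad a S := fun a S => by
    dsimp only [bad]; split_ifs <;> norm_num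
  have hpoint : ∀ S ⊆ U, (if SearchTree 𝓕 (CoveredBy (UsesNonEdge S) n) d Finset.univ then
      (1 : ℝ) else 0) ≤ ∑ a ∈ idx, bad a S := by
    intro S _
    split_ifs with hS
    · by_contra hlt
      refine not_searchTree_of_restores hρ0 (fun i => (hρ i).le) hκ0 hκ1 hn hd ?_ hS
      intro i hi I W R hR
      by_contra hno
      refine hlt (le_trans ?_ (Finset.single_le_sum (f := fun a => bad a S)
        (fun a _ => hbad0 a S) (a := (i, I, W, R)) ?_))
      · dsimp only [bad]; rw [if_neg hno]
      · simp [idx, hi, hR]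
    · exact Finset.sum_nonneg fun a _ => hbad0 a S
  have hbad : ∀ a ∈ idx, binomExp p U (bad a) ≤ ex := by
    rintro ⟨i, I, W, R⟩ ha
    have hi : i < r := by simp only [idx, Finset.mem_product, Finset.mem_range] at ha; exact ha.1
    by_cases hcap : Cap I (ρ i) (κ / 2 ^ q) (R ∩ Fintype.piFinset W)
    · have hηpos : 0 < κ / 2 ^ q := by positivity
      have hρi : ρ (i + 1) ≤ ρ r := hmono hi
      have hρi0 : 1 / (Fintype.card B : ℝ) ≤ ρ (i + 1) := hρ0 ▸ hmono (Nat.zero_le _)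
      have h1 := binomExp_not_restore_le (U := U) hp0 hp1 hηpos hcap (hρ i) (hρρ' i) (hb i) (hρ₂ i)
        (hρi.trans hρr1) (fun J x => hU I J x) (by
          have h2 : 1 ≤ (Fintype.card B : ℝ) * ρ (i + 1) := by
            rwa [div_le_iff₀' hN] at hρi0
          calc (1 : ℝ) ≤ ((Fintype.card B : ℝ) * ρ (i + 1)) ^ 2 := one_le_pow₀ h2
            _ = (Fintype.card B : ℝ) ^ 2 * ρ (i + 1) ^ 2 := mul_pow _ _ _
            _ ≤ _ := by gcongr)
      rw [← hκ] at h1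
      refine le_trans (le_of_eq ?_) (h1.trans ?_)
      · refine binomExp_congr fun S _ => ?_
        simp only [bad, hcap, true_imp_iff, Restores]
      · rw [hex, Real.exp_le_exp, neg_le_neg_iff]
        have hρ1 := hρ (i + 1)
        have hκκ : κ ≤ p ^ (b * b) / (4 * 8 ^ Fintype.card K) := by
          rw [hκ]; gcongr; norm_num
        gcongr
    · have : ∀ S ⊆ U, bad (i, I, W, R) S = 0 := fun S _ => by
        simp only [bad, hcap, false_imp_iff, if_true]
      rw [binomExp_congr this, binomExp_const]
      exact (Real.exp_pos _).le
  have hcard : (idx.card : ℝ) ≤ r * (2 ^ Fintype.card K * (2 ^ (Fintype.card B * Fintype.card K) *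
      (1 + 2 * 𝓕.card) ^ (r * q))) := by
    have h1 := card_queryFamily_le 𝓕 (r * q)
    have h2 : idx.card ≤ r * (2 ^ Fintype.card K * (2 ^ (Fintype.card B * Fintype.card K) *
        (1 + 2 * 𝓕.card) ^ (r * q))) := by
      simp only [idx, Finset.card_product, Finset.card_range, Finset.card_univ,
        Fintype.card_finset, Fintype.card_fun]
      rw [← pow_mul]
      gcongr
    exact_mod_cast h2
  calc _ ≤ binomExp p U (fun S => ∑ a ∈ idx, bad a S) := binomExp_mono hp0.le hp1 hpoint
    _ = ∑ a ∈ idx, binomExp p U (bad a) := binomExp_sum _ _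
    _ ≤ ∑ a ∈ idx, ex := Finset.sum_le_sum hbad
    _ = idx.card * ex := by rw [Finset.sum_const, nsmul_eq_mul]
    _ ≤ (r * (2 ^ Fintype.card K * (2 ^ (Fintype.card B * Fintype.card K) *
      (1 + 2 * 𝓕.card) ^ (r * q)))) * ex := mul_le_mul_of_nonneg_right hcard (Real.exp_pos _).le
    _ = _ := by ring

end Adversary

/-! ### Graphs, clique formulas and the transfer to random formulas. -/

open Classical in
/-- The potential edges of a `k`-partite graph. -/
noncomputable def crossEdges (k c m : ℕ) : Finset (Sym2 (BlockVertex k c m)) :=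
  ((⊤ : SimpleGraph (Fin k)).comap (Prod.fst : BlockVertex k c m → Fin k)).edgeFinset

section Graphs

variable {k c m : ℕ}

lemma mk_mem_crossEdges {u v : BlockVertex k c m} : s(u, v) ∈ crossEdges k c m ↔ u.1 ≠ v.1 := by
  simp [crossEdges]

lemma card_crossEdges : (crossEdges k c m).card = k.choose 2 * (m ^ c) ^ 2 := by
  classical
  have iso : (⊤ : SimpleGraph (Fin k)).comap (Prod.fst : BlockVertex k c m → Fin k) ≃g
      SimpleGraph.completeEquipartiteGraph k (m ^ c) :=
    { toEquiv := (Equiv.refl _).prodCongr (Fintype.equivFinOfCardEq (by simp))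
      map_rel_iff' := by
        intro a b
        simp }
  rw [crossEdges, ← SimpleGraph.card_edgeFinset_completeEquipartiteGraph]
  convert iso.card_edgeFinset_eq

lemma tupleEdges_subset_crossEdges (I J : Finset (Fin k)) (x : Fin k → Fin c → Fin m) :
    tupleEdges I J x ⊆ crossEdges k c m := by
  intro e he
  simp only [tupleEdges, Finset.mem_image, Finset.mem_filter, Prod.exists] at he
  obtain ⟨i, j, ⟨-, hij⟩, rfl⟩ := he
  exact mk_mem_crossEdges.2 hij

lemma card_tupleEdges_univ (x : Fin k → Fin c → Fin m) :
    (tupleEdges ∅ Finset.univ x).card = k.choose 2 := by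
  classical
  have h : tupleEdges ∅ Finset.univ x =
      (⊤ : SimpleGraph (Fin k)).edgeFinset.image (Sym2.map fun i => (i, x i)) := by
    ext e
    simp only [tupleEdges, Finset.mem_image, Finset.mem_filter, Prod.exists, Finset.mem_product,
      Finset.mem_univ, Finset.compl_empty, true_and]
    constructor
    · rintro ⟨i, j, hij, rfl⟩
      exact ⟨s(i, j), by simpa using hij, rfl⟩
    · rintro ⟨e', he', rfl⟩
      induction e' using Sym2.ind with
      | _ i j => exact ⟨i, j, by simpa using he', rfl⟩
  rw [h, Finset.card_image_of_injective _ (Sym2.map.injective fun i j hij =>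
    (Prod.mk.inj hij).1), SimpleGraph.card_edgeFinset_top_eq_card_choose_two, Fintype.card_fin]

/-- The formula of the graph with the edges `S`. -/
noncomputable def edgeFormula {V : Type} [DecidableEq V] (x : CliqueVar k c m ↪ V)
    (S : Finset (Sym2 (BlockVertex k c m))) : CNF V :=
  cliqueFormula x (SimpleGraph.fromEdgeSet (S : Set (Sym2 (BlockVertex k c m))))

variable {V : Type} [DecidableEq V] (x : CliqueVar k c m ↪ V)

lemma mem_nodeClause {u : BlockVertex k c m} {l : V × Bool} :
    l ∈ nodeClause x u ↔ ∃ j, l = (x (u.1, j, u.2 j), false) := by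
  simp [nodeClause, eq_comm]

lemma mem_edgeFormula {S : Finset (Sym2 (BlockVertex k c m))} {C : Clause V} :
    C ∈ edgeFormula x S ↔
      (∃ u v, u ≠ v ∧ s(u, v) ∉ S ∧ nodeClause x u ∪ nodeClause x v = C) ∨
        ∃ i j, rangeClause x i j = C := by
  simp only [edgeFormula, cliqueFormula, Finset.mem_union, Finset.mem_image, Finset.mem_filter,
    Finset.mem_univ, true_and, SimpleGraph.fromEdgeSet_adj, Finset.mem_coe]
  refine or_congr ?_ (by simp)
  constructor
  · rintro ⟨e, ⟨h1, h2⟩, h3⟩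
    exact ⟨e.1, e.2, h1, fun h => h2 ⟨h, h1⟩, h3⟩
  · rintro ⟨u, v, h1, h2, h3⟩
    exact ⟨(u, v), ⟨h1, fun h => h2 h.1⟩, h3⟩

/-- The literals at coordinate 0 reveal which block belongs to which vertex. As u and v lie in
different blocks, the remaining coordinates cannot be mixed between them. -/
lemma eq_of_nodeClause_union_eq (hc : 0 < c) {u v u' v' : BlockVertex k c m} (huv : u.1 ≠ v.1)
    (h : nodeClause x u ∪ nodeClause x v = nodeClause x u' ∪ nodeClause x v') :
    s(u, v) = s(u', v') := by
  have key : ∀ w : BlockVertex k c m, nodeClause x w ⊆ nodeClause x u' ∪ nodeClause x v' →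
      ∀ j, (w.1 = u'.1 ∧ w.2 j = u'.2 j) ∨ (w.1 = v'.1 ∧ w.2 j = v'.2 j) := by
    intro w hw j
    have := hw ((mem_nodeClause x).2 ⟨j, rfl⟩)
    rw [Finset.mem_union, mem_nodeClause, mem_nodeClause] at this
    rcases this with ⟨j', h⟩ | ⟨j', h⟩
    · simp only [Prod.mk.injEq, and_true, x.injective.eq_iff] at h
      obtain ⟨h1, rfl, h2⟩ := h
      exact .inl ⟨h1, h2⟩
    · simp only [Prod.mk.injEq, and_true, x.injective.eq_iff] at h
      obtain ⟨h1, rfl, h2⟩ := h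
      exact .inr ⟨h1, h2⟩
  have hu := key u (h ▸ Finset.subset_union_left)
  have hv := key v (h ▸ Finset.subset_union_right)
  rw [Sym2.eq_iff]
  rcases hu ⟨0, hc⟩ with hu0 | hu0 <;> rcases hv ⟨0, hc⟩ with hv0 | hv0
  · exact absurd (hu0.1.trans hv0.1.symm) huv
  · refine .inl ⟨Prod.ext hu0.1 (funext fun j => ?_), Prod.ext hv0.1 (funext fun j => ?_)⟩
    · exact ((hu j).resolve_right fun h => huv (h.1.trans hv0.1.symm)).2
    · exact ((hv j).resolve_left fun h => huv (hu0.1.trans h.1.symm)).2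
  · refine .inr ⟨Prod.ext hu0.1 (funext fun j => ?_), Prod.ext hv0.1 (funext fun j => ?_)⟩
    · exact ((hu j).resolve_left fun h => huv (h.1.trans hv0.1.symm)).2
    · exact ((hv j).resolve_right fun h => huv (hu0.1.trans h.1.symm)).2
  · exact absurd (hu0.1.trans hv0.1.symm) huv

lemma mem_iff_nodeClause_union_notMem (hc : 0 < c) (hm : 0 < m)
    {S : Finset (Sym2 (BlockVertex k c m))} {u v : BlockVertex k c m} (huv : u.1 ≠ v.1) :
    s(u, v) ∈ S ↔ nodeClause x u ∪ nodeClause x v ∉ edgeFormula x S := by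
  rw [mem_edgeFormula]
  constructor
  · rintro hS (⟨u', v', -, h2, h3⟩ | ⟨i, j, h⟩)
    · exact h2 (eq_of_nodeClause_union_eq x hc huv h3.symm ▸ hS)
    · have : (x (i, j, ⟨0, hm⟩), true) ∈ rangeClause x i j := by simp [rangeClause]
      rw [h, Finset.mem_union, mem_nodeClause, mem_nodeClause] at this
      simp at this
  · intro h
    by_contra hS
    exact h (.inl ⟨u, v, fun h => huv (h ▸ rfl), hS, rfl⟩)

/-- Consequently a uniformly random formula of the family is the formula of a uniformly random
graph. -/
lemma edgeFormula_injOn (hc : 0 < c) (hm : 0 < m) :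
    Set.InjOn (edgeFormula x) {S | S ⊆ crossEdges k c m} := by
  have key : ∀ S S' : Finset (Sym2 (BlockVertex k c m)), S ⊆ crossEdges k c m →
      edgeFormula x S = edgeFormula x S' → S ⊆ S' := by
    intro S S' hS h e he
    induction e using Sym2.ind with
    | _ u v =>
      have huv := mk_mem_crossEdges.1 (hS he)
      rw [mem_iff_nodeClause_union_notMem x hc hm huv] at he ⊢
      rwa [← h]
  exact fun S hS S' hS' h => (key S S' hS h).antisymm (key S' S hS' h.symm)

lemma cliqueFamily_eq (M : ℕ) :
    cliqueFamily x M = edgeFormula x '' ((crossEdges k c m).powersetCard M :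
      Set (Finset (Sym2 (BlockVertex k c m)))) := by
  classical
  ext A
  simp only [cliqueFamily, Set.mem_ofPred_eq, Set.mem_image, Finset.mem_coe,
    Finset.mem_powersetCard]
  constructor
  · rintro ⟨G, hG, hM, rfl⟩
    refine ⟨G.edgeFinset, ⟨fun e he => ?_, ?_⟩, ?_⟩
    · induction e using Sym2.ind with
      | _ u v => exact mk_mem_crossEdges.2 (hG u v (by simpa using he))
    · rw [← hM, ← SimpleGraph.coe_edgeFinset, Set.ncard_coe_finset]
    · rw [edgeFormula, SimpleGraph.coe_edgeFinset, SimpleGraph.fromEdgeSet_edgeSet]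
  · rintro ⟨S, ⟨hS, hM⟩, rfl⟩
    refine ⟨SimpleGraph.fromEdgeSet S, fun u v h => mk_mem_crossEdges.1 (hS ?_), ?_, rfl⟩
    · simpa using ((SimpleGraph.fromEdgeSet_adj _).1 h).1
    · rw [SimpleGraph.edgeSet_fromEdgeSet, ← hM, ← Set.ncard_coe_finset]
      congr 1
      refine sdiff_eq_left.2 (Set.disjoint_left.2 fun e he hd => ?_)
      have := hS he
      induction e using Sym2.ind with
      | _ u v =>
        rw [mk_mem_crossEdges] at this
        have huv : u = v := by simpa using hd
        exact this (huv ▸ rfl)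

lemma uniformProb_le_one {α : Type} {S : Set α} (hS : S.Finite) (P : α → Prop) :
    uniformProb S P ≤ 1 :=
  div_le_one_of_le₀ (by exact_mod_cast Set.ncard_le_ncard (Set.sep_subset S P) hS)
    (Nat.cast_nonneg _)

lemma cliqueFamily_finite (M : ℕ) : (cliqueFamily x M).Finite := by
  rw [cliqueFamily_eq]; exact (Finset.finite_toSet _).image _

/-- Properties of a random clique formula can be checked in the binomial model. -/
lemma one_sub_le_uniformProb_cliqueFamily (hc : 0 < c) (hm : 0 < m) {M : ℕ}
    (hM : M ≤ (crossEdges k c m).card) (hU : 0 < (crossEdges k c m).card) {P : CNF V → Prop}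
    {bad : Finset (Sym2 (BlockVertex k c m)) → Prop}
    (hbad : ∀ S ⊆ crossEdges k c m, S.card = M → ¬ P (edgeFormula x S) → bad S) :
    1 - ((crossEdges k c m).card + 1 : ℕ) * binomProb ((M : ℝ) / (crossEdges k c m).card)
      (crossEdges k c m) bad ≤ uniformProb (cliqueFamily x M) P := by
  classical
  set U := crossEdges k c m with hU_def
  have hinj : Set.InjOn (edgeFormula x) (U.powersetCard M : Set (Finset (Sym2 _))) := fun S hS S' hS' h =>
    edgeFormula_injOn x hc hm (Finset.mem_powersetCard.1 hS).1 (Finset.mem_powersetCard.1 hS').1 h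
  have htot : (cliqueFamily x M).ncard = U.card.choose M := by
    rw [cliqueFamily_eq, hinj.ncard_image, Set.ncard_coe_finset,
      Finset.card_powersetCard]
  have hpos : 0 < U.card.choose M := Nat.choose_pos hM
  have hgood : {A ∈ cliqueFamily x M | P A} =
      edgeFormula x '' ((U.powersetCard M).filter fun S => P (edgeFormula x S) :
        Finset (Finset (Sym2 (BlockVertex k c m)))) := by
    ext A
    rw [cliqueFamily_eq]
    simp only [Set.mem_ofPred_eq, Set.mem_image, Finset.mem_coe, Finset.mem_filter]
    constructor
    · rintro ⟨⟨S, hS, rfl⟩, h⟩; exact ⟨S, ⟨hS, h⟩, rfl⟩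
    · rintro ⟨S, ⟨hS, h⟩, rfl⟩; exact ⟨⟨S, hS, rfl⟩, h⟩
  have hgoodcard : {A ∈ cliqueFamily x M | P A}.ncard =
      ((U.powersetCard M).filter fun S => P (edgeFormula x S)).card := by
    rw [hgood, Set.InjOn.ncard_image, Set.ncard_coe_finset]
    exact hinj.mono fun S hS => (Finset.mem_filter.1 hS).1
  have hsplit := Finset.card_filter_add_card_filter_not (s := U.powersetCard M)
    (fun S => P (edgeFormula x S))
  rw [Finset.card_powersetCard] at hsplit
  have hle : ((U.powersetCard M).filter fun S => ¬ P (edgeFormula x S)).card ≤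
      ((U.powersetCard M).filter bad).card :=
    Finset.card_le_card fun S hS => by
      rw [Finset.mem_filter] at hS ⊢
      have := Finset.mem_powersetCard.1 hS.1
      exact ⟨hS.1, hbad S this.1 this.2 hS.2⟩
  have hmain := card_powersetCard_filter_le hM hU bad
  have hposR : (0 : ℝ) < U.card.choose M := by exact_mod_cast hpos
  rw [uniformProb, htot, hgoodcard, le_div_iff₀ hposR, sub_mul, one_mul]
  have h1 : (((U.powersetCard M).filter fun S => P (edgeFormula x S)).card : ℝ) +
      ((U.powersetCard M).filter fun S => ¬ P (edgeFormula x S)).card = U.card.choose M := by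
    exact_mod_cast hsplit
  have h2 : (((U.powersetCard M).filter fun S => ¬ P (edgeFormula x S)).card : ℝ) ≤
      ((U.powersetCard M).filter bad).card := by exact_mod_cast hle
  linarith

/-- The range axioms supply a true variable for every coordinate, hence a vertex in each block. The
edge axioms forbid a non-edge among these vertices. -/
lemma exists_clique_of_satisfiable {S : Finset (Sym2 (BlockVertex k c m))}
    (h : CNF.Satisfiable (edgeFormula x S)) : ∃ z, tupleEdges ∅ Finset.univ z ⊆ S := by
  obtain ⟨α, hα⟩ := h
  have hrange : ∀ i j, ∃ a, α (x (i, j, a)) = true := by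
    intro i j
    obtain ⟨l, hl, hl'⟩ := hα _ ((mem_edgeFormula x).2 (.inr ⟨i, j, rfl⟩))
    simp only [rangeClause, Finset.mem_image, Finset.mem_univ, true_and] at hl
    obtain ⟨a, rfl⟩ := hl
    exact ⟨a, hl'⟩
  choose z hz using hrange
  refine ⟨z, fun e he => ?_⟩
  simp only [tupleEdges, Finset.mem_image, Finset.mem_filter, Prod.exists] at he
  obtain ⟨i, j, ⟨-, hij⟩, rfl⟩ := he
  by_contra hS
  obtain ⟨l, hl, hl'⟩ := hα _ ((mem_edgeFormula x).2
    (.inl ⟨(i, z i), (j, z j), fun h => hij (Prod.mk.inj h).1, hS, rfl⟩))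
  rw [Finset.mem_union, mem_nodeClause, mem_nodeClause] at hl
  rcases hl with ⟨q, rfl⟩ | ⟨q, rfl⟩
  · simp [hz] at hl'
  · simp [hz] at hl'

/-- First moment bound over the N ^ k transversal tuples. -/
lemma binomProb_clique_le {p : ℝ} (hp0 : 0 ≤ p) (hp1 : p ≤ 1) :
    binomProb p (crossEdges k c m)
      (fun S => ∃ z : Fin k → Fin c → Fin m, tupleEdges ∅ Finset.univ z ⊆ S) ≤
        ((m ^ c : ℕ) : ℝ) ^ k * p ^ k.choose 2 := by
  classical
  calc _ ≤ binomExp p (crossEdges k c m) (fun S => ∑ z : Fin k → Fin c → Fin m,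
        if tupleEdges ∅ Finset.univ z ⊆ S then (1 : ℝ) else 0) := by
        refine binomExp_mono hp0 hp1 fun S _ => ?_
        have h0 : ∀ z : Fin k → Fin c → Fin m, z ∈ Finset.univ →
            (0 : ℝ) ≤ if tupleEdges ∅ Finset.univ z ⊆ S then (1 : ℝ) else 0 := fun z _ => by
          split_ifs <;> norm_num
        split_ifs with h
        · obtain ⟨z, hz⟩ := h
          refine le_trans ?_ (Finset.single_le_sum h0 (Finset.mem_univ z))
          rw [if_pos hz]
        · exact Finset.sum_nonneg h0
    _ = ∑ z : Fin k → Fin c → Fin m, p ^ k.choose 2 := by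
        rw [binomExp_sum]
        refine Finset.sum_congr rfl fun z _ => ?_
        rw [← card_tupleEdges_univ z]
        exact binomExp_subset (tupleEdges_subset_crossEdges _ _ _)
    _ = _ := by
        rw [Finset.sum_const, nsmul_eq_mul, Finset.card_univ]
        simp

/-- The number of literals of a clique formula. -/
lemma size_edgeFormula_le (S : Finset (Sym2 (BlockVertex k c m))) :
    CNF.size (edgeFormula x S) ≤ (k * m ^ c) ^ 2 * (2 * c) + k * c * m := by
  classical
  have himage : ∀ {α : Type} (s : Finset α) (f : α → Clause V) (b : ℕ), (∀ a, (f a).card ≤ b) →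
      ∑ C ∈ s.image f, C.card ≤ s.card * b := by
    intro α s f b hb
    calc _ ≤ ∑ C ∈ s.image f, b := Finset.sum_le_sum fun C hC => by
          obtain ⟨a, -, rfl⟩ := Finset.mem_image.1 hC
          exact hb a
      _ = (s.image f).card * b := by simp
      _ ≤ _ := Nat.mul_le_mul_right _ Finset.card_image_le
  rw [CNF.size, edgeFormula, cliqueFormula]
  refine (Finset.sum_union_inter (s₁ := _) (s₂ := _) (f := fun C : Clause V => C.card) ▸
    Nat.le_add_right _ _ : _ ≤ _ + _).trans (Nat.add_le_add ?_ ?_)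
  · refine (himage _ _ (2 * c) fun e => ?_).trans (Nat.mul_le_mul_right _ ?_)
    · refine (Finset.card_union_le _ _).trans ?_
      have : ∀ u : BlockVertex k c m, (nodeClause x u).card ≤ c := fun u =>
        Finset.card_image_le.trans (by simp)
      rw [two_mul]
      exact Nat.add_le_add (this _) (this _)
    · refine (Finset.card_le_univ _).trans ?_
      simp [sq]
  · refine (himage _ _ m fun e => Finset.card_image_le.trans (by simp)).trans ?_
    simp

end Graphs

/-- The assignment which chooses the vertices of the tuple `z`. -/
noncomputable def tupleAssignment {k c m n : ℕ} (x : CliqueVar k c m ↪ Fin n)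
    (z : Fin k → Fin c → Fin m) : Assignment (Fin n) :=
  fun v => open Classical in decide (∃ i j, x (i, j, z i j) = v)

lemma tupleAssignment_apply {k c m n : ℕ} (x : CliqueVar k c m ↪ Fin n)
    (z : Fin k → Fin c → Fin m) (i : Fin k) (j : Fin c) (a : Fin m) :
    tupleAssignment x z (x (i, j, a)) = true ↔ z i j = a := by
  simp only [tupleAssignment, decide_eq_true_eq, x.injective.eq_iff, Prod.mk.injEq]
  constructor
  · rintro ⟨i, j, rfl, rfl, h⟩; exact h
  · intro h; exact ⟨i, j, rfl, rfl, h⟩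

/-- A short tree-like refutation of a clique formula gives a shallow search tree for a
non-edge. -/
lemma searchTree_of_not_requiresLength {k c m n : ℕ} (x : CliqueVar k c m ↪ Fin n)
    {S : Finset (Sym2 (BlockVertex k c m))} {F : Finset (BoolFn n)} {L d : ℕ}
    (h : ¬ RequiresLength F (edgeFormula x S) L) (hL : (L : ℝ) ≤ 12 * (4 / 3 : ℝ) ^ d) :
    SearchTree (F.image fun g => ({z | g (tupleAssignment x z) = true} :
      Finset (Fin k → Fin c → Fin m))) (CoveredBy (UsesNonEdge S) 12) d Finset.univ := by
  simp only [RequiresLength, not_forall, not_le] at h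
  obtain ⟨t, f, hf, ht⟩ := h
  have hP : ∀ C ∈ edgeFormula x S, UsesNonEdge S
      ({z | ¬ ∃ l ∈ C, tupleAssignment x z l.1 = l.2} : Finset (Fin k → Fin c → Fin m)) := by
    intro C hC
    rcases (mem_edgeFormula x).1 hC with ⟨u, v, huv, hS, rfl⟩ | ⟨i, j, rfl⟩
    -- Falsifying the edge axiom makes every coordinate of both vertices agree with z.
    · refine .inr ⟨u, v, huv, hS, fun z hz => ?_⟩
      simp only [Finset.mem_filter, Finset.mem_univ, true_and] at hz
      have key : ∀ w : BlockVertex k c m,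
          nodeClause x w ⊆ nodeClause x u ∪ nodeClause x v → z w.1 = w.2 := by
        intro w hw
        funext j
        by_contra hne
        refine hz ⟨_, hw ((mem_nodeClause x).2 ⟨j, rfl⟩), ?_⟩
        rw [← Bool.not_eq_true, tupleAssignment_apply]
        exact hne
      exact ⟨key u Finset.subset_union_left, key v Finset.subset_union_right⟩
    -- A range axiom is satisfied by every assignment that comes from a tuple.
    · refine .inl (Finset.filter_eq_empty_iff.2 fun z _ => not_not.2 ?_)
      exact ⟨(x (i, j, z i j), true), by simp [rangeClause], by
        rw [tupleAssignment_apply]⟩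
  obtain ⟨a, ha, hd⟩ := exists_deriv_of_isTreeLikeRefutation hf (tupleAssignment x) _ hP
  have haL : (a : ℝ) ≤ L := by exact_mod_cast ha.trans ht.le
  simpa using hd.searchTree UsesNonEdge.mono (.inl rfl) d (haL.trans hL)

/-! ### Parameter estimates, unsatisfiability and size. -/

section Parameters

variable {ε : ℝ} {c : ℕ}

lemma densityParam_two_pow (ε : ℝ) (c : ℕ) : densityParam ε (2 ^ c) = ⌊(c : ℝ) ^ ε⌋₊ := by
  have : Real.logb 2 ((2 ^ c : ℕ) : ℝ) = c := by
    push_cast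
    rw [Real.logb_pow, Real.logb_self_eq_one (by norm_num), mul_one]
  rw [densityParam, this]

lemma tendsto_densityParam (hε : 0 < ε) :
    Tendsto (fun c : ℕ => (densityParam ε (2 ^ c) : ℝ)) atTop atTop := by
  simp only [densityParam_two_pow]
  exact tendsto_natCast_atTop_atTop.comp (tendsto_nat_floor_atTop.comp
    ((tendsto_rpow_atTop hε).comp tendsto_natCast_atTop_atTop))

lemma densityParam_le_rpow (ε : ℝ) (c : ℕ) : (densityParam ε (2 ^ c) : ℝ) ≤ (c : ℝ) ^ ε := by
  rw [densityParam_two_pow]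
  exact Nat.floor_le (by positivity)

lemma densityParam_le (hε1 : ε < 1) (hc : 1 ≤ c) : (densityParam ε (2 ^ c) : ℝ) ≤ c := by
  refine (densityParam_le_rpow ε c).trans ?_
  conv_rhs => rw [← Real.rpow_one (c : ℝ)]
  exact Real.rpow_le_rpow_of_exponent_le (by exact_mod_cast hc) hε1.le

/-- D ≤ c ^ ε is o(c). This is what makes 8 ^ k an arbitrarily small power of N. -/
lemma eventually_densityParam_le (hε1 : ε < 1) {a : ℝ} (ha : 0 < a) :
    ∀ᶠ c : ℕ in atTop, (densityParam ε (2 ^ c) : ℝ) ≤ a * c := by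
  have h := (tendsto_rpow_atTop (sub_pos.2 hε1)).comp (tendsto_natCast_atTop_atTop (R := ℝ))
  filter_upwards [h.eventually_ge_atTop a⁻¹, eventually_ge_atTop 1] with c hc hc1
  have hc0 : (0 : ℝ) < c := by exact_mod_cast hc1
  refine (densityParam_le_rpow ε c).trans ?_
  simp only [Function.comp_apply] at hc
  have h1 : (c : ℝ) ^ ε * (c : ℝ) ^ (1 - ε) = c := by
    rw [← Real.rpow_add hc0]; simp
  have h2 : 1 ≤ a * (c : ℝ) ^ (1 - ε) := by
    rwa [inv_le_iff_one_le_mul₀' ha] at hc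
  calc (c : ℝ) ^ ε = (c : ℝ) ^ ε * 1 := (mul_one _).symm
    _ ≤ (c : ℝ) ^ ε * (a * (c : ℝ) ^ (1 - ε)) := by gcongr
    _ = a * c := by rw [mul_left_comm, h1]

lemma eventually_mul_pow_le_rpow (A : ℝ) (j : ℕ) {a : ℝ} (ha : 0 < a) :
    ∀ᶠ c : ℕ in atTop, A * (c : ℝ) ^ j ≤ (2 : ℝ) ^ (a * c) := by
  have h1 : (1 : ℝ) < (2 : ℝ) ^ a := Real.one_lt_rpow (by norm_num) ha
  have h2 := (tendsto_pow_const_div_const_pow_of_one_lt j h1).const_mul A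
  rw [mul_zero] at h2
  filter_upwards [h2.eventually_le_const one_pos] with c hc
  rw [← mul_div_assoc, div_le_one (by positivity)] at hc
  rwa [Real.rpow_mul (by norm_num), Real.rpow_natCast]

lemma card_crossEdges_cliqueParam : ((crossEdges (cliqueParam ε (2 ^ c)) c 2).card : ℝ) =
    (cliqueParam ε (2 ^ c)).choose 2 * ((2 ^ c : ℕ) : ℝ) ^ 2 := by
  rw [card_crossEdges]; push_cast; ring

lemma choose_cliqueParam : (((cliqueParam ε (2 ^ c)).choose 2 : ℕ) : ℝ) =
    densityParam ε (2 ^ c) * (2 * densityParam ε (2 ^ c) - 1) := by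
  rw [cliqueParam, Nat.cast_choose_two]; push_cast; ring

lemma rpow_density : ((2 ^ c : ℕ) : ℝ) ^ (-2 / (densityParam ε (2 ^ c) : ℝ)) =
    (2 : ℝ) ^ (-(2 * c / (densityParam ε (2 ^ c) : ℝ))) := by
  rw [Nat.cast_pow, Nat.cast_ofNat, ← Real.rpow_natCast 2 c, ← Real.rpow_mul (by norm_num)]
  congr 1; ring

/-- The edge density in the uniform model. -/
noncomputable def edgeDensity (ε : ℝ) (c : ℕ) : ℝ :=
  (edgeParam ε (2 ^ c) : ℝ) / (crossEdges (cliqueParam ε (2 ^ c)) c 2).card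

lemma card_crossEdges_ge (hD : 1 ≤ densityParam ε (2 ^ c)) :
    ((2 : ℝ) ^ c) ^ 2 ≤ (crossEdges (cliqueParam ε (2 ^ c)) c 2).card := by
  have hD' : (1 : ℝ) ≤ densityParam ε (2 ^ c) := by exact_mod_cast hD
  rw [card_crossEdges_cliqueParam, choose_cliqueParam]
  push_cast
  have : (1 : ℝ) ≤ densityParam ε (2 ^ c) * (2 * densityParam ε (2 ^ c) - 1) := by nlinarith
  exact le_mul_of_one_le_left (by positivity) this

lemma card_crossEdges_le (hDc : (densityParam ε (2 ^ c) : ℝ) ≤ c) :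
    ((crossEdges (cliqueParam ε (2 ^ c)) c 2).card : ℝ) ≤ 2 * c ^ 2 * (2 ^ c) ^ 2 := by
  rw [card_crossEdges_cliqueParam, choose_cliqueParam]
  push_cast
  have h0 : (0 : ℝ) ≤ densityParam ε (2 ^ c) := Nat.cast_nonneg _
  refine mul_le_mul_of_nonneg_right ?_ (by positivity)
  nlinarith

/-- Rounding the number of edges up raises the density by at most one edge's share, 1 / |U|. -/
lemma edgeParam_bounds (hD : 1 ≤ densityParam ε (2 ^ c)) :
    0 < (crossEdges (cliqueParam ε (2 ^ c)) c 2).card ∧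
    edgeParam ε (2 ^ c) ≤ (crossEdges (cliqueParam ε (2 ^ c)) c 2).card ∧
    (2 : ℝ) ^ (-(2 * c / (densityParam ε (2 ^ c) : ℝ))) ≤ edgeDensity ε c ∧
    edgeDensity ε c ≤ 1 ∧
    edgeDensity ε c ≤ (2 : ℝ) ^ (-(2 * c / (densityParam ε (2 ^ c) : ℝ))) +
      1 / (crossEdges (cliqueParam ε (2 ^ c)) c 2).card := by
  have hge := card_crossEdges_ge hD
  set u := (crossEdges (cliqueParam ε (2 ^ c)) c 2).card with hu
  have hu0 : (0 : ℝ) < u := lt_of_lt_of_le (by positivity) hge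
  set p₀ := (2 : ℝ) ^ (-(2 * c / (densityParam ε (2 ^ c) : ℝ))) with hp₀
  have hp₀0 : 0 < p₀ := by positivity
  have hp₀1 : p₀ ≤ 1 := Real.rpow_le_one_of_one_le_of_nonpos (by norm_num)
    (neg_nonpos.2 (by positivity))
  have hM : edgeParam ε (2 ^ c) = ⌈p₀ * u⌉₊ := by
    rw [edgeParam, rpow_density, ← card_crossEdges_cliqueParam]
  have h1 : p₀ * u ≤ edgeParam ε (2 ^ c) := hM ▸ Nat.le_ceil _
  have h2 : (edgeParam ε (2 ^ c) : ℝ) ≤ p₀ * u + 1 := hM ▸ (Nat.ceil_lt_add_one (by positivity)).le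
  have h3 : edgeParam ε (2 ^ c) ≤ u := by
    rw [hM]
    exact Nat.ceil_le.2 (mul_le_of_le_one_left hu0.le hp₀1)
  refine ⟨by exact_mod_cast hu0, h3, ?_, ?_, ?_⟩
  · rw [edgeDensity, le_div_iff₀ hu0]; exact h1
  · rw [edgeDensity, div_le_one hu0]; exact_mod_cast h3
  · rw [edgeDensity, div_le_iff₀ hu0, add_mul, one_div_mul_cancel hu0.ne']; exact h2

/-- A random clique formula is unsatisfiable. -/
lemma eventually_unsat (hε : 0 < ε) (hε1 : ε < 1) :
    ∀ᶠ c : ℕ in atTop, ∀ (n : ℕ) (x : CliqueVar (cliqueParam ε (2 ^ c)) c 2 ↪ Fin n),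
      1 - 9 * (c : ℝ) ^ 2 / 2 ^ c ≤ uniformProb (cliqueFamily x (edgeParam ε (2 ^ c)))
        fun A => ¬ CNF.Satisfiable A := by
  filter_upwards [(tendsto_densityParam hε).eventually_ge_atTop 3, eventually_ge_atTop 1]
    with c hD3 hc n x
  have hD1 : 1 ≤ densityParam ε (2 ^ c) := by
    have : (1 : ℝ) ≤ densityParam ε (2 ^ c) := by linarith
    exact_mod_cast this
  obtain ⟨hu0, hMu, hp₀p, hp1, hpp₀⟩ := edgeParam_bounds hD1
  have hprob := one_sub_le_uniformProb_cliqueFamily x (Nat.lt_of_lt_of_le Nat.zero_lt_one hc)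
    two_pos hMu hu0
    (P := fun A => ¬ CNF.Satisfiable A)
    (bad := fun S => ∃ z, tupleEdges ∅ Finset.univ z ⊆ S)
    (fun S _ _ h => exists_clique_of_satisfiable x (not_not.1 h))
  refine le_trans ?_ hprob
  have hge := card_crossEdges_ge hD1
  have hle := card_crossEdges_le (densityParam_le hε1 hc)
  have hcardeq := card_crossEdges_cliqueParam (ε := ε) (c := c)
  rw [← edgeDensity]
  set u := (crossEdges (cliqueParam ε (2 ^ c)) c 2).card with hu
  set p := edgeDensity ε c with hp
  set D := densityParam ε (2 ^ c) with hD
  set p₀ := (2 : ℝ) ^ (-(2 * c / (D : ℝ))) with hp₀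
  set h := (cliqueParam ε (2 ^ c)).choose 2 with hh
  have hhD : (h : ℝ) = D * (2 * D - 1) := choose_cliqueParam
  have hp₀0 : 0 < p₀ := by positivity
  have hp0 : 0 < p := hp₀0.trans_le hp₀p
  have hu0R : (0 : ℝ) < u := by exact_mod_cast hu0
  have hD0 : (0 : ℝ) < D := by linarith
  have hN1 : (1 : ℝ) ≤ 2 ^ c := one_le_pow₀ (by norm_num)
  have hc1 : (1 : ℝ) ≤ c := by exact_mod_cast hc
  -- the density is not much larger than `p₀`
  have hph : p ^ h ≤ p₀ ^ h * Real.exp 1 := by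
    have h1 : p ≤ p₀ * Real.exp (1 / (p₀ * u)) := by
      refine hpp₀.trans ?_
      have := Real.add_one_le_exp (1 / (p₀ * u))
      calc p₀ + 1 / u = p₀ * (1 / (p₀ * u) + 1) := by field_simp; ring
        _ ≤ _ := by gcongr
    -- Here u = h N² and p₀ N² ≥ 1, so rounding the number of edges costs at most a factor e in p ^
    -- h.
    have h2 : h * (1 / (p₀ * u)) ≤ 1 := by
      have h3 : 1 ≤ p₀ * (2 ^ c) ^ 2 := by
        rw [hp₀, ← pow_mul, ← Real.rpow_natCast 2 (c * 2), ← Real.rpow_add (by norm_num)]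
        refine Real.one_le_rpow (by norm_num) ?_
        push_cast
        have : 2 * (c : ℝ) / D ≤ 2 * c := div_le_self (by positivity) (by linarith)
        linarith
      rw [mul_one_div, div_le_one (by positivity), hcardeq]
      push_cast
      have : (0 : ℝ) ≤ h := Nat.cast_nonneg _
      nlinarith
    calc p ^ h ≤ (p₀ * Real.exp (1 / (p₀ * u))) ^ h := pow_le_pow_left₀ hp0.le h1 _
      _ = p₀ ^ h * Real.exp (h * (1 / (p₀ * u))) := by rw [mul_pow, Real.exp_nat_mul]
      _ ≤ _ := by gcongr
  have hp₀h : ((2 ^ c : ℕ) : ℝ) ^ cliqueParam ε (2 ^ c) * p₀ ^ h = (2 : ℝ) ^ (2 * c - 2 * c * D : ℝ) := by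
    rw [cliqueParam, ← hD, hp₀, ← Real.rpow_natCast _ h, ← Real.rpow_mul (by norm_num), hhD,
      Nat.cast_pow, ← pow_mul, Nat.cast_ofNat, ← Real.rpow_natCast 2 (c * (2 * D)),
      ← Real.rpow_add (by norm_num)]
    congr 1
    push_cast
    field_simp
    ring
  -- D ≥ 3 makes the expected number of cliques at most N ^ (-3). This beats the transfer factor, of
  -- order c² N².
  have hsmall : (2 : ℝ) ^ (2 * c - 2 * c * D : ℝ) ≤ ((2 : ℝ) ^ c)⁻¹ * (((2 : ℝ) ^ c) ^ 2)⁻¹ := by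
    rw [← mul_inv, ← pow_succ', ← pow_mul, ← Real.rpow_natCast 2 (c * (2 + 1)),
      ← Real.rpow_neg (by norm_num)]
    refine Real.rpow_le_rpow_of_exponent_le (by norm_num) ?_
    push_cast
    nlinarith
  have hE := binomProb_clique_le (k := cliqueParam ε (2 ^ c)) (c := c) (m := 2) hp0.le hp1
  have hu1 : ((u + 1 : ℕ) : ℝ) ≤ 3 * c ^ 2 * (2 ^ c) ^ 2 := by
    push_cast
    have : (1 : ℝ) ≤ c ^ 2 * (2 ^ c) ^ 2 := by
      have h1 : (1 : ℝ) ≤ (c : ℝ) ^ 2 := one_le_pow₀ hc1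
      have h2 : (1 : ℝ) ≤ ((2 : ℝ) ^ c) ^ 2 := one_le_pow₀ hN1
      nlinarith
    nlinarith
  have hexp : Real.exp 1 ≤ 3 := by linarith [Real.exp_one_lt_d9]
  refine sub_le_sub_left ?_ 1
  calc ((u + 1 : ℕ) : ℝ) * _ ≤ (3 * c ^ 2 * (2 ^ c) ^ 2) *
        (((2 ^ c : ℕ) : ℝ) ^ cliqueParam ε (2 ^ c) * p ^ h) := by
        exact mul_le_mul hu1 hE (binomProb_nonneg hp0.le hp1 _) (by positivity)
    _ ≤ (3 * c ^ 2 * (2 ^ c) ^ 2) *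
        (((2 ^ c : ℕ) : ℝ) ^ cliqueParam ε (2 ^ c) * (p₀ ^ h * 3)) := by
        gcongr
        exact hph.trans (by gcongr)
    _ = (9 * c ^ 2 * (2 ^ c) ^ 2) * (2 : ℝ) ^ (2 * c - 2 * c * D : ℝ) := by
        rw [← hp₀h]; ring
    _ ≤ (9 * c ^ 2 * (2 ^ c) ^ 2) * (((2 : ℝ) ^ c)⁻¹ * (((2 : ℝ) ^ c) ^ 2)⁻¹) := by gcongr
    _ = 9 * (c : ℝ) ^ 2 / 2 ^ c := by field_simp

/-- The size of a clique formula is close to the square of the size of the blocks. -/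
lemma eventually_size_le (hε1 : ε < 1) {a : ℝ} (ha : 0 < a) :
    ∀ᶠ c : ℕ in atTop, ∀ (n : ℕ) (x : CliqueVar (cliqueParam ε (2 ^ c)) c 2 ↪ Fin n),
      ∀ S, (CNF.size (edgeFormula x S) : ℝ) ≤ (2 : ℝ) ^ ((2 + a) * c) := by
  filter_upwards [eventually_mul_pow_le_rpow 12 3 ha, eventually_ge_atTop 1] with c hc12 hc n x S
  have hc1 : (1 : ℝ) ≤ c := by exact_mod_cast hc
  have hD := densityParam_le hε1 hc
  have hD0 : (0 : ℝ) ≤ densityParam ε (2 ^ c) := Nat.cast_nonneg _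
  have h1 : (CNF.size (edgeFormula x S) : ℝ) ≤
      ((cliqueParam ε (2 ^ c) * 2 ^ c) ^ 2 * (2 * c) + cliqueParam ε (2 ^ c) * c * 2 : ℝ) := by
    exact_mod_cast size_edgeFormula_le x S
  have hk : (cliqueParam ε (2 ^ c) : ℝ) ≤ 2 * c := by
    rw [cliqueParam]; push_cast; linarith
  have hk0 : (0 : ℝ) ≤ cliqueParam ε (2 ^ c) := Nat.cast_nonneg _
  have h4 : (1 : ℝ) ≤ (2 ^ c) ^ 2 := one_le_pow₀ (one_le_pow₀ (by norm_num))
  calc _ ≤ _ := h1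
    _ ≤ ((2 * c) * 2 ^ c) ^ 2 * (2 * c) + (2 * c) * c * 2 := by gcongr
    _ ≤ ((2 * c) * 2 ^ c) ^ 2 * (2 * c) + (4 * c ^ 3) * (2 ^ c) ^ 2 := by
        have : (2 * c : ℝ) * c * 2 ≤ 4 * c ^ 3 := by nlinarith [sq_nonneg (c : ℝ)]
        have h5 : (0 : ℝ) ≤ 4 * c ^ 3 := by positivity
        nlinarith
    _ = 12 * c ^ 3 * (2 ^ c) ^ 2 := by ring
    _ ≤ (2 : ℝ) ^ (a * c) * (2 ^ c) ^ 2 := by gcongr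
    _ = (2 : ℝ) ^ ((2 + a) * c) := by
        rw [← pow_mul, ← Real.rpow_natCast 2 (c * 2), ← Real.rpow_add (by norm_num)]
        congr 1; push_cast; ring

end Parameters

/-! ### Choice of exponents and the length lower bound. -/

section LowerBound

variable {ε : ℝ}

/-- Holds because (4/3)³ > 2: depth 3e accommodates length 2 ^ e. -/
lemma two_pow_three_mul_le (e : ℕ) : (2 : ℝ) ^ e ≤ 12 * (4 / 3 : ℝ) ^ (3 * e) := by
  have h1 : (2 : ℝ) ^ e ≤ (4 / 3 : ℝ) ^ (3 * e) := by
    rw [pow_mul]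
    exact pow_le_pow_left₀ (by norm_num) (by norm_num) e
  have h2 : (0 : ℝ) ≤ (4 / 3 : ℝ) ^ (3 * e) := by positivity
  linarith

/-- The number of the events in the union bound is negligible. -/
lemma union_bound_le {r c k q u f : ℕ} {T X : ℝ} (hc : 1 ≤ c) (hk : k ≤ 2 * c) (hq : q ≤ c)
    (hT : (2 : ℝ) ^ c ≤ T) (hf : (f : ℝ) ≤ Real.exp T) (hu : ((u + 1 : ℕ) : ℝ) ≤ Real.exp (2 ^ c))
    (hX : (6 + 4 * r) * c * T ≤ X) :
    ((u + 1 : ℕ) : ℝ) * (r * (2 ^ k * (2 ^ (2 ^ c * k) * ((1 + 2 * f) ^ (r * q) *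
      Real.exp (-X))))) ≤ Real.exp (-2 ^ c) := by
  have hN1 : (1 : ℝ) ≤ 2 ^ c := one_le_pow₀ (by norm_num)
  have hc1 : (1 : ℝ) ≤ c := by exact_mod_cast hc
  have hT1 : 1 ≤ T := hN1.trans hT
  have h2e : ∀ j : ℕ, (2 : ℝ) ^ j ≤ Real.exp j := fun j => by
    rw [← Real.exp_one_pow]
    exact pow_le_pow_left₀ (by norm_num) (by linarith [Real.exp_one_gt_d9]) j
  have hr : (r : ℝ) ≤ Real.exp r := by linarith [Real.add_one_le_exp (r : ℝ)]
  have hff : (1 + 2 * f : ℝ) ^ (r * q) ≤ Real.exp ((r * q : ℕ) * (T + 2)) := by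
    rw [Real.exp_nat_mul]
    refine pow_le_pow_left₀ (by positivity) ?_ _
    have h1 : 1 ≤ Real.exp T := Real.one_le_exp (by linarith)
    have h3 : (3 : ℝ) ≤ Real.exp 2 := by linarith [Real.add_one_le_exp (2 : ℝ)]
    rw [Real.exp_add]
    nlinarith [Real.exp_pos T]
  calc _ ≤ Real.exp (2 ^ c) * (Real.exp r * (Real.exp k * (Real.exp ((2 ^ c * k : ℕ)) *
        (Real.exp ((r * q : ℕ) * (T + 2)) * Real.exp (-X))))) := by
        gcongr
        · exact h2e k
        · exact h2e _
    _ = Real.exp (2 ^ c + (r + (k + ((2 ^ c * k : ℕ) + ((r * q : ℕ) * (T + 2) + -X))))) := by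
        simp only [Real.exp_add]
    _ ≤ _ := by
        -- In units of c T the positive terms cost 1, r, 2, 2 and 3 r. One more unit yields the
        -- final 2 ^ c, hence 6 + 4 r.
        rw [Real.exp_le_exp]
        push_cast
        have hk' : (k : ℝ) ≤ 2 * c := by exact_mod_cast hk
        have hq' : (q : ℝ) ≤ c := by exact_mod_cast hq
        have hr0 : (0 : ℝ) ≤ r := Nat.cast_nonneg _
        have hcT : T ≤ c * T := le_mul_of_one_le_left (by linarith) hc1
        have hcT' : (c : ℝ) ≤ c * T := le_mul_of_one_le_right (by linarith) hT1
        have a1 : (2 : ℝ) ^ c ≤ c * T := hT.trans hcT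
        have a2 : (r : ℝ) ≤ r * (c * T) := le_mul_of_one_le_right hr0 (hT1.trans hcT)
        have a3 : (k : ℝ) ≤ 2 * (c * T) := by linarith
        have a4 : (2 : ℝ) ^ c * k ≤ 2 * (c * T) := by
          calc (2 : ℝ) ^ c * k ≤ T * (2 * c) :=
                mul_le_mul hT hk' (Nat.cast_nonneg _) (by linarith)
            _ = _ := by ring
        have a5 : (r : ℝ) * q * (T + 2) ≤ 3 * (r * (c * T)) := by
          calc (r : ℝ) * q * (T + 2) ≤ r * c * (3 * T) := by
                gcongr; linarith
            _ = _ := by ring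
        linarith

set_option maxHeartbeats 1000000 in
/-- Numerical form of the bound on shallow search trees at edge density `2 ^ (-2 c / D)`. -/
lemma binomProb_searchTree_le_exp {g δ₁ δ₂ p : ℝ} {r b c k D K : ℕ}
    {U : Finset (Sym2 (Fin k × (Fin c → Fin 2)))} {𝓕 : Finset (Finset (Fin k → Fin c → Fin 2))}
    (hg : 0 < g) (hg1 : g ≤ 1 / 2) (hδ₂ : δ₂ = g / 8) (hδ₁0 : 0 < δ₁) (hδ₁r : δ₁ * r = g / 32)
    (hrK : 36 * K ≤ r * δ₂) (hb : δ₂ ≤ b * δ₁) (hkD : k = 2 * D) (hD1 : (1 : ℝ) ≤ D)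
    (hDb : 2 * b ≤ D * δ₁) (hDbb : 16 * (b * b) ≤ D * δ₂) (hDc : D ≤ δ₂ / 96 * c)
    (hc4 : 4 ≤ c)
    (hpoly : 32 * (6 + 4 * r) * (c : ℝ) ^ 3 ≤ (2 : ℝ) ^ (3 / 2 * g * c))
    (h18 : 18 * (c : ℝ) ^ 2 ≤ (2 : ℝ) ^ c)
    (hp₀p : (2 : ℝ) ^ (-(2 * c / (D : ℝ))) ≤ p) (hp1 : p ≤ 1)
    (hge : ((2 : ℝ) ^ c) ^ 2 ≤ U.card) (hle : (U.card : ℝ) ≤ 2 * c ^ 2 * (2 ^ c) ^ 2)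
    (hU : ∀ I J x, tupleEdges I J x ⊆ U)
    (hF : (𝓕.card : ℝ) ≤ Real.exp ((2 : ℝ) ^ ((2 - 2 * g) * c))) :
    ((U.card + 1 : ℕ) : ℝ) * binomProb p U (fun S =>
      SearchTree 𝓕 (CoveredBy (UsesNonEdge S) 12) (3 * (3 * c * K)) Finset.univ) ≤
        Real.exp (-2 ^ c) := by
  have hδ₂0 : 0 < δ₂ := by rw [hδ₂]; positivity
  have hδ₂1 : δ₂ ≤ 1 / 16 := by rw [hδ₂]; linarith
  have hc1 : 1 ≤ c := by omega
  have hcR : (4 : ℝ) ≤ c := by exact_mod_cast hc4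
  have hu0 : (0 : ℝ) < U.card := lt_of_lt_of_le (by positivity) hge
  have hD0 : (0 : ℝ) < D := by linarith
  have hp0 : 0 < p := lt_of_lt_of_le (by positivity) hp₀p
  have two : ∀ y z : ℝ, (2 : ℝ) ^ y * (2 : ℝ) ^ z = (2 : ℝ) ^ (y + z) := fun y z =>
    (Real.rpow_add (by norm_num) y z).symm
  have twopow : ∀ (y : ℝ) (j : ℕ), ((2 : ℝ) ^ y) ^ j = (2 : ℝ) ^ (y * j) := fun y j => by
    rw [← Real.rpow_natCast, ← Real.rpow_mul (by norm_num)]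
  have twole : ∀ y z : ℝ, y ≤ z → (2 : ℝ) ^ y ≤ (2 : ℝ) ^ z := fun y z h =>
    Real.rpow_le_rpow_of_exponent_le (by norm_num) h
  have twolt : ∀ y z : ℝ, y < z → (2 : ℝ) ^ y < (2 : ℝ) ^ z := fun y z h =>
    Real.rpow_lt_rpow_of_exponent_lt (by norm_num) h
  have twoc : (2 : ℝ) ^ c = (2 : ℝ) ^ (c : ℝ) := (Real.rpow_natCast 2 c).symm
  have hpj : ∀ (j : ℕ) (a : ℝ), 2 * j ≤ a * D → (2 : ℝ) ^ (-(a * c)) ≤ p ^ j := by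
    intro j a haD
    refine le_trans ?_ (pow_le_pow_left₀ (by positivity) hp₀p j)
    rw [twopow]
    refine twole _ _ ?_
    rw [neg_mul, neg_le_neg_iff, div_mul_eq_mul_div, div_le_iff₀ hD0]
    nlinarith
  have hk2c : k ≤ 2 * c := by
    have : (D : ℝ) ≤ c := by nlinarith
    have : D ≤ c := by exact_mod_cast this
    omega
  obtain ⟨κ, hκ⟩ : ∃ κ : ℝ, κ = p ^ (b * b) / (16 * 8 ^ Fintype.card (Fin k)) := ⟨_, rfl⟩
  have hκ0 : 0 < κ := by rw [hκ]; positivity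
  -- The power p ^ (b²) and the constant 16 · 8 ^ k each cost at most N ^ (δ₂ / 8).
  have hκge : (2 : ℝ) ^ (-(δ₂ / 4 * c)) ≤ κ := by
    have h1 := hpj (b * b) (δ₂ / 8) (by push_cast; linarith)
    have h2 : (16 * 8 ^ Fintype.card (Fin k) : ℝ) ≤ (2 : ℝ) ^ (δ₂ / 8 * c) := by
      have h3 : (16 * 8 ^ Fintype.card (Fin k) : ℝ) = (2 : ℝ) ^ ((4 + 6 * D : ℕ) : ℝ) := by
        rw [Real.rpow_natCast, Fintype.card_fin, hkD, pow_add, pow_mul 2 6 D, pow_mul 8 2 D]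
        norm_num
      rw [h3]
      refine twole _ _ ?_
      push_cast
      linarith
    rw [hκ, le_div_iff₀ (by positivity)]
    calc _ ≤ (2 : ℝ) ^ (-(δ₂ / 4 * c)) * (2 : ℝ) ^ (δ₂ / 8 * c) := by gcongr
      _ = (2 : ℝ) ^ (-(δ₂ / 8 * c)) := by rw [two]; congr 1; ring
      _ ≤ _ := h1
  obtain ⟨q, hqle, hqge⟩ : ∃ q : ℕ, (q : ℝ) ≤ δ₂ * c / 2 ∧ δ₂ * c / 4 ≤ q := by
    refine ⟨⌊δ₂ * c / 2⌋₊, Nat.floor_le (by positivity), ?_⟩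
    have := (Nat.lt_floor_add_one (δ₂ * c / 2)).le
    linarith
  have hqc : q ≤ c := by
    have : (q : ℝ) ≤ c := by nlinarith
    exact_mod_cast this
  have hη : (2 : ℝ) ^ (-(3 / 4 * δ₂ * c)) ≤ κ / 2 ^ q := by
    rw [le_div_iff₀ (by positivity), ← Real.rpow_natCast 2 q, two]
    exact (twole _ _ (by linarith)).trans hκge
  -- A round loses N ^ (2 δ₁) in spread: one N ^ δ₁ to isolate the nearly determined blocks, giving
  -- ρ', and another to pay for p ^ (-b).
  obtain ⟨ρ, hρ⟩ : ∃ ρ : ℕ → ℝ, ∀ i, ρ i = (2 : ℝ) ^ ((2 * δ₁ * i - 1) * c) :=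
    ⟨_, fun _ => rfl⟩
  obtain ⟨ρ', hρ'⟩ : ∃ ρ' : ℕ → ℝ, ∀ i, ρ' i = (2 : ℝ) ^ ((2 * δ₁ * i - 1 + δ₁) * c) :=
    ⟨_, fun _ => rfl⟩
  have hρpos : ∀ i, 0 < ρ i := fun i => by rw [hρ]; positivity
  have hρ'pos : ∀ i, 0 < ρ' i := fun i => by rw [hρ']; positivity
  have hcardB : Fintype.card (Fin c → Fin 2) = 2 ^ c := by simp
  have hdrq : 3 * (3 * c * K) ≤ r * q := by
    have : ((3 * (3 * c * K) : ℕ) : ℝ) ≤ r * q := by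
      push_cast
      have h1 : (r : ℝ) * (δ₂ * c / 4) ≤ r * q := by gcongr
      have h2 : (36 * K) * c ≤ r * δ₂ * c := by gcongr
      linarith
    exact_mod_cast this
  have hprob := binomExp_searchTree_le (K := Fin k) (B := Fin c → Fin 2) (𝓕 := 𝓕)
    (U := U) (ρ := ρ) (ρ' := ρ') (κ := κ) (p := p) (n := 12) (r := r) (q := q)
    (b := b) hp0 hp1 hκ
    (by
      simp only [hρ, hcardB, Nat.cast_zero, mul_zero, zero_sub, Nat.cast_pow, Nat.cast_ofNat]
      rw [twoc, one_div, ← Real.rpow_neg (by norm_num)]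
      congr 1; ring)
    hρpos
    (fun i hi => by
      refine lt_of_lt_of_le ?_ hη
      have hi' : δ₁ * i ≤ δ₁ * r := by gcongr
      have h16 : ((12 : ℕ) : ℝ) ≤ (2 : ℝ) ^ (4 : ℝ) := by norm_num
      calc ((12 : ℕ) : ℝ) * ρ i ^ 2 ≤ (2 : ℝ) ^ (4 : ℝ) * ρ i ^ 2 := by gcongr
        _ = (2 : ℝ) ^ (4 + (2 * δ₁ * i - 1) * c * (2 : ℕ)) := by
            rw [hρ, twopow, two]
        _ < _ := by
            refine twolt _ _ ?_
            push_cast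
            have h1 : 2 * δ₁ * i - 1 ≤ -(31 / 32) := by linarith
            nlinarith)
    hdrq
    (fun i => by rw [hρ, hρ']; exact twole _ _ (by nlinarith))
    (fun i => by
      refine lt_of_lt_of_le ?_ (mul_le_mul_of_nonneg_right hη (pow_nonneg (hρ'pos i).le _))
      rw [hρ, hρ', twopow, twopow, two]
      refine twolt _ _ ?_
      push_cast
      have h1 : 3 / 4 * δ₂ < δ₁ * (b + 1) := by nlinarith
      have h2 : 3 / 4 * δ₂ * c < δ₁ * (b + 1) * c := by gcongr
      linarith)
    (fun i => by
      refine le_trans ?_ (mul_le_mul_of_nonneg_left (hpj b δ₁ (by linarith)) (hρpos _).le)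
      rw [hρ, hρ', two]
      refine twole _ _ (le_of_eq ?_)
      push_cast; ring)
    (by
      rw [hρ]
      refine Real.rpow_le_one_of_one_le_of_nonpos (by norm_num) ?_
      nlinarith)
    (fun I J z _ => hU I J z)
    (by rw [hcardB]; push_cast; exact hge)
  refine (mul_le_mul_of_nonneg_left hprob (Nat.cast_nonneg _)).trans ?_
  rw [hcardB, Fintype.card_fin]
  obtain ⟨T, hT⟩ : ∃ T : ℝ, T = (2 : ℝ) ^ ((2 - 2 * g) * c) := ⟨_, rfl⟩
  rw [← hT] at hF
  refine union_bound_le (T := T) hc1 hk2c hqc ?_ hF ?_ ?_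
  -- N ≤ N ^ (2 - 2g) because g ≤ 1/2, so the number of boxes is dominated by the term from F.
  · rw [twoc, hT]
    exact twole _ _ (by nlinarith)
  · have h1 := Real.pow_div_factorial_le_exp (x := (2 : ℝ) ^ c) (by positivity) 3
    refine le_trans ?_ h1
    have h2 : (1 : ℝ) ≤ c ^ 2 * (2 ^ c) ^ 2 := by
      have h1 : (1 : ℝ) ≤ (c : ℝ) ^ 2 := one_le_pow₀ (by linarith)
      have h2 : (1 : ℝ) ≤ ((2 : ℝ) ^ c) ^ 2 := one_le_pow₀ (one_le_pow₀ (by norm_num))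
      nlinarith
    have h3 : ((Nat.factorial 3 : ℕ) : ℝ) = 6 := by norm_num [Nat.factorial]
    rw [h3, le_div_iff₀ (by norm_num)]
    push_cast
    have h4 : (18 * (c : ℝ) ^ 2) * (2 ^ c) ^ 2 ≤ 2 ^ c * (2 ^ c) ^ 2 := by gcongr
    nlinarith
  · have hρr : ρ r ^ 4 = (2 : ℝ) ^ ((g / 4 - 4) * c) := by
      rw [hρ, twopow]
      congr 1; push_cast
      linear_combination (8 * c : ℝ) * hδ₁r
    have hηκ : (2 : ℝ) ^ (-(δ₂ * c)) ≤ κ / 2 ^ q * κ := by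
      calc (2 : ℝ) ^ (-(δ₂ * c)) = (2 : ℝ) ^ (-(3 / 4 * δ₂ * c)) * (2 : ℝ) ^ (-(δ₂ / 4 * c)) := by
            rw [two]; congr 1; ring
        _ ≤ _ := by gcongr
    have hρr0 := hρpos r
    have hT0 : 0 < T := by rw [hT]; positivity
    rw [le_div_iff₀ (by positivity)]
    -- Apart from the polynomial in c, the left side has exponent (2 - 2g) + 2 + (g/4 - 4) = -7g/4,
    -- and the right side -2 δ₂ = -g/4. The slack 3g/2 absorbs the polynomial.
    calc (6 + 4 * r) * c * T * (16 * (U.card * ρ r ^ 4))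
        ≤ (6 + 4 * r) * c * T * (16 * ((2 * c ^ 2 * (2 ^ c) ^ 2) * ρ r ^ 4)) := by gcongr
      _ = (32 * (6 + 4 * r) * c ^ 3) * (T * ((2 ^ c) ^ 2 * ρ r ^ 4)) := by ring
      _ ≤ (2 : ℝ) ^ (3 / 2 * g * c) * (T * ((2 ^ c) ^ 2 * ρ r ^ 4)) := by gcongr
      _ = ((2 : ℝ) ^ (-(δ₂ * c))) ^ 2 := by
          rw [hρr, hT, twoc, twopow, twopow, two, two, two, hδ₂]
          congr 1; push_cast; ring
      _ ≤ _ := by gcongr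

/-- A random clique formula has no short tree-like refutations. -/
lemma eventually_requiresLength (hε : 0 < ε) (hε1 : ε < 1) {g : ℝ} (hg : 0 < g) (hg1 : g ≤ 1 / 2)
    (K : ℕ) : ∀ᶠ c : ℕ in atTop, ∀ (n : ℕ) (x : CliqueVar (cliqueParam ε (2 ^ c)) c 2 ↪ Fin n)
      (F : Finset (BoolFn n)), (F.card : ℝ) ≤ Real.exp ((2 : ℝ) ^ ((2 - 2 * g) * c)) →
      1 - Real.exp (-2 ^ c) ≤ uniformProb (cliqueFamily x (edgeParam ε (2 ^ c)))
        fun A => RequiresLength F A (CNF.size A ^ K) := by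
  obtain ⟨δ₂, hδ₂⟩ : ∃ δ₂ : ℝ, δ₂ = g / 8 := ⟨_, rfl⟩
  have hδ₂0 : 0 < δ₂ := by rw [hδ₂]; positivity
  -- Each round answers at least δ₂ c / 4 queries, so this constant number of rounds exhausts depth
  -- 9 c K.
  obtain ⟨r, hr⟩ : ∃ r : ℕ, 36 * K / δ₂ + 1 ≤ r := exists_nat_ge _
  have hr1 : (1 : ℝ) ≤ r := by
    have : 0 ≤ 36 * K / δ₂ := by positivity
    linarith
  have hrK : 36 * K ≤ r * δ₂ := by
    rw [← div_le_iff₀ hδ₂0]; linarith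
  -- All r rounds together then lose only N ^ (g/16) in spread.
  obtain ⟨δ₁, hδ₁⟩ : ∃ δ₁ : ℝ, δ₁ = g / (32 * r) := ⟨_, rfl⟩
  have hδ₁0 : 0 < δ₁ := by rw [hδ₁]; positivity
  have hδ₁r : δ₁ * r = g / 32 := by rw [hδ₁]; field_simp
  obtain ⟨b, hb⟩ : ∃ b : ℕ, δ₂ / δ₁ ≤ b := exists_nat_ge _
  rw [div_le_iff₀ hδ₁0] at hb
  have hDtop := tendsto_densityParam hε
  filter_upwards [hDtop.eventually_ge_atTop 1, hDtop.eventually_ge_atTop (2 * b / δ₁),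
    hDtop.eventually_ge_atTop (16 * (b * b) / δ₂),
    eventually_densityParam_le hε1 (a := δ₂ / 96) (by positivity),
    eventually_mul_pow_le_rpow (32 * (6 + 4 * r)) 3 (a := 3 / 2 * g) (by positivity),
    eventually_mul_pow_le_rpow 18 2 one_pos, eventually_size_le hε1 one_pos,
    eventually_ge_atTop 4] with c hD1 hDb hDbb hDc hpoly h18 hsize hc4 n x F hF
  have hc1 : 1 ≤ c := by omega
  have hDnat : 1 ≤ densityParam ε (2 ^ c) := by exact_mod_cast hD1
  have hDlec := densityParam_le hε1 hc1
  obtain ⟨hu0, hMu, hp₀p, hp1, -⟩ := edgeParam_bounds hDnat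
  have hge := card_crossEdges_ge hDnat
  have hle := card_crossEdges_le hDlec
  rw [div_le_iff₀ hδ₁0] at hDb
  rw [div_le_iff₀ hδ₂0] at hDbb
  rw [one_mul, Real.rpow_natCast] at h18
  have hFle : ((F.image fun f => ({z | f (tupleAssignment x z) = true} :
      Finset (Fin (cliqueParam ε (2 ^ c)) → Fin c → Fin 2))).card : ℝ) ≤
        Real.exp ((2 : ℝ) ^ ((2 - 2 * g) * c)) :=
    le_trans (by exact_mod_cast Finset.card_image_le) hF
  have hprob := binomProb_searchTree_le_exp (K := K) hg hg1 hδ₂ hδ₁0 hδ₁r hrK hb rfl hD1 hDb hDbb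
    hDc hc4 hpoly h18 hp₀p hp1 hge hle tupleEdges_subset_crossEdges hFle
  have hfinal := one_sub_le_uniformProb_cliqueFamily x hc1 two_pos hMu hu0
    (P := fun A => RequiresLength F A (CNF.size A ^ K))
    -- The size is at most 2 ^ (3c), so lengths below its K-th power balance to depth 9 c K.
    (fun S _ _ h => searchTree_of_not_requiresLength (d := 3 * (3 * c * K)) x h (by
      refine le_trans ?_ (two_pow_three_mul_le (3 * c * K))
      push_cast
      rw [pow_mul]
      refine pow_le_pow_left₀ (Nat.cast_nonneg _) ((hsize n x S).trans (le_of_eq ?_)) K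
      rw [← Real.rpow_natCast]
      congr 1; push_cast; ring))
  exact (sub_le_sub_left hprob 1).trans hfinal

end LowerBound

/-! ### Choice of c(n) and conclusion. -/

lemma tendsto_uniformProb_of_le {c : ℕ → ℕ} (hc : Tendsto c atTop atTop)
    {𝒜 : (n : ℕ) → Set (CNF (Fin n))} (h𝒜 : ∀ n, (𝒜 n).Finite)
    {P : (n : ℕ) → CNF (Fin n) → Prop} {err : ℕ → ℝ} (herr : Tendsto err atTop (𝓝 0))
    (h : ∀ᶠ n in atTop, 1 - err (c n) ≤ uniformProb (𝒜 n) (P n)) :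
    Tendsto (fun n => uniformProb (𝒜 n) (P n)) atTop (𝓝 1) := by
  have h1 : Tendsto (fun n => 1 - err (c n)) atTop (𝓝 1) := by
    simpa using (herr.comp hc).const_sub 1
  exact tendsto_of_tendsto_of_tendsto_of_le_of_le' h1 tendsto_const_nhds h
    (Eventually.of_forall fun n => uniformProb_le_one (h𝒜 n) _)

/-- The choice of the number of coordinates of a vertex. -/
lemma eventually_coordinates {ε : ℝ} (hε : 0 < ε) (hε1 : ε < 1) {s : ℕ → ℝ}
    (hs : ∀ᶠ n : ℕ in atTop,
      (n : ℝ) ^ (2 - ε) ≤ s n ∧ s n ≤ (2 : ℝ) ^ ((n : ℝ) ^ (1 - ε))) :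
    ∃ c : ℕ → ℕ, Tendsto c atTop atTop ∧ ∀ᶠ n : ℕ in atTop,
      s n ≤ (2 : ℝ) ^ (4 / (2 + ε) * c n) ∧
      (2 : ℝ) ^ ((2 + ε / (2 + ε)) * c n) ≤ s n ^ (1 + ε) ∧
      2 * densityParam ε (2 ^ c n) * (c n * 2) ≤ n := by
  set l : ℕ → ℝ := fun n => Real.logb 2 (s n) with hl
  have hspos : ∀ᶠ n : ℕ in atTop, 0 < s n ∧ (2 : ℝ) ^ l n = s n := by
    filter_upwards [hs, eventually_ge_atTop 1] with n hn hn1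
    have hn0 : (0 : ℝ) < n := by exact_mod_cast hn1
    have : 0 < s n := lt_of_lt_of_le (by positivity) hn.1
    exact ⟨this, Real.rpow_logb (by norm_num) (by norm_num) this⟩
  have hltop : Tendsto l atTop atTop := by
    have h1 : Tendsto (fun n : ℕ => (2 - ε) * Real.logb 2 (n : ℝ)) atTop atTop :=
      ((Real.tendsto_logb_atTop (by norm_num)).comp tendsto_natCast_atTop_atTop).const_mul_atTop
        (by linarith)
    refine tendsto_atTop_mono' atTop ?_ h1
    filter_upwards [hs, eventually_ge_atTop 1] with n hn hn1
    have hn0 : (0 : ℝ) < n := by exact_mod_cast hn1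
    rw [← Real.logb_rpow_eq_mul_logb_of_pos hn0]
    exact Real.logb_le_logb_of_le (by norm_num) (by positivity) hn.1
  have hle : ∀ᶠ n : ℕ in atTop, l n ≤ (n : ℝ) ^ (1 - ε) := by
    filter_upwards [hs, hspos] with n hn hn'
    rw [← hn'.2] at hn
    exact (Real.rpow_le_rpow_left_iff (by norm_num)).1 hn.2
  set θ : ℝ := (2 + ε) / 4 with hθ
  have hθ0 : 0 < θ := by positivity
  have hθ1 : θ ≤ 1 := by rw [hθ]; linarith
  set c : ℕ → ℕ := fun n => ⌈θ * l n⌉₊ with hc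
  have hcge : ∀ n, θ * l n ≤ c n := fun n => Nat.le_ceil _
  have hctop : Tendsto c atTop atTop := by
    refine tendsto_natCast_atTop_iff (R := ℝ) |>.1 ?_
    exact tendsto_atTop_mono hcge (hltop.const_mul_atTop hθ0)
  refine ⟨c, hctop, ?_⟩
  have hnpow : Tendsto (fun n : ℕ => (n : ℝ) ^ (ε ^ 2)) atTop atTop :=
    (tendsto_rpow_atTop (by positivity)).comp tendsto_natCast_atTop_atTop
  filter_upwards [hspos, hle, hltop.eventually_ge_atTop (12 / ε), eventually_ge_atTop 1,
    hnpow.eventually_ge_atTop 16] with n hsn hln hl12 hn1 hn16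
  have hn0 : (1 : ℝ) ≤ n := by exact_mod_cast hn1
  rw [div_le_iff₀ hε] at hl12
  have hl0 : 0 < l n := by
    by_contra h
    nlinarith
  have hcle : (c n : ℝ) ≤ θ * l n + 1 := (Nat.ceil_lt_add_one (by positivity)).le
  refine ⟨?_, ?_, ?_⟩
  · rw [← hsn.2]
    refine Real.rpow_le_rpow_of_exponent_le (by norm_num) ?_
    have := hcge n
    rw [div_mul_eq_mul_div, le_div_iff₀ (by positivity)]
    rw [hθ] at this
    linarith
  · rw [← hsn.2, ← Real.rpow_mul (by norm_num)]
    refine Real.rpow_le_rpow_of_exponent_le (by norm_num) ?_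
    -- This leaves ε / 4 · log₂ s for the rounding of c, which costs at most 3. Hence the threshold
    -- 12 / ε.
    have h1 : (2 + ε / (2 + ε)) * θ = 1 + 3 / 4 * ε := by rw [hθ]; field_simp; ring
    have h2 : ε / (2 + ε) ≤ 1 := by rw [div_le_one (by positivity)]; linarith
    have h3 : 0 ≤ ε / (2 + ε) := by positivity
    calc (2 + ε / (2 + ε)) * c n ≤ (2 + ε / (2 + ε)) * (θ * l n + 1) := by gcongr
      _ = ((2 + ε / (2 + ε)) * θ) * l n + (2 + ε / (2 + ε)) := by ring
      _ ≤ l n * (1 + ε) := by rw [h1]; nlinarith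
  · have hnε : (1 : ℝ) ≤ (n : ℝ) ^ (1 - ε) := Real.one_le_rpow hn0 (by linarith)
    have hc2 : (c n : ℝ) ≤ 2 * (n : ℝ) ^ (1 - ε) := by nlinarith
    have hc0 : (0 : ℝ) < c n := lt_of_lt_of_le (by positivity) (hcge n)
    have h4 : 2 * (densityParam ε (2 ^ c n) : ℝ) * (c n * 2) ≤ n := by
      -- The number of variables is at most 4 c ^ (1 + ε), which is O(n ^ ((1 - ε)(1 + ε))) = O(n ^
      -- (1 - ε²)). The spare n ^ (ε²) absorbs the constant, so ε₀ = ε suffices.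
      calc 2 * (densityParam ε (2 ^ c n) : ℝ) * (c n * 2)
          ≤ 2 * (c n : ℝ) ^ ε * (c n * 2) := by
            have := densityParam_le_rpow ε (c n)
            gcongr
        _ = 4 * (c n : ℝ) ^ (1 + ε) := by
            rw [Real.rpow_add hc0, Real.rpow_one]; ring
        _ ≤ 4 * (2 * (n : ℝ) ^ (1 - ε)) ^ (1 + ε) := by gcongr
        _ = 4 * (2 : ℝ) ^ (1 + ε) * (n : ℝ) ^ (1 - ε ^ 2) := by
            rw [Real.mul_rpow (by norm_num) (by positivity), ← Real.rpow_mul (by positivity)]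
            ring_nf
        _ ≤ 4 * 4 * (n : ℝ) ^ (1 - ε ^ 2) := by
            have : (2 : ℝ) ^ (1 + ε) ≤ (2 : ℝ) ^ (2 : ℝ) :=
              Real.rpow_le_rpow_of_exponent_le (by norm_num) (by linarith)
            have h22 : (2 : ℝ) ^ (2 : ℝ) = 4 := by norm_num
            rw [h22] at this
            gcongr
        _ ≤ (n : ℝ) ^ (ε ^ 2) * (n : ℝ) ^ (1 - ε ^ 2) := by gcongr; linarith
        _ = n := by
            rw [← Real.rpow_add (by linarith)]; simp
    exact_mod_cast h4

theorem theorem1p3 (ε : ℝ) (hε_pos : 0 < ε) (hε_lt : ε < 1) :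
    ∃ ε₀ : ℝ, 0 < ε₀ ∧ ∀ s : ℕ → ℝ,
      (∀ᶠ n : ℕ in atTop,
        (n : ℝ) ^ (2 - ε) ≤ s n ∧ s n ≤ (2 : ℝ) ^ ((n : ℝ) ^ (1 - ε))) →
      ∃ (m c : ℕ → ℕ) (𝒜 : (n : ℕ) → Set (CNF (Fin n))),
        -- the family consists of interpolated clique formulas
        (∀ᶠ n : ℕ in atTop,
          s n ≤ ((m n ^ c n : ℕ) : ℝ) ^ 2 ∧ ((m n ^ c n : ℕ) : ℝ) ^ 2 ≤ s n ^ (1 + ε) ∧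
          ∃ x : CliqueVar (cliqueParam ε₀ (m n ^ c n)) (c n) (m n) ↪ Fin n,
            𝒜 n = cliqueFamily x (edgeParam ε₀ (m n ^ c n))) ∧
        -- the size bound
        (∀ᶠ n : ℕ in atTop, ∀ A ∈ 𝒜 n, (CNF.size A : ℝ) ≤ s n ^ (1 + ε)) ∧
        -- a uniformly random member is asymptotically almost surely unsatisfiable
        Tendsto (fun n => uniformProb (𝒜 n) fun A => ¬ CNF.Satisfiable A) atTop (𝓝 1) ∧
        -- the superpolynomial lower bound
        ∀ F : (n : ℕ) → Finset (BoolFn n),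
          (∀ᶠ n : ℕ in atTop, ((F n).card : ℝ) ≤ Real.exp (s n)) →
          ∀ K : ℕ, Tendsto
            (fun n => uniformProb (𝒜 n) fun A => RequiresLength (F n) A (CNF.size A ^ K))
            atTop (𝓝 1) := by
  refine ⟨ε, hε_pos, fun s hs => ?_⟩
  obtain ⟨c, hctop, hc⟩ := eventually_coordinates hε_pos hε_lt hs
  set g : ℝ := ε / (2 + ε) with hg
  have hg0 : 0 < g := by positivity
  have hg1 : g ≤ 1 / 2 := by rw [hg, div_le_iff₀ (by positivity)]; linarith
  have hg2 : 4 / (2 + ε) = 2 - 2 * g := by rw [hg]; field_simp; ring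
  rw [hg2] at hc
  let Emb : ℕ → Type := fun n => CliqueVar (cliqueParam ε (2 ^ c n)) (c n) 2 ↪ Fin n
  -- The empty default only concerns those n, finitely many, for which the variables do not fit.
  let 𝒜 : (n : ℕ) → Set (CNF (Fin n)) := fun n =>
    open Classical in if h : Nonempty (Emb n) then
      cliqueFamily h.some (edgeParam ε (2 ^ c n)) else ∅
  have hfin : ∀ n, (𝒜 n).Finite := fun n => by
    dsimp only [𝒜]
    split_ifs
    · exact cliqueFamily_finite _ _
    · exact Set.finite_empty
  have hemb : ∀ᶠ n in atTop, ∃ x : Emb n, 𝒜 n = cliqueFamily x (edgeParam ε (2 ^ c n)) := by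
    filter_upwards [hc] with n hn
    have h : Nonempty (Emb n) := Function.Embedding.nonempty_of_card_le (by
      rw [Fintype.card_fin]
      refine le_of_eq_of_le ?_ hn.2.2
      exact (Fintype.card_prod _ _).trans (by simp only [Fintype.card_prod, Fintype.card_fin]; rfl))
    exact ⟨h.some, dif_pos h⟩
  have two : ∀ n, ((2 ^ c n : ℕ) : ℝ) ^ 2 = (2 : ℝ) ^ (2 * c n : ℝ) := fun n => by
    rw [Nat.cast_pow, ← pow_mul, Nat.cast_ofNat, ← Real.rpow_natCast]
    congr 1; push_cast; ring
  have hmono : ∀ y z : ℝ, y ≤ z → (2 : ℝ) ^ y ≤ (2 : ℝ) ^ z := fun y z h =>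
    Real.rpow_le_rpow_of_exponent_le (by norm_num) h
  refine ⟨fun _ => 2, c, 𝒜, ?_, ?_, ?_, ?_⟩
  · filter_upwards [hc, hemb] with n hn hx
    have hc0 : (0 : ℝ) ≤ c n := Nat.cast_nonneg _
    refine ⟨?_, ?_, hx⟩
    · rw [two]
      exact hn.1.trans (hmono _ _ (by nlinarith))
    · rw [two]
      exact (hmono _ _ (by nlinarith)).trans hn.2.1
  · filter_upwards [hc, hemb, hctop.eventually (eventually_size_le hε_lt hg0)]
      with n hn hx hsize A hA
    obtain ⟨x, hx⟩ := hx
    rw [hx, cliqueFamily_eq] at hA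
    obtain ⟨S, -, rfl⟩ := hA
    exact (hsize n x S).trans hn.2.1
  · refine tendsto_uniformProb_of_le hctop hfin (err := fun c => 9 * (c : ℝ) ^ 2 / 2 ^ c) ?_ ?_
    · simpa [mul_div_assoc] using
        (tendsto_pow_const_div_const_pow_of_one_lt 2 (one_lt_two (α := ℝ))).const_mul 9
    · filter_upwards [hemb, hctop.eventually (eventually_unsat hε_pos hε_lt)] with n hx hn
      obtain ⟨x, hx⟩ := hx
      rw [hx]
      exact hn n x
  · intro F hF K
    refine tendsto_uniformProb_of_le hctop hfin (err := fun c => Real.exp (-2 ^ c)) ?_ ?_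
    · exact Real.tendsto_exp_neg_atTop_nhds_zero.comp
        (tendsto_pow_atTop_atTop_of_one_lt (one_lt_two (α := ℝ)))
    · filter_upwards [hemb, hF, hc,
        hctop.eventually (eventually_requiresLength hε_pos hε_lt hg0 hg1 K)] with n hx hFn hcn hn
      obtain ⟨x, hx⟩ := hx
      rw [hx]
      exact hn n x (F n) (hFn.trans (Real.exp_le_exp.2 hcn.1))
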